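/- Let $d\ge 1$, $\lambda>0$, and let $|\cdot|$ be the $1$-norm on $\mathbb{Z}^d$. Let $(k_x)_{x\in\mathbb{Z}^d}$ be i.i.d. real random variables whose common distribution is absolutely continuous with a bounded density $\nu$ and has support $[0,k_{\max}]$, $k_{\max}<\infty$; $\mathbb{E}$ denotes the expectation over them. For a non-empty finite box $\Lambda=([a_1,b_1]\times\dots\times[a_d,b_d])\cap\mathbb{Z}^d$ consider on $L^2(\mathbb{R}^\Lambda)$ the Hamiltonian (the closure of its restriction to Schwartz functions) $$H_\Lambda=\sum_{x\in\Lambda}\Big(p_x^2+\frac{k_x}{2}q_x^2\Big)+\sum_{\{x,y\}\subset\Lambda,\ |x-y|=1}\lambda(q_x-q_y)^2,$$ where $q_x$ and $p_x=-i\,\partial/\partial q_x$ are the position and momentum operators, and on $\ell^2(\Lambda)$ the matrix $h_\Lambda=\lambda h_{0,\Lambda}+\frac12 k$, where $h_{0,\Lambda}$ is the negative discrete (graph) Laplacian of $\Lambda$ with nearest-neighbor edges and $k$ is multiplication by $k_x$. Assume that there are constants $C_0<\infty$ and $\eta>0$ such that for all boxes $\Lambda$ and all $x,y\in\Lambda$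 $$\mathbb{E}\Big(\sup_{|g|\le 1}\big|\langle\delta_x,h_\Lambda^{-1/2}g(h_\Lambda)\delta_y\rangle\big|^{1/2}\Big)\le C_0e^{-\eta|x-y|},$$ the supremum being over all functions $g:\mathbb{R}\to\mathbb{C}$ with $|g|\le 1$. For $(n_x)_{x\in\Lambda}\in\mathbb{N}_0^{\Lambda}$ let $\rho=\bigotimes_{x\in\Lambda}|\phi_{n_x}\rangle\langle\phi_{n_x}|$ be the product of the eigenstates of the single-site oscillators $p_x^2+\frac{k_x}{2}q_x^2$ given by the Hermite functions $$\phi_{n_x}(q_x)=\frac{1}{\sqrt{2^{n_x}n_x!}}\Big(\frac{\sqrt{2k_x}}{2\pi}\Big)^{1/4}H_{n_x}\Big(\sqrt[4]{\tfrac{k_x}{2}}\,q_x\Big)e^{-\frac{\sqrt{2k_x}}{4}q_x^2},$$ where $H_n$ is the $n$-th (physicists') Hermite polynomial. Put $N=\max_{x\in\Lambda}n_x$. Let $\rho_t=e^{-itH_\Lambda}\rho e^{itH_\Lambda}$, $\langle A\rangle_{\rho_t}=\operatorname{Tr}[A\rho_t]$, and for $x,y\in\Lambda$, with $(r_1,r_2)=(q_x,p_x)$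 and $(r_1',r_2')=(q_y,p_y)$, let $$(\tilde\Gamma_\rho(t))_{xy}=\Big(\langle r_i r_j'\rangle_{\rho_t}-\langle r_i\rangle_{\rho_t}\langle r_j'\rangle_{\rho_t}\Big)_{i,j=1,2}\in\mathbb{C}^{2\times 2},$$ with $\|\cdot\|$ the Euclidean operator norm. Then these quantities are almost surely well defined, and there is a constant $C<\infty$, independent of $\Lambda$, of $(n_x)$ (in particular of $N$) and of $x,y$, such that for all non-empty boxes $\Lambda$, all $(n_x)\in\mathbb{N}_0^\Lambda$ and all $x,y\in\Lambda$ $$\mathbb{E}\Big(\sup_{t\in\mathbb{R}}\|(\tilde\Gamma_\rho(t))_{xy}\|^{1/6}\Big)\le C\,(1+2N)^{1/6}\,e^{-\frac{\eta}{6}|x-y|}.$$ -/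

import Mathlib

open MeasureTheory ProbabilityTheory
open scoped ENNReal SchwartzMap LineDeriv

noncomputable section

namespace Oscillator

/-! ### Unbounded operators, unitary groups and expectations on a Hilbert space -/

section Hilbert

variable {𝓗 : Type*} [NormedAddCommGroup 𝓗] [InnerProductSpace ℂ 𝓗]

/-- The product `A B` of two unbounded operators, with its natural domain
`{ψ ∈ D(B) : B ψ ∈ D(A)}`. -/
def opMul (A B : 𝓗 →ₗ.[ℂ] 𝓗) : 𝓗 →ₗ.[ℂ] 𝓗 where
  domain :=
    { carrier := {ψ | ∃ h : ψ ∈ B.domain, B ⟨ψ, h⟩ ∈ A.domain}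
      zero_mem' := ⟨B.domain.zero_mem, by
        have h : B ⟨0, B.domain.zero_mem⟩ = 0 := B.map_zero
        rw [h]; exact A.domain.zero_mem⟩
      add_mem' := by
        rintro a b ⟨ha, ha'⟩ ⟨hb, hb'⟩
        refine ⟨B.domain.add_mem ha hb, ?_⟩
        have h : B ⟨a + b, B.domain.add_mem ha hb⟩ = B ⟨a, ha⟩ + B ⟨b, hb⟩ :=
          B.map_add ⟨a, ha⟩ ⟨b, hb⟩
        rw [h]; exact A.domain.add_mem ha' hb'
      smul_mem' := by
        rintro c a ⟨ha, ha'⟩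
        refine ⟨B.domain.smul_mem c ha, ?_⟩
        have h : B ⟨c • a, B.domain.smul_mem c ha⟩ = c • B ⟨a, ha⟩ :=
          B.map_smul c ⟨a, ha⟩
        rw [h]; exact A.domain.smul_mem c ha' }
  toFun :=
    { toFun := fun ψ => A ⟨B ⟨ψ.1, ψ.2.1⟩, ψ.2.2⟩
      map_add' := by
        rintro ⟨a, ha, ha'⟩ ⟨b, hb, hb'⟩
        rw [← A.map_add]
        congr 1
        exact Subtype.ext (B.map_add ⟨a, ha⟩ ⟨b, hb⟩)
      map_smul' := by
        rintro c ⟨a, ha, ha'⟩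
        rw [RingHom.id_apply, ← A.map_smul]
        congr 1
        exact Subtype.ext (B.map_smul c ⟨a, ha⟩) }

/-- `U` is the strongly continuous one-parameter unitary group `t ↦ e^{-itA}` generated by `A`.
For a self-adjoint operator `A` there is exactly one such `U`. -/
structure IsUnitaryGroup (A : 𝓗 →ₗ.[ℂ] 𝓗) (U : ℝ → 𝓗 →L[ℂ] 𝓗) : Prop where
  map_zero : U 0 = 1
  map_add : ∀ s t, U (s + t) = U s * U t
  isometry : ∀ t ψ, ‖U t ψ‖ = ‖ψ‖
  continuous : ∀ ψ, Continuous fun t => U t ψ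
  generator : ∀ ψ : A.domain, HasDerivAt (fun t => U t (ψ : 𝓗)) (-Complex.I • A ψ) 0

open Classical in
/-- The unitary group `t ↦ e^{-itA}` generated by `A` (identically `1` if `A` generates none). -/
def unitaryGroup (A : 𝓗 →ₗ.[ℂ] 𝓗) : ℝ → 𝓗 →L[ℂ] 𝓗 :=
  if h : ∃ U, IsUnitaryGroup A U then h.choose else fun _ => 1

/-- The Schrödinger evolution `ρ_t = e^{-itH} ρ e^{itH}`. -/
def schrodinger (H : 𝓗 →ₗ.[ℂ] 𝓗) (ρ : 𝓗 →L[ℂ] 𝓗) (t : ℝ) : 𝓗 →L[ℂ] 𝓗 :=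
  unitaryGroup H t * ρ * unitaryGroup H (-t)

/-- The (in general unbounded) observable `A` has the `ρ`-expectation `Tr[A ρ] = z`: the range of
`ρ` lies in the domain of `A`, and the trace of the everywhere defined operator `A ρ`, computed
in any Hilbert basis, converges to `z`. -/
def HasExpectation (ρ : 𝓗 →L[ℂ] 𝓗) (A : 𝓗 →ₗ.[ℂ] 𝓗) (z : ℂ) : Prop :=
  ∃ hdom : ∀ ψ, ρ ψ ∈ A.domain, ∀ (w : Set 𝓗) (e : HilbertBasis w ℂ 𝓗),
    HasSum (fun i => inner ℂ (e i) (A ⟨ρ (e i), hdom (e i)⟩)) z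

open Classical in
/-- The expectation `⟨A⟩_ρ = Tr[A ρ]` (with the value `0` where it does not exist). -/
def expectation (ρ : 𝓗 →L[ℂ] 𝓗) (A : 𝓗 →ₗ.[ℂ] 𝓗) : ℂ :=
  if h : ∃ z, HasExpectation ρ A z then h.choose else 0

end Hilbert

/-! ### Position, momentum and operators given on the Schwartz space -/

section Schwartz

variable (V : Type) [Fintype V]

/-- The Hilbert space `L²(ℝ^V)`. -/
abbrev L2 : Type := Lp ℂ 2 (volume : Measure (EuclideanSpace ℝ V))

/-- The Schwartz space of `ℝ^V`. -/
abbrev Schw : Type := 𝓢(EuclideanSpace ℝ V, ℂ)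

variable {V}

/-- The embedding of the Schwartz space into `L²`. -/
def schwEmb : Schw V →ₗ[ℂ] L2 V :=
  (SchwartzMap.toLpCLM ℂ (E := EuclideanSpace ℝ V) ℂ 2 volume).toLinearMap

theorem schwEmb_injective : Function.Injective (schwEmb : Schw V →ₗ[ℂ] L2 V) :=
  SchwartzMap.injective_toLp (E := EuclideanSpace ℝ V) (F := ℂ) 2 volume

/-- The closed operator on `L²(ℝ^V)` given by `T` on the Schwartz space, that is, the closure of
`T` regarded as an unbounded operator with domain the Schwartz space. -/
def closedOp (T : Schw V →L[ℂ] Schw V) : L2 V →ₗ.[ℂ] L2 V :=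
  LinearPMap.closure
    { domain := LinearMap.range (schwEmb : Schw V →ₗ[ℂ] L2 V)
      toFun := schwEmb ∘ₗ T.toLinearMap ∘ₗ
        (LinearEquiv.ofInjective (schwEmb : Schw V →ₗ[ℂ] L2 V) schwEmb_injective).symm.toLinearMap }

/-- The position operator at the site `x` on Schwartz functions: `(q_x f)(u) = u_x f(u)`. -/
def posS (x : V) : Schw V →L[ℂ] Schw V :=
  SchwartzMap.smulLeftCLM ℂ fun u : EuclideanSpace ℝ V => ((u x : ℝ) : ℂ)

theorem posS_apply (x : V) (f : Schw V) (u : EuclideanSpace ℝ V) :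
    posS x f u = (u x : ℂ) * f u := by
  have h : (fun u : EuclideanSpace ℝ V => ((u x : ℝ) : ℂ)).HasTemperateGrowth :=
    (Complex.ofRealCLM.comp (EuclideanSpace.proj (𝕜 := ℝ) x)).hasTemperateGrowth
  simp [posS, SchwartzMap.smulLeftCLM_apply_apply h]

variable [DecidableEq V]

/-- The momentum operator at the site `x` on Schwartz functions: `p_x f = -i ∂f/∂u_x`. -/
def momS (x : V) : Schw V →L[ℂ] Schw V :=
  (-Complex.I) • LineDeriv.lineDerivOpCLM ℂ (Schw V) (EuclideanSpace.single x (1 : ℝ))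

/-- The operators `(q, p)`, indexed by `V ⊕ V`, as operators on `L²(ℝ^V)`. -/
def qp : V ⊕ V → (L2 V →ₗ.[ℂ] L2 V) :=
  Sum.elim (fun x => closedOp (posS x)) (fun x => closedOp (momS x))

end Schwartz

/-! ### The oscillator system on a finite set of lattice sites -/

section Model

variable {d : ℕ}

/-- The `1`-norm distance on `ℤ^d`. -/
def dist1 (x y : Fin d → ℤ) : ℤ := ∑ i, |x i - y i|

/-- The nearest neighbor graph on a finite set `Λ` of sites: `x ∼ y` iff `|x - y| = 1`. -/
def nnGraph (Λ : Finset (Fin d → ℤ)) : SimpleGraph Λ where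
  Adj x y := dist1 x.1 y.1 = 1
  symm := ⟨fun x y h => by simpa only [dist1, abs_sub_comm] using h⟩
  loopless := ⟨fun x h => by simp [dist1] at h⟩

instance (Λ : Finset (Fin d → ℤ)) : DecidableRel (nnGraph Λ).Adj :=
  fun x y => inferInstanceAs (Decidable (dist1 x.1 y.1 = 1))

variable (lam : ℝ) (κ : (Fin d → ℤ) → ℝ) (Λ : Finset (Fin d → ℤ))

/-- The Hamiltonian `∑_x (p_x² + (κ_x/2) q_x²) + ∑_{{x,y} : |x-y|=1} lam (q_x - q_y)²` on Schwartz
functions. -/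
def hamS : Schw Λ →L[ℂ] Schw Λ :=
  ∑ x : Λ, (momS x ^ 2 + ((κ x.1 / 2 : ℝ) : ℂ) • posS x ^ 2) +
    ∑ e ∈ (nnGraph Λ).edgeFinset,
      Sym2.lift ⟨fun x y => (lam : ℂ) • (posS x - posS y) ^ 2, fun x y => by
        beta_reduce
        rw [← neg_sub (posS y) (posS x), neg_sq]⟩ e

/-- The oscillator Hamiltonian `H_Λ` on `L²(ℝ^Λ)`. -/
def ham : L2 Λ →ₗ.[ℂ] L2 Λ := closedOp (hamS lam κ Λ)

/-- The effective one-particle Hamiltonian `h_Λ = lam h_{0,Λ} + κ/2`, where `h_{0,Λ}` is the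
negative discrete Laplacian of `Λ`. -/
def effHam : Matrix Λ Λ ℝ :=
  lam • (nnGraph Λ).lapMatrix ℝ + Matrix.diagonal fun x => κ x.1 / 2

theorem effHam_isHermitian : (effHam lam κ Λ).IsHermitian := by
  have h : ((nnGraph Λ).lapMatrix ℝ).IsHermitian := (nnGraph Λ).isHermitian_lapMatrix ℝ
  refine Matrix.IsHermitian.add ?_ (Matrix.isHermitian_diagonal _)
  unfold Matrix.IsHermitian at h ⊢
  rw [Matrix.conjTranspose_smul, h, star_trivial]

/-- The functional calculus `f(h_Λ) = O f(γ²) Oᵀ` with `h_Λ = O γ² Oᵀ`, for an arbitrary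
`f : ℝ → ℂ`. -/
def effHamFun (f : ℝ → ℂ) : Matrix Λ Λ ℂ :=
  let O : Matrix Λ Λ ℂ :=
    ((effHam_isHermitian lam κ Λ).eigenvectorUnitary : Matrix Λ Λ ℝ).map Complex.ofReal
  O * Matrix.diagonal (fun i => f ((effHam_isHermitian lam κ Λ).eigenvalues i)) * O.transpose

/-- `sup_{|g| ≤ 1} |⟨δ_x, h_Λ^{-1/2} g(h_Λ) δ_y⟩|^s`. -/
def singCorr (s : ℝ) (x y : Λ) : ℝ≥0∞ :=
  ⨆ (g : ℝ → ℂ) (_ : ∀ r, ‖g r‖ ≤ 1),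
    ‖effHamFun lam κ Λ (fun r => ((r ^ (-(1 / 2) : ℝ) : ℝ) : ℂ) * g r) x y‖ₑ ^ s

/-- The (physicists') Hermite polynomials. -/
def hermiteH : ℕ → Polynomial ℝ
  | 0 => 1
  | n + 1 => 2 * Polynomial.X * hermiteH n - Polynomial.derivative (hermiteH n)

/-- The normalized `n`-th eigenfunction of `p² + (c/2) q²` on `L²(ℝ)`, for `c > 0`. -/
def hermiteFun (c : ℝ) (n : ℕ) (u : ℝ) : ℝ :=
  1 / √(2 ^ n * (n.factorial : ℝ)) * (√(2 * c) / (2 * Real.pi)) ^ (1 / 4 : ℝ) *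
    (hermiteH n).eval ((c / 2) ^ (1 / 4 : ℝ) * u) * Real.exp (-(√(2 * c) / 4) * u ^ 2)

open Classical in
/-- The vector `⨂_x φ_{n_x}` of `L²(ℝ^Λ)`, that is, the function `u ↦ ∏_x φ_{n_x}(u_x)`. -/
def prodVec (n : Λ → ℕ) : L2 Λ :=
  if h : MemLp (fun u : EuclideanSpace ℝ Λ => ∏ x, ((hermiteFun (κ x.1) (n x) (u x) : ℝ) : ℂ)) 2
    then h.toLp else 0

/-- The state `ρ = ⨂_x |φ_{n_x}⟩⟨φ_{n_x}|`. -/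
def prodState (n : Λ → ℕ) : L2 Λ →L[ℂ] L2 Λ :=
  InnerProductSpace.rankOne ℂ (prodVec κ Λ n) (prodVec κ Λ n)

variable (ρ : L2 Λ →L[ℂ] L2 Λ)

/-- The quenched correlation matrix of `ρ` at time `t`,
`⟨(q,p)ᵀ (q,p)⟩_{ρ_t} - ⟨(q,p)ᵀ⟩_{ρ_t} ⟨(q,p)⟩_{ρ_t}`. -/
def quenchCorr (t : ℝ) : Matrix (Λ ⊕ Λ) (Λ ⊕ Λ) ℂ := fun i j =>
  let ρt := schrodinger (ham lam κ Λ) ρ t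
  expectation ρt (opMul (qp i) (qp j)) - expectation ρt (qp i) * expectation ρt (qp j)

/-- The dynamics of `H_Λ` exists, and so do at all times all the expectations that enter the
quenched correlation matrix. -/
def QuenchWellDefined : Prop :=
  (∃ U, IsUnitaryGroup (ham lam κ Λ) U) ∧
    ∀ (t : ℝ) (i j : Λ ⊕ Λ),
      (∃ z, HasExpectation (schrodinger (ham lam κ Λ) ρ t) (qp i) z) ∧
        ∃ z, HasExpectation (schrodinger (ham lam κ Λ) ρ t) (opMul (qp i) (qp j)) z

end Model

/-- The `2 × 2` block `M_{xy}` of a block matrix. -/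
def block {V : Type} (M : Matrix (V ⊕ V) (V ⊕ V) ℂ) (x y : V) : Matrix (Fin 2) (Fin 2) ℂ :=
  !![M (Sum.inl x) (Sum.inl y), M (Sum.inl x) (Sum.inr y);
     M (Sum.inr x) (Sum.inl y), M (Sum.inr x) (Sum.inr y)]

/-- `sup_t ‖(Γ̃_ρ(t))_{xy}‖^r` for the Euclidean operator norm. -/
def supQuench {d : ℕ} (lam : ℝ) (κ : (Fin d → ℤ) → ℝ) (Λ : Finset (Fin d → ℤ))
    (ρ : L2 Λ →L[ℂ] L2 Λ) (r : ℝ) (x y : Λ) : ℝ≥0∞ :=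
  ⨆ t : ℝ, ‖Matrix.toEuclideanCLM (n := Fin 2) (𝕜 := ℂ)
    (block (quenchCorr lam κ Λ ρ t) x y)‖ₑ ^ r

end Oscillator

end

open Oscillator

/-!
The Hamiltonian is quadratic, so everything reduces to the one-particle matrix `h_Λ`.

*Dynamics.* In the eigenbasis of `h_Λ` the oscillators decouple (`hamS_eq_normalHam`), since the
Laplacian is invariant under rotations and the potential is the quadratic form of `h_Λ`. Products of
Hermite functions in these normal coordinates are eigenfunctions and form a Hilbert basis of `L²`
(`orthonormal_hermS`, `span_hermS_orthogonal`), which gives existence and uniqueness of the unitary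
group (`isUnitaryGroup_evol`, `unitaryGroup_eq_evol`). Through ladder operators the Heisenberg
equations `e^{itH} r_i e^{-itH} = ∑_k M(t)_{ik} r_k` for `r = (q, p)` hold on the Schwartz space
(`qp_evol_mem_graph`), where the blocks of the propagator `M(t)` are `cos (2 √h_Λ t)`,
`h_Λ^{-1/2} sin (2 √h_Λ t)` and `-√h_Λ sin (2 √h_Λ t)`. Domains are dealt with by evolving Hermite
expansions term by term and passing to the closure (`Intertwines.mem_graph`).

*Correlations.* In a product Hermite state the first moments vanish and the second moments `m_{kl}`
couple `k` and `l` only at the same site. Hence the quenched correlations are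
`∑_{k,l} M(t)_{ik} M(t)_{jl} m_{kl}` (`quenchCorr_prodState`). The spectrum of `h_Λ` is positive and
bounded uniformly in `Λ`, so each block of `M(t)` is a constant times `h_Λ^{-1/2} g(h_Λ)` with
`|g| ≤ 1`, and its entries are bounded by the singular eigenfunction correlators uniformly in `t`
(`enorm_propagator_rpow_le`).

*Average.* The power `1/6` is subadditive, and Hölder's inequality with exponents `(3, 3, 3)`
separates the two entries of `M`, to the power `1/2`, from `|m_{kl}|^{1/2}` (`supQuench_le`,
`lintegral_supQuench_le`). The former decay exponentially in the mean by hypothesis. The latter is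
at most a constant times `(1 + 2N)^{1/2} (1 + k_z^{-1/4})` and has a bounded mean as the density of
`k_z` is bounded. What remains is `∑_z e^{-(η/3)(|x-z| + |y-z|)}`, which is at most a constant times
`e^{-(η/6)|x-y|}` (`sum_exp_two_centers_le`).

Measurability in the disorder is not automatic, as the eigenvectors of `h_Λ` are chosen arbitrarily.
It holds because the entries of `M(t)` are limits of polynomials in the entries of `h_Λ`
(`aemeasurable_propagator`), and the supremum over `t` may be taken over the rationals.
-/

noncomputable section

namespace Oscillator

set_option linter.unusedSectionVars false

/-! ### Hermite functions of one variable -/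

lemma derivative_hermiteH_succ (n : ℕ) :
    Polynomial.derivative (hermiteH (n + 1)) = (2 * (n + 1 : ℝ)) • hermiteH n := by
  induction n with
  | zero =>
    have : (Polynomial.C 2 : Polynomial ℝ) = 2 := rfl
    simp [hermiteH, Polynomial.smul_eq_C_mul, this]
  | succ n ih =>
    rw [hermiteH, Polynomial.derivative_sub, Polynomial.derivative_mul, Polynomial.derivative_mul,
      Polynomial.derivative_X, ih, Polynomial.derivative_smul, hermiteH]
    simp only [Polynomial.smul_eq_C_mul]
    push_cast
    simp only [map_mul, map_add, map_natCast, map_one, Polynomial.derivative_ofNat]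
    have : (Polynomial.C 2 : Polynomial ℝ) = 2 := rfl
    rw [this]
    ring

/-- The frequency `√(c / 2)` of the oscillator `p² + (c / 2) q²`. -/
def freq (c : ℝ) : ℝ := √(c / 2)

lemma freq_pos {c : ℝ} (hc : 0 < c) : 0 < freq c := Real.sqrt_pos.2 (by positivity)

lemma freq_sq {c : ℝ} (hc : 0 < c) : freq c ^ 2 = c / 2 := Real.sq_sqrt (by positivity)

lemma hermiteFun_eq {c : ℝ} (hc : 0 < c) (n : ℕ) (u : ℝ) :
    hermiteFun c n u = 1 / √(2 ^ n * (n.factorial : ℝ)) * (freq c / Real.pi) ^ (1 / 4 : ℝ) *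
      (hermiteH n).eval (√(freq c) * u) * Real.exp (-(freq c * u ^ 2 / 2)) := by
  have h1 : √(2 * c) = 2 * freq c := by
    rw [freq, show 2 * c = 2 ^ 2 * (c / 2) by ring, Real.sqrt_mul (by positivity),
      Real.sqrt_sq (by norm_num)]
  have h2 : (c / 2) ^ (1 / 4 : ℝ) = √(freq c) := by
    rw [freq, Real.sqrt_eq_rpow, Real.sqrt_eq_rpow, ← Real.rpow_mul (by positivity)]
    norm_num
  unfold hermiteFun
  rw [h1, h2, mul_div_mul_left _ _ (by norm_num : (2 : ℝ) ≠ 0)]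
  congr 2
  ring

lemma sqrt_factorial_succ (n : ℕ) :
    √(2 ^ (n + 1) * ((n + 1).factorial : ℝ)) =
      √2 * √((n + 1 : ℕ) : ℝ) * √(2 ^ n * (n.factorial : ℝ)) := by
  rw [← Real.sqrt_mul (by norm_num), ← Real.sqrt_mul (by positivity), Nat.factorial_succ]
  congr 1
  push_cast
  ring

/-- The lowering step: `√n φ_{n-1}` through the derivative of the Hermite polynomial. For `n = 0`
both sides vanish. -/
lemma sqrt_mul_hermiteFun_pred {c : ℝ} (hc : 0 < c) (n : ℕ) (u : ℝ) :
    √(n : ℝ) * hermiteFun c (n - 1) u =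
      1 / √2 * (1 / √(2 ^ n * (n.factorial : ℝ)) * (freq c / Real.pi) ^ (1 / 4 : ℝ) *
        (Polynomial.derivative (hermiteH n)).eval (√(freq c) * u) *
          Real.exp (-(freq c * u ^ 2 / 2))) := by
  cases n with
  | zero => simp [hermiteH]
  | succ n =>
    rw [Nat.add_sub_cancel, hermiteFun_eq hc, sqrt_factorial_succ, derivative_hermiteH_succ]
    have h2 : √2 ^ 2 = 2 := Real.sq_sqrt (by norm_num)
    have hn : √((n + 1 : ℕ) : ℝ) ^ 2 = n + 1 := by
      rw [Real.sq_sqrt (by positivity)]; push_cast; ring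
    have hn0 : √((n + 1 : ℕ) : ℝ) ≠ 0 := by positivity
    have hf0 : √(2 ^ n * (n.factorial : ℝ)) ≠ 0 := by positivity
    rw [Polynomial.eval_smul, smul_eq_mul]
    generalize √((n + 1 : ℕ) : ℝ) = s at *
    generalize √(2 ^ n * (n.factorial : ℝ)) = r at *
    generalize Real.exp _ = g
    generalize Polynomial.eval (√(freq c) * u) (hermiteH n) = p
    generalize (freq c / Real.pi) ^ (1 / 4 : ℝ) = q
    have h20 : √2 ≠ (0 : ℝ) := by positivity
    field_simp
    rw [h2, ← hn]
    ring

/-- The raising step: `√(n+1) φ_{n+1}`, by the recursion of the Hermite polynomials. -/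
lemma sqrt_mul_hermiteFun_succ {c : ℝ} (hc : 0 < c) (n : ℕ) (u : ℝ) :
    √((n + 1 : ℕ) : ℝ) * hermiteFun c (n + 1) u =
      1 / √2 * (1 / √(2 ^ n * (n.factorial : ℝ)) * (freq c / Real.pi) ^ (1 / 4 : ℝ) *
        (2 * (√(freq c) * u) * (hermiteH n).eval (√(freq c) * u) -
          (Polynomial.derivative (hermiteH n)).eval (√(freq c) * u)) *
          Real.exp (-(freq c * u ^ 2 / 2))) := by
  rw [hermiteFun_eq hc, sqrt_factorial_succ, hermiteH]
  have hn0 : √((n + 1 : ℕ) : ℝ) ≠ 0 := by positivity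
  have hf0 : √(2 ^ n * (n.factorial : ℝ)) ≠ 0 := by positivity
  have h20 : √2 ≠ (0 : ℝ) := by positivity
  simp only [Polynomial.eval_sub, Polynomial.eval_mul, Polynomial.eval_X, Polynomial.eval_ofNat]
  field_simp

lemma sqrt_two_mul {w : ℝ} : √(2 * w) = √2 * √w := Real.sqrt_mul (by norm_num) _

lemma mul_hermiteFun {c : ℝ} (hc : 0 < c) (n : ℕ) (u : ℝ) :
    u * hermiteFun c n u = 1 / √(2 * freq c) *
      (√(n : ℝ) * hermiteFun c (n - 1) u + √((n + 1 : ℕ) : ℝ) * hermiteFun c (n + 1) u) := by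
  rw [sqrt_mul_hermiteFun_pred hc, sqrt_mul_hermiteFun_succ hc, hermiteFun_eq hc, sqrt_two_mul]
  have h2 : √2 ^ 2 = 2 := Real.sq_sqrt (by norm_num)
  have h20 : √2 ≠ (0 : ℝ) := by positivity
  have hw0 : √(freq c) ≠ (0 : ℝ) := (Real.sqrt_pos.2 (freq_pos hc)).ne'
  field_simp
  rw [h2]
  ring

lemma hasDerivAt_hermiteFun {c : ℝ} (hc : 0 < c) (n : ℕ) (u : ℝ) :
    HasDerivAt (hermiteFun c n) (√(freq c / 2) *
      (√(n : ℝ) * hermiteFun c (n - 1) u - √((n + 1 : ℕ) : ℝ) * hermiteFun c (n + 1) u)) u := by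
  rw [sqrt_mul_hermiteFun_pred hc, sqrt_mul_hermiteFun_succ hc]
  have hfun : hermiteFun c n = fun u => 1 / √(2 ^ n * (n.factorial : ℝ)) *
      (freq c / Real.pi) ^ (1 / 4 : ℝ) *
      (hermiteH n).eval (√(freq c) * u) * Real.exp (-(freq c * u ^ 2 / 2)) :=
    funext fun u => hermiteFun_eq hc n u
  rw [hfun]
  have hlin : HasDerivAt (fun u : ℝ => √(freq c) * u) (√(freq c)) u := by
    simpa using (hasDerivAt_id u).const_mul (√(freq c))
  have hp := ((hermiteH n).hasDerivAt (√(freq c) * u)).comp u hlin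
  have hq : HasDerivAt (fun u : ℝ => -(freq c * u ^ 2 / 2)) (-(freq c * u)) u := by
    have := ((((hasDerivAt_id u).pow 2).const_mul (freq c)).div_const 2).neg
    refine this.congr_deriv ?_
    simp
    ring
  have := (hp.const_mul (1 / √(2 ^ n * (n.factorial : ℝ)) *
      (freq c / Real.pi) ^ (1 / 4 : ℝ))).mul hq.exp
  refine this.congr_deriv ?_
  have h2 : √2 ^ 2 = 2 := Real.sq_sqrt (by norm_num)
  have h20 : √2 ≠ (0 : ℝ) := by positivity
  have hw : √(freq c) ^ 2 = freq c := Real.sq_sqrt (freq_pos hc).le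
  rw [Real.sqrt_div (freq_pos hc).le]
  simp only [Function.comp_apply]
  generalize Real.exp _ = g
  generalize Polynomial.eval (√(freq c) * u) (hermiteH n) = p
  generalize Polynomial.eval (√(freq c) * u) (Polynomial.derivative (hermiteH n)) = p'
  generalize (freq c / Real.pi) ^ (1 / 4 : ℝ) = q
  generalize 1 / √(2 ^ n * (n.factorial : ℝ)) = r
  generalize √(freq c) = s at hw ⊢
  rw [← hw]
  field_simp
  rw [h2]
  ring

/-! ### Gaussians as Schwartz functions -/

lemma exists_bound_eval_mul_exp (p : Polynomial ℝ) :
    ∃ C : ℝ, ∀ x : ℝ, |p.eval x * Real.exp (-(x ^ 2 / 2))| ≤ C := by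
  induction p using Polynomial.induction_on' with
  | add p q hp hq =>
    obtain ⟨C, hC⟩ := hp
    obtain ⟨D, hD⟩ := hq
    refine ⟨C + D, fun x => ?_⟩
    rw [Polynomial.eval_add, add_mul]
    exact (abs_add_le _ _).trans (add_le_add (hC x) (hD x))
  | monomial n a =>
    refine ⟨|a| * (1 + 2 ^ n * n.factorial), fun x => ?_⟩
    rw [Polynomial.eval_monomial, mul_assoc, abs_mul]
    refine mul_le_mul_of_nonneg_left ?_ (abs_nonneg _)
    rw [abs_mul, abs_pow, Real.abs_exp, Real.exp_neg, ← div_eq_mul_inv,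
      div_le_iff₀ (Real.exp_pos _)]
    have h1 : (x ^ 2 / 2) ^ n / n.factorial ≤ Real.exp (x ^ 2 / 2) :=
      Real.pow_div_factorial_le_exp _ (by positivity) n
    have h2 : 1 ≤ Real.exp (x ^ 2 / 2) := Real.one_le_exp (by positivity)
    have h3 : |x| ^ n ≤ 1 + (x ^ 2) ^ n := by
      rw [← sq_abs, ← pow_mul, mul_comm 2 n, pow_mul]
      nlinarith [sq_nonneg (|x| ^ n - 1), sq_nonneg (|x| ^ n), pow_nonneg (abs_nonneg x) n]
    have h4 : (x ^ 2) ^ n = 2 ^ n * n.factorial * ((x ^ 2 / 2) ^ n / n.factorial) := by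
      have : (n.factorial : ℝ) ≠ 0 := by positivity
      rw [div_pow]
      field_simp
    calc |x| ^ n ≤ 1 + (x ^ 2) ^ n := h3
      _ ≤ Real.exp (x ^ 2 / 2) + 2 ^ n * n.factorial * Real.exp (x ^ 2 / 2) := by
          rw [h4]; gcongr
      _ = _ := by ring

/-- The Gaussian `x ↦ e^{-x²/2}` on `ℝ` as a Schwartz function. -/
def gaussianLine : 𝓢(ℝ, ℝ) where
  toFun x := Real.exp (-(x ^ 2 / 2))
  smooth' := by fun_prop
  decay' k n := by
    obtain ⟨C, hC⟩ := exists_bound_eval_mul_exp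
      (Polynomial.X ^ k * (Polynomial.hermite n).map (Int.castRingHom ℝ))
    refine ⟨C, fun x => le_trans (le_of_eq ?_) (hC x)⟩
    rw [norm_iteratedFDeriv_eq_norm_iteratedDeriv, iteratedDeriv_eq_iterate,
      Polynomial.deriv_gaussian_eq_hermite_mul_gaussian, Real.norm_eq_abs, Real.norm_eq_abs,
      ← abs_pow, ← abs_mul, Polynomial.eval_mul, Polynomial.eval_pow, Polynomial.eval_X,
      Polynomial.eval_map, Polynomial.aeval_def]
    simp [abs_mul, mul_assoc]

/-- Real Gaussians in orthonormal coordinates are Schwartz functions: the one-dimensional Gaussian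
is composed with `u ↦ √(1 + ‖Au‖²)`, which is smooth. -/
lemma exists_schwartz_gaussian {V : Type} [Fintype V]
    (f : OrthonormalBasis V ℝ (EuclideanSpace ℝ V)) {w : V → ℝ}
    (hw : ∀ i, 0 < w i) :
    ∃ g : Schw V, ∀ u, g u = (Real.exp (-(∑ i, w i * (inner ℝ (f i) u) ^ 2) / 2) : ℝ) := by
  classical
  let A : EuclideanSpace ℝ V →L[ℝ] EuclideanSpace ℝ V :=
    ∑ i, (innerSL ℝ (f i)).smulRight (√(w i) • f i)
  have hA : ∀ u, ‖A u‖ ^ 2 = ∑ i, w i * (inner ℝ (f i) u) ^ 2 := by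
    intro u
    rw [← f.sum_sq_norm_inner_right]
    refine Finset.sum_congr rfl fun i _ => ?_
    have : inner ℝ (f i) (A u) = inner ℝ (f i) u * √(w i) := by
      simp only [A, sum_apply, ContinuousLinearMap.smulRight_apply,
        innerSL_apply_apply, inner_sum, inner_smul_right]
      rw [Finset.sum_eq_single i]
      · simp
      · intro j _ hj
        rw [f.inner_eq_zero hj.symm]; simp
      · simp
    rw [this, Real.norm_eq_abs, sq_abs, mul_pow, Real.sq_sqrt (hw i).le, mul_comm]
  have hg : Function.HasTemperateGrowth
      (fun u : EuclideanSpace ℝ V => (1 + ‖A u‖ ^ 2) ^ (1 / 2 : ℝ)) :=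
    (Function.hasTemperateGrowth_one_add_norm_sq_rpow (EuclideanSpace ℝ V) (1 / 2)).comp
      A.hasTemperateGrowth
  have hup : ∃ (k : ℕ) (C : ℝ), ∀ u : EuclideanSpace ℝ V,
      ‖u‖ ≤ C * (1 + ‖(1 + ‖A u‖ ^ 2) ^ (1 / 2 : ℝ)‖) ^ k := by
    refine ⟨1, √(∑ j, (w j)⁻¹), fun u => ?_⟩
    have h1 : ‖u‖ ^ 2 ≤ (∑ j, (w j)⁻¹) * ‖A u‖ ^ 2 := by
      rw [hA, ← f.sum_sq_norm_inner_right, Finset.mul_sum]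
      refine Finset.sum_le_sum fun i _ => ?_
      rw [Real.norm_eq_abs, sq_abs, ← mul_assoc]
      refine le_mul_of_one_le_left (sq_nonneg _) ?_
      rw [← inv_mul_cancel₀ (hw i).ne']
      exact mul_le_mul_of_nonneg_right
        (Finset.single_le_sum (f := fun j => (w j)⁻¹) (fun j _ => (inv_pos.2 (hw j)).le)
          (Finset.mem_univ i)) (hw i).le
    rw [← Real.sqrt_eq_rpow, pow_one, Real.norm_of_nonneg (Real.sqrt_nonneg _)]
    have h0 : 0 ≤ ∑ j, (w j)⁻¹ := Finset.sum_nonneg fun j _ => (inv_pos.2 (hw j)).le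
    calc ‖u‖ = √(‖u‖ ^ 2) := (Real.sqrt_sq (norm_nonneg _)).symm
      _ ≤ √((∑ j, (w j)⁻¹) * ‖A u‖ ^ 2) := Real.sqrt_le_sqrt h1
      _ = √(∑ j, (w j)⁻¹) * √(‖A u‖ ^ 2) := Real.sqrt_mul h0 _
      _ ≤ _ := by
        gcongr
        refine (Real.sqrt_le_sqrt ?_).trans (le_add_of_nonneg_left zero_le_one)
        linarith
  refine ⟨Real.exp (1 / 2) • SchwartzMap.postcompCLM (𝕜 := ℝ) Complex.ofRealCLM
    (SchwartzMap.compCLM ℝ hg hup gaussianLine), fun u => ?_⟩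
  rw [smul_apply, SchwartzMap.postcompCLM_apply, SchwartzMap.compCLM_apply]
  change Real.exp (1 / 2) • ((Real.exp (-(((1 + ‖A u‖ ^ 2) ^ (1 / 2 : ℝ)) ^ 2 / 2)) : ℝ) : ℂ) = _
  rw [← Real.sqrt_eq_rpow, Real.sq_sqrt (by positivity), hA, Complex.real_smul,
    ← Complex.ofReal_mul, ← Real.exp_add]
  congr 2
  ring

/-! ### Product Hermite functions in orthonormal coordinates -/

section Hermite

variable {V : Type} [Fintype V]

lemma hasTemperateGrowth_prod {E ι : Type*} [NormedAddCommGroup E] [NormedSpace ℝ E]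
    {F : ι → E → ℂ} (s : Finset ι) (hF : ∀ i, (F i).HasTemperateGrowth) :
    Function.HasTemperateGrowth fun u => ∏ i ∈ s, F i u := by
  classical
  induction s using Finset.induction_on with
  | empty => simp [Function.HasTemperateGrowth.const (1 : ℂ)]
  | insert a s ha ih =>
    simp only [Finset.prod_insert ha]
    exact (hF a).mul ih

lemma hasTemperateGrowth_inner_ofReal (v : EuclideanSpace ℝ V) :
    Function.HasTemperateGrowth fun u : EuclideanSpace ℝ V => ((inner ℝ v u : ℝ) : ℂ) :=
  (Complex.ofRealCLM.comp (innerSL ℝ v)).hasTemperateGrowth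

lemma hasTemperateGrowth_eval {E : Type*} [NormedAddCommGroup E] [NormedSpace ℝ E] {h : E → ℂ}
    (hh : h.HasTemperateGrowth) (p : Polynomial ℂ) :
    Function.HasTemperateGrowth fun u => p.eval (h u) := by
  induction p using Polynomial.induction_on' with
  | add p q hp hq =>
    simp only [Polynomial.eval_add]
    exact hp.add hq
  | monomial n a =>
    simp only [Polynomial.eval_monomial]
    exact (Function.HasTemperateGrowth.const a).mul (hh.pow n)

lemma exists_schwartz_hermite (f : OrthonormalBasis V ℝ (EuclideanSpace ℝ V)) {c : V → ℝ}
    (hc : ∀ i, 0 < c i) (n : V → ℕ) :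
    ∃ g : Schw V, ∀ u, g u = ∏ i, ((hermiteFun (c i) (n i) (inner ℝ (f i) u) : ℝ) : ℂ) := by
  obtain ⟨G, hG⟩ := exists_schwartz_gaussian f (fun i => freq_pos (hc i))
  let F : V → EuclideanSpace ℝ V → ℂ := fun i u =>
    ((1 / √(2 ^ n i * ((n i).factorial : ℝ)) * (freq (c i) / Real.pi) ^ (1 / 4 : ℝ) : ℝ) : ℂ) *
      ((hermiteH (n i)).map (algebraMap ℝ ℂ)).eval
        (((√(freq (c i)) : ℝ) : ℂ) * ((inner ℝ (f i) u : ℝ) : ℂ))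
  have hF : ∀ i, (F i).HasTemperateGrowth := fun i =>
    (Function.HasTemperateGrowth.const _).mul (hasTemperateGrowth_eval
      ((Function.HasTemperateGrowth.const _).mul (hasTemperateGrowth_inner_ofReal (f i))) _)
  refine ⟨SchwartzMap.smulLeftCLM ℂ (fun u => ∏ i, F i u) G, fun u => ?_⟩
  rw [SchwartzMap.smulLeftCLM_apply_apply (hasTemperateGrowth_prod _ hF), hG, smul_eq_mul,
    neg_div, Finset.sum_div, ← Finset.sum_neg_distrib, Real.exp_sum, Complex.ofReal_prod,
    ← Finset.prod_mul_distrib]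
  refine Finset.prod_congr rfl fun i _ => ?_
  rw [hermiteFun_eq (hc i), Complex.ofReal_mul, Complex.ofReal_mul]
  simp only [F]
  congr 2
  rw [← Complex.ofReal_mul]
  exact Polynomial.eval_map_apply (algebraMap ℝ ℂ) (√(freq (c i)) * inner ℝ (f i) u)

open Classical in
/-- The product Hermite function `u ↦ ∏_i φ_{n_i}(⟨f_i, u⟩)` in the coordinates of the orthonormal
basis `f`, with one parameter `c_i > 0` for each coordinate, as a Schwartz function (`0` if it is
not one). -/
def hermS (f : OrthonormalBasis V ℝ (EuclideanSpace ℝ V)) (c : V → ℝ) (n : V → ℕ) : Schw V :=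
  if h : ∃ g : Schw V, ∀ u, g u = ∏ i, ((hermiteFun (c i) (n i) (inner ℝ (f i) u) : ℝ) : ℂ)
  then h.choose else 0

variable {f : OrthonormalBasis V ℝ (EuclideanSpace ℝ V)} {c : V → ℝ}

lemma hermS_apply (hc : ∀ i, 0 < c i) (n : V → ℕ) (u : EuclideanSpace ℝ V) :
    hermS f c n u = ∏ i, ((hermiteFun (c i) (n i) (inner ℝ (f i) u) : ℝ) : ℂ) := by
  have h := exists_schwartz_hermite f hc n
  rw [hermS, dif_pos h]
  exact h.choose_spec u

/-! ### Position and momentum along a vector -/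

/-- The position operator `u ↦ ⟨v, u⟩` along the vector `v`. -/
def posL (v : EuclideanSpace ℝ V) : Schw V →L[ℂ] Schw V :=
  SchwartzMap.smulLeftCLM ℂ fun u => ((inner ℝ v u : ℝ) : ℂ)

/-- The momentum operator `-i ∂_v` along the vector `v`. -/
def momL (v : EuclideanSpace ℝ V) : Schw V →L[ℂ] Schw V :=
  (-Complex.I) • LineDeriv.lineDerivOpCLM ℂ (Schw V) v

lemma posL_apply (v : EuclideanSpace ℝ V) (g : Schw V) (u : EuclideanSpace ℝ V) :
    posL v g u = ((inner ℝ v u : ℝ) : ℂ) * g u := by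
  rw [posL, SchwartzMap.smulLeftCLM_apply_apply (hasTemperateGrowth_inner_ofReal v), smul_eq_mul]

lemma momL_apply (v : EuclideanSpace ℝ V) (g : Schw V) (u : EuclideanSpace ℝ V) :
    momL v g u = -Complex.I * lineDeriv ℝ g u v := by
  rw [momL, smul_apply, smul_apply, smul_eq_mul]
  congr 1
  exact SchwartzMap.lineDerivOp_apply v g u

lemma momL_apply_fderiv (v : EuclideanSpace ℝ V) (g : Schw V) (u : EuclideanSpace ℝ V) :
    momL v g u = -Complex.I * fderiv ℝ g u v := by
  rw [momL_apply, (g.differentiableAt).lineDeriv_eq_fderiv]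

lemma posS_eq_posL [DecidableEq V] (x : V) : posS x = posL (EuclideanSpace.single x (1 : ℝ)) := by
  unfold posS posL
  congr 1
  ext u
  rw [EuclideanSpace.inner_single_left]
  simp

lemma momS_eq_momL [DecidableEq V] (x : V) : momS x = momL (EuclideanSpace.single x (1 : ℝ)) := rfl

lemma posL_sum {ι : Type*} (s : Finset ι) (a : ι → ℝ) (v : ι → EuclideanSpace ℝ V) :
    posL (∑ i ∈ s, a i • v i) = ∑ i ∈ s, (a i : ℂ) • posL (v i) := by
  ext g u
  rw [posL_apply, sum_apply, sum_apply, sum_inner, Complex.ofReal_sum, Finset.sum_mul]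
  refine Finset.sum_congr rfl fun i _ => ?_
  rw [smul_apply, smul_apply, posL_apply, real_inner_smul_left]
  push_cast
  simp only [smul_eq_mul]
  ring

lemma momL_sum {ι : Type*} (s : Finset ι) (a : ι → ℝ) (v : ι → EuclideanSpace ℝ V) :
    momL (∑ i ∈ s, a i • v i) = ∑ i ∈ s, (a i : ℂ) • momL (v i) := by
  ext g u
  rw [momL_apply_fderiv, sum_apply, sum_apply, map_sum, Finset.mul_sum]
  refine Finset.sum_congr rfl fun i _ => ?_
  rw [smul_apply, smul_apply, momL_apply_fderiv, map_smul, Complex.real_smul]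
  simp only [smul_eq_mul]
  ring

lemma inner_schwEmb (g h : Schw V) :
    inner ℂ (schwEmb g) (schwEmb h) = ∫ u, inner ℂ (g u) (h u) :=
  SchwartzMap.inner_toL2_toL2_eq g h volume

lemma posL_symm (v : EuclideanSpace ℝ V) (g h : Schw V) :
    inner ℂ (schwEmb (posL v g)) (schwEmb h) = inner ℂ (schwEmb g) (schwEmb (posL v h)) := by
  rw [inner_schwEmb, inner_schwEmb]
  refine integral_congr_ae (.of_forall fun u => ?_)
  simp only [posL_apply, RCLike.inner_apply, map_mul, Complex.conj_ofReal]
  ring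

lemma momL_symm (v : EuclideanSpace ℝ V) (g h : Schw V) :
    inner ℂ (schwEmb (momL v g)) (schwEmb h) = inner ℂ (schwEmb g) (schwEmb (momL v h)) := by
  have key := SchwartzMap.integral_bilinear_lineDerivOp_right_eq_neg_left (μ := volume) g h
    ((ContinuousLinearMap.mul ℝ ℂ).comp (Complex.conjCLE : ℂ →L[ℝ] ℂ)) v
  simp only [SchwartzMap.lineDerivOp_apply] at key
  rw [inner_schwEmb, inner_schwEmb]
  calc ∫ u, inner ℂ (momL v g u) (h u)
      = ∫ u, Complex.I * (((ContinuousLinearMap.mul ℝ ℂ).comp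
          (Complex.conjCLE : ℂ →L[ℝ] ℂ)) (lineDeriv ℝ g u v)) (h u) := by
        refine integral_congr_ae (.of_forall fun u => ?_)
        simp only [momL_apply, RCLike.inner_apply, map_mul, map_neg, Complex.conj_I,
          ContinuousLinearMap.comp_apply, ContinuousLinearMap.mul_apply']
        simp
        ring
    _ = -Complex.I * ∫ u, (((ContinuousLinearMap.mul ℝ ℂ).comp
          (Complex.conjCLE : ℂ →L[ℝ] ℂ)) (g u)) (lineDeriv ℝ h u v) := by
        rw [key, integral_const_mul]
        ring
    _ = ∫ u, inner ℂ (g u) (momL v h u) := by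
        rw [← integral_const_mul]
        refine integral_congr_ae (.of_forall fun u => ?_)
        simp only [momL_apply, RCLike.inner_apply,
          ContinuousLinearMap.comp_apply, ContinuousLinearMap.mul_apply']
        simp
        ring

/-! ### Ladder relations -/

section MultiIndex

variable {V : Type} [DecidableEq V]

/-- The multi-index `n` with its entry `n_i` raised by one. -/
def raise (n : V → ℕ) (i : V) : V → ℕ := Function.update n i (n i + 1)

/-- The multi-index `n` with its entry `n_i` lowered by one (unchanged if `n_i = 0`). -/
def lower (n : V → ℕ) (i : V) : V → ℕ := Function.update n i (n i - 1)

@[simp] lemma raise_self (n : V → ℕ) (i : V) : raise n i i = n i + 1 := by simp [raise]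

@[simp] lemma lower_self (n : V → ℕ) (i : V) : lower n i i = n i - 1 := by simp [lower]

lemma raise_of_ne (n : V → ℕ) {i j : V} (h : j ≠ i) : raise n i j = n j := by simp [raise, h]

lemma lower_of_ne (n : V → ℕ) {i j : V} (h : j ≠ i) : lower n i j = n j := by simp [lower, h]

@[simp] lemma lower_raise (n : V → ℕ) (i : V) : lower (raise n i) i = n := by
  ext j
  by_cases h : j = i
  · subst h; simp
  · rw [lower_of_ne _ h, raise_of_ne _ h]

lemma raise_lower {n : V → ℕ} {i : V} (hn : n i ≠ 0) : raise (lower n i) i = n := by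
  ext j
  by_cases h : j = i
  · subst h; simp; lia
  · rw [raise_of_ne _ h, lower_of_ne _ h]

lemma lower_ne_raise (n : V → ℕ) (i j : V) : lower n i ≠ raise n j := fun h => by
  have := congrFun h j
  rw [raise_self] at this
  by_cases hij : j = i
  · subst hij
    rw [lower_self] at this
    lia
  · rw [lower_of_ne n hij] at this
    lia

end MultiIndex

variable [DecidableEq V]

lemma hermS_update_apply (hc : ∀ i, 0 < c i) (n : V → ℕ) (i : V) (m : ℕ)
    (u : EuclideanSpace ℝ V) :
    hermS f c (Function.update n i m) u = ((hermiteFun (c i) m (inner ℝ (f i) u) : ℝ) : ℂ) *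
      ∏ j ∈ Finset.univ.erase i, ((hermiteFun (c j) (n j) (inner ℝ (f j) u) : ℝ) : ℂ) := by
  rw [hermS_apply hc, ← Finset.mul_prod_erase _ _ (Finset.mem_univ i), Function.update_self]
  congr 1
  refine Finset.prod_congr rfl fun j hj => ?_
  rw [Function.update_of_ne (Finset.ne_of_mem_erase hj)]

lemma hermS_apply_erase (hc : ∀ i, 0 < c i) (n : V → ℕ) (i : V) (u : EuclideanSpace ℝ V) :
    hermS f c n u = ((hermiteFun (c i) (n i) (inner ℝ (f i) u) : ℝ) : ℂ) *
      ∏ j ∈ Finset.univ.erase i, ((hermiteFun (c j) (n j) (inner ℝ (f j) u) : ℝ) : ℂ) := by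
  rw [hermS_apply hc, ← Finset.mul_prod_erase _ _ (Finset.mem_univ i)]

lemma posL_hermS (hc : ∀ i, 0 < c i) (n : V → ℕ) (i : V) :
    posL (f i) (hermS f c n) = ((1 / √(2 * freq (c i)) : ℝ) : ℂ) •
      (((√(n i : ℝ) : ℝ) : ℂ) • hermS f c (lower n i) +
        ((√((n i + 1 : ℕ) : ℝ) : ℝ) : ℂ) • hermS f c (raise n i)) := by
  ext u
  rw [posL_apply, smul_apply, add_apply, smul_apply, smul_apply, lower, raise,
    hermS_update_apply hc, hermS_update_apply hc, hermS_apply_erase hc n i, ← mul_assoc,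
    ← Complex.ofReal_mul, mul_hermiteFun (hc i)]
  simp only [smul_eq_mul]
  push_cast
  ring

lemma momL_hermS (hc : ∀ i, 0 < c i) (n : V → ℕ) (i : V) :
    momL (f i) (hermS f c n) = (-Complex.I * ((√(freq (c i) / 2) : ℝ) : ℂ)) •
      (((√(n i : ℝ) : ℝ) : ℂ) • hermS f c (lower n i) -
        ((√((n i + 1 : ℕ) : ℝ) : ℝ) : ℂ) • hermS f c (raise n i)) := by
  ext u
  have hd : lineDeriv ℝ (hermS f c n) u (f i) =
      ((√(freq (c i) / 2) * (√(n i : ℝ) * hermiteFun (c i) (n i - 1) (inner ℝ (f i) u) -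
        √((n i + 1 : ℕ) : ℝ) * hermiteFun (c i) (n i + 1) (inner ℝ (f i) u)) : ℝ) : ℂ) *
      ∏ j ∈ Finset.univ.erase i, ((hermiteFun (c j) (n j) (inner ℝ (f j) u) : ℝ) : ℂ) := by
    rw [lineDeriv]
    have hfun : (fun t : ℝ => hermS f c n (u + t • f i)) = fun t : ℝ =>
        ((hermiteFun (c i) (n i) (t + inner ℝ (f i) u) : ℝ) : ℂ) *
        ∏ j ∈ Finset.univ.erase i, ((hermiteFun (c j) (n j) (inner ℝ (f j) u) : ℝ) : ℂ) := by
      ext t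
      rw [hermS_apply_erase hc n i, inner_add_right, real_inner_smul_right,
        real_inner_self_eq_norm_sq, f.norm_eq_one, one_pow, mul_one, add_comm t]
      congr 1
      refine Finset.prod_congr rfl fun j hj => ?_
      rw [inner_add_right, real_inner_smul_right, f.inner_eq_zero (Finset.ne_of_mem_erase hj),
        mul_zero, add_zero]
    rw [hfun]
    have h0 := hasDerivAt_hermiteFun (hc i) (n i) (0 + inner ℝ (f i) u)
    have h1 := (h0.comp_add_const (0 : ℝ) (inner ℝ (f i) u)).ofReal_comp.mul_const
      (∏ j ∈ Finset.univ.erase i, ((hermiteFun (c j) (n j) (inner ℝ (f j) u) : ℝ) : ℂ))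
    rw [h1.deriv, zero_add]
  rw [momL_apply, hd, smul_apply, sub_apply, smul_apply, smul_apply, lower, raise,
    hermS_update_apply hc, hermS_update_apply hc]
  simp only [smul_eq_mul]
  push_cast
  ring

/-- The product Hermite functions are eigenfunctions of each single oscillator. -/
lemma oscillator_hermS (hc : ∀ i, 0 < c i) (n : V → ℕ) (i : V) :
    momL (f i) (momL (f i) (hermS f c n)) +
      ((c i / 2 : ℝ) : ℂ) • posL (f i) (posL (f i) (hermS f c n)) =
      ((freq (c i) * (2 * n i + 1) : ℝ) : ℂ) • hermS f c n := by
  have hw := freq_pos (hc i)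
  rw [← freq_sq (hc i)]
  have e1 : ∀ m : ℕ, ((√(m : ℝ) : ℝ) : ℂ) * ((√(m : ℝ) : ℝ) : ℂ) = m := fun m => by
    rw [← Complex.ofReal_mul, Real.mul_self_sqrt (by positivity)]; simp
  have e2 : ((√(freq (c i) / 2) : ℝ) : ℂ) * ((√(freq (c i) / 2) : ℝ) : ℂ) = freq (c i) / 2 := by
    rw [← Complex.ofReal_mul, Real.mul_self_sqrt (by positivity)]; simp
  have e3 : ((1 / √(2 * freq (c i)) : ℝ) : ℂ) * ((1 / √(2 * freq (c i)) : ℝ) : ℂ) =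
      1 / (2 * freq (c i)) := by
    rw [← Complex.ofReal_mul, div_mul_div_comm, Real.mul_self_sqrt (by positivity)]; simp
  have hw0 : (freq (c i) : ℂ) ≠ 0 := by exact_mod_cast hw.ne'
  have h1 : ((√(n i : ℝ) : ℝ) : ℂ) • hermS f c (raise (lower n i) i) =
      ((√(n i : ℝ) : ℝ) : ℂ) • hermS f c n := by
    by_cases h : n i = 0
    · simp [h]
    · rw [raise_lower h]
  have h2 : ((√(n i : ℝ) : ℝ) : ℂ) * ((√(((n i - 1 : ℕ) + 1 : ℕ) : ℝ) : ℝ) : ℂ) = n i := by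
    by_cases h : n i = 0
    · simp [h]
    · rw [Nat.sub_add_cancel (by lia), e1]
  generalize hs : ((√(n i : ℝ) : ℝ) : ℂ) = s at *
  generalize hs' : ((√((n i - 1 : ℕ) : ℝ) : ℝ) : ℂ) = s'
  rw [momL_hermS hc, posL_hermS hc, map_smul, map_smul, map_sub, map_add, map_smul, map_smul,
    map_smul, map_smul, momL_hermS hc, posL_hermS hc, momL_hermS hc, posL_hermS hc, hs]
  simp only [raise_self, lower_self, lower_raise, hs']
  have e4 := e1 (n i + 1)
  generalize ((√((n i + 1 : ℕ) : ℝ) : ℝ) : ℂ) = r at *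
  generalize ((√((n i + 1 + 1 : ℕ) : ℝ) : ℝ) : ℂ) = r'
  generalize ((√((n i - 1 + 1 : ℕ) : ℝ) : ℝ) : ℂ) = q at *
  generalize ((√(freq (c i) / 2) : ℝ) : ℂ) = a at *
  generalize ((1 / √(2 * freq (c i)) : ℝ) : ℂ) = b at *
  ext u
  have h1' := congrArg (fun g : Schw V => g u) h1
  simp only [smul_apply, add_apply, sub_apply, smul_eq_mul] at h1' ⊢
  push_cast at e4 ⊢
  generalize hermS f c (raise (lower n i) i) u = A at *
  generalize hermS f c n u = B at *
  generalize hermS f c (lower (lower n i) i) u = D at *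
  generalize hermS f c (raise (raise n i) i) u = G at *
  have hI : Complex.I ^ 2 = -1 := Complex.I_sq
  have e3' : (freq (c i) : ℂ) ^ 2 * (b * b) = freq (c i) / 2 := by rw [e3]; field_simp
  generalize (freq (c i) : ℂ) = w at *
  linear_combination (a * a * (s * s' * D - s * q * A - r * r * B + r * r' * G)) * hI -
    (s * s' * D - s * q * A - r * r * B + r * r' * G) * e2 +
    (s * s' * D + s * q * A + r * r * B + r * r' * G) * e3' + w * q * h1' + w * B * h2 + w * B * e4

/-! ### Orthonormality of the product Hermite functions -/

lemma hermS_orthogonal (hc : ∀ i, 0 < c i) {m n : V → ℕ} (hmn : m ≠ n) :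
    inner ℂ (schwEmb (hermS f c m)) (schwEmb (hermS f c n)) = 0 := by
  obtain ⟨i, hi⟩ := Function.ne_iff.1 hmn
  have hs : inner ℂ (schwEmb (momL (f i) (momL (f i) (hermS f c m)) +
        ((c i / 2 : ℝ) : ℂ) • posL (f i) (posL (f i) (hermS f c m)))) (schwEmb (hermS f c n)) =
      inner ℂ (schwEmb (hermS f c m)) (schwEmb (momL (f i) (momL (f i) (hermS f c n)) +
        ((c i / 2 : ℝ) : ℂ) • posL (f i) (posL (f i) (hermS f c n)))) := by
    simp only [map_add, map_smul, inner_add_left, inner_add_right, inner_smul_left,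
      inner_smul_right, momL_symm, posL_symm, Complex.conj_ofReal]
  rw [oscillator_hermS hc, oscillator_hermS hc, map_smul, map_smul, inner_smul_left,
    inner_smul_right, Complex.conj_ofReal] at hs
  by_contra h0
  have h1 := Complex.ofReal_injective (mul_right_cancel₀ h0 hs)
  have h2 := mul_left_cancel₀ (freq_pos (hc i)).ne' h1
  apply hi
  have h3 : (m i : ℝ) = n i := by linarith
  exact_mod_cast h3

lemma inner_hermS_raise (hc : ∀ i, 0 < c i) (n : V → ℕ) (i : V) :
    inner ℂ (schwEmb (hermS f c (raise n i))) (schwEmb (hermS f c (raise n i))) =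
      inner ℂ (schwEmb (hermS f c n)) (schwEmb (hermS f c n)) := by
  have h := posL_symm (f i) (hermS f c (raise n i)) (hermS f c n)
  have h3 : n ≠ raise (raise n i) i := fun h => by
    have := congrFun h i
    simp only [raise_self] at this
    lia
  have h4 : raise n i ≠ lower n i := (lower_ne_raise n i i).symm
  rw [posL_hermS hc, posL_hermS hc] at h
  simp only [map_add, map_smul, inner_add_left, inner_add_right, inner_smul_left,
    inner_smul_right, Complex.conj_ofReal, lower_raise, raise_self,
    hermS_orthogonal hc h3.symm, hermS_orthogonal hc h4] at h
  have hw := freq_pos (hc i)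
  have h1 : ((1 / √(2 * freq (c i)) : ℝ) : ℂ) ≠ 0 := by
    norm_cast
    positivity
  have h2 : ((√((n i + 1 : ℕ) : ℝ) : ℝ) : ℂ) ≠ 0 := by
    norm_cast
    positivity
  rw [mul_zero, mul_zero, zero_add, add_zero] at h
  exact (mul_left_cancel₀ h2 (mul_left_cancel₀ h1 h)).symm

lemma inner_hermS_zero (hc : ∀ i, 0 < c i) :
    inner ℂ (schwEmb (hermS f c 0)) (schwEmb (hermS f c 0)) = 1 := by
  rw [inner_schwEmb]
  have h1 : ∀ u : EuclideanSpace ℝ V, inner ℂ (hermS f c 0 u) (hermS f c 0 u) =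
      (fun v : V → ℝ => ∏ i, ((hermiteFun (c i) 0 (v i) ^ 2 : ℝ) : ℂ))
        (WithLp.ofLp (f.repr u)) := by
    intro u
    rw [hermS_apply hc, RCLike.inner_apply, map_prod, ← Finset.prod_mul_distrib]
    refine Finset.prod_congr rfl fun i _ => ?_
    rw [Complex.conj_ofReal, ← Complex.ofReal_mul, ← sq]
    simp [OrthonormalBasis.repr_apply_apply]
  simp only [h1]
  have hmp : MeasurePreserving (fun u : EuclideanSpace ℝ V => WithLp.ofLp (f.repr u)) :=
    (PiLp.volume_preserving_ofLp V).comp f.repr.measurePreserving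
  have hme : MeasurableEmbedding (fun u : EuclideanSpace ℝ V => WithLp.ofLp (f.repr u)) :=
    (f.repr.toHomeomorph.trans (PiLp.homeomorph 2 (fun _ : V => ℝ))).measurableEmbedding
  rw [hmp.integral_comp hme (fun v : V → ℝ => ∏ i, ((hermiteFun (c i) 0 (v i) ^ 2 : ℝ) : ℂ)),
    integral_fintype_prod_volume_eq_prod
      (fun (i : V) (r : ℝ) => ((hermiteFun (c i) 0 r ^ 2 : ℝ) : ℂ))]
  refine Finset.prod_eq_one fun i _ => ?_
  rw [integral_complex_ofReal]
  have hw := freq_pos (hc i)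
  have h2 : ∀ r, hermiteFun (c i) 0 r ^ 2 =
      √(freq (c i) / Real.pi) * Real.exp (-freq (c i) * r ^ 2) := fun r => by
    rw [hermiteFun_eq (hc i)]
    simp only [hermiteH, pow_zero, Nat.factorial_zero, Nat.cast_one, mul_one, Real.sqrt_one,
      div_one, one_mul, Polynomial.eval_one, mul_pow, ← Real.exp_nat_mul]
    rw [← Real.rpow_natCast, ← Real.rpow_mul (by positivity), Real.sqrt_eq_rpow]
    congr 2
    · norm_num
    · push_cast; ring
  simp only [h2]
  rw [integral_const_mul, integral_gaussian, ← Real.sqrt_mul (by positivity)]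
  have : freq (c i) / Real.pi * (Real.pi / freq (c i)) = 1 := by
    field_simp
  rw [this]
  simp

lemma inner_hermS_self (hc : ∀ i, 0 < c i) (n : V → ℕ) :
    inner ℂ (schwEmb (hermS f c n)) (schwEmb (hermS f c n)) = 1 := by
  induction hN : ∑ i, n i generalizing n with
  | zero =>
    have : n = 0 := by
      ext i
      exact (Finset.sum_eq_zero_iff.1 hN) i (Finset.mem_univ i)
    rw [this, inner_hermS_zero hc]
  | succ N ih =>
    obtain ⟨i, hi⟩ : ∃ i, n i ≠ 0 := by
      by_contra! h
      simp [h] at hN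
    rw [← raise_lower hi, inner_hermS_raise hc]
    apply ih
    rw [← Finset.add_sum_erase _ _ (Finset.mem_univ i)] at hN ⊢
    rw [lower_self, Finset.sum_congr rfl
      (fun j hj => lower_of_ne n (Finset.ne_of_mem_erase hj))]
    lia

lemma orthonormal_hermS (hc : ∀ i, 0 < c i) :
    Orthonormal ℂ fun n : V → ℕ => schwEmb (hermS f c n) := by
  rw [orthonormal_iff_ite]
  intro m n
  split_ifs with h
  · rw [h, inner_hermS_self hc]
  · exact hermS_orthogonal hc h

end Hermite

/-! ### Completeness of the product Hermite functions -/

section Fourier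

open scoped FourierTransform

variable {E : Type*} [NormedAddCommGroup E] [InnerProductSpace ℝ E] [FiniteDimensional ℝ E]
  [MeasurableSpace E] [BorelSpace E]

/-- The Fourier transform is injective on integrable functions. -/
lemma ae_eq_zero_of_fourier_eq_zero {F : E → ℂ} (hF : Integrable F) (h : ∀ ξ, 𝓕 F ξ = 0) :
    ∀ᵐ u, F u = 0 := by
  refine ae_eq_zero_of_integral_contDiff_smul_eq_zero hF.locallyIntegrable fun g hg hgc => ?_
  have hgc' : HasCompactSupport fun u => (g u : ℂ) := hgc.comp_left Complex.ofReal_zero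
  let G : 𝓢(E, ℂ) := hgc'.toSchwartzMap (Complex.ofRealCLM.contDiff.comp hg)
  have hG : ∀ u, G u = g u := fun u => rfl
  have key : ∫ ξ, 𝓕 F ξ • (𝓕⁻ G) ξ = ∫ u, F u • 𝓕 (𝓕⁻ G) u := by
    have := VectorFourier.integral_fourierIntegral_smul_eq_flip (L := innerₗ E)
      Real.continuous_fourierChar continuous_inner hF ((𝓕⁻ G).integrable (μ := volume))
    rw [flip_innerₗ] at this
    exact this
  rw [FourierTransform.fourier_fourierInv_eq] at key
  simp only [h, zero_smul, integral_zero] at key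
  rw [key]
  refine integral_congr_ae (.of_forall fun u => ?_)
  simp only [hG, Complex.real_smul, smul_eq_mul, mul_comm]

/-- A function with exponential moments whose polynomial moments vanish is zero almost everywhere:
its Fourier transform is the sum of its moments. -/
lemma ae_eq_zero_of_moments_eq_zero {F : E → ℂ} (hF : Integrable F)
    (hexp : ∀ ξ : E, Integrable fun u => Real.exp |inner ℝ ξ u| * ‖F u‖)
    (h : ∀ (ξ : E) (k : ℕ), ∫ u, ((inner ℝ ξ u : ℝ) : ℂ) ^ k * F u = 0) :
    ∀ᵐ u, F u = 0 := by
  refine ae_eq_zero_of_fourier_eq_zero hF fun ξ => ?_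
  have hs : HasSum (fun k : ℕ => ∫ u, (Complex.I ^ k / (k.factorial : ℂ)) *
      (((inner ℝ ((-2 * Real.pi) • ξ) u : ℝ) : ℂ) ^ k * F u))
      (∫ u, Complex.exp (((inner ℝ ((-2 * Real.pi) • ξ) u : ℝ) : ℂ) * Complex.I) * F u) := by
    generalize (-2 * Real.pi) • ξ = η
    have hsum : ∀ u, HasSum (fun k : ℕ => |inner ℝ η u| ^ k / (k.factorial : ℝ) * ‖F u‖)
        (Real.exp |inner ℝ η u| * ‖F u‖) := fun u => by
      rw [Real.exp_eq_exp_ℝ]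
      exact (NormedSpace.expSeries_div_hasSum_exp (𝔸 := ℝ) |inner ℝ η u|).mul_right _
    refine hasSum_integral_of_dominated_convergence
      (fun k u => |inner ℝ η u| ^ k / (k.factorial : ℝ) * ‖F u‖) (fun k => ?_)
      (fun k => .of_forall fun u => ?_) (.of_forall fun u => (hsum u).summable) ?_
      (.of_forall fun u => ?_)
    · have : AEStronglyMeasurable (fun u : E => ((inner ℝ η u : ℝ) : ℂ) ^ k) :=
        Continuous.aestronglyMeasurable (by fun_prop)
      exact (this.mul hF.aestronglyMeasurable).const_mul _
    · rw [norm_mul, norm_div, norm_pow, Complex.norm_I, one_pow, Complex.norm_natCast, norm_mul,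
        norm_pow, Complex.norm_real, Real.norm_eq_abs, ← mul_assoc, one_div_mul_eq_div]
    · simp only [fun u => (hsum u).tsum_eq]
      exact hexp η
    · have := (NormedSpace.expSeries_div_hasSum_exp (𝔸 := ℂ)
        (((inner ℝ η u : ℝ) : ℂ) * Complex.I)).mul_right (F u)
      rw [← Complex.exp_eq_exp_ℂ] at this
      have e : ∀ k : ℕ, (((inner ℝ η u : ℝ) : ℂ) * Complex.I) ^ k / (k.factorial : ℂ) * F u =
          Complex.I ^ k / (k.factorial : ℂ) * (((inner ℝ η u : ℝ) : ℂ) ^ k * F u) := fun k => by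
        rw [mul_pow]
        ring
      simp only [e] at this
      exact this
  simp only [integral_const_mul, h, mul_zero] at hs
  rw [Real.fourier_eq', ← hs.unique hasSum_zero]
  refine integral_congr_ae (.of_forall fun u => ?_)
  simp only [smul_eq_mul]
  rw [real_inner_smul_left, real_inner_comm ξ u]

end Fourier

section Basis

variable {V : Type} [Fintype V] {f : OrthonormalBasis V ℝ (EuclideanSpace ℝ V)} {c : V → ℝ}

lemma hermS_zero_apply (hc : ∀ i, 0 < c i) : ∃ C : ℝ, 0 < C ∧ ∀ u, hermS f c 0 u =
    ((C * Real.exp (-(∑ i, freq (c i) * (inner ℝ (f i) u) ^ 2) / 2) : ℝ) : ℂ) := by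
  refine ⟨∏ i, (freq (c i) / Real.pi) ^ (1 / 4 : ℝ), Finset.prod_pos fun i _ => ?_, fun u => ?_⟩
  · have := freq_pos (hc i)
    positivity
  · rw [hermS_apply hc, neg_div, Finset.sum_div, ← Finset.sum_neg_distrib, Real.exp_sum,
      ← Finset.prod_mul_distrib, Complex.ofReal_prod]
    refine Finset.prod_congr rfl fun i _ => ?_
    rw [hermiteFun_eq (hc i)]
    simp [hermiteH]

/-- The ground state stays square integrable after multiplication by `e^{|⟨ξ, u⟩|}`: it is then
bounded by a multiple of a wider Gaussian. -/
lemma exists_schwartz_bound_exp_mul_hermS_zero (hc : ∀ i, 0 < c i) (ξ : EuclideanSpace ℝ V) :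
    ∃ g : Schw V, ∀ u, Real.exp |inner ℝ ξ u| * ‖hermS f c 0 u‖ ≤ ‖g u‖ := by
  obtain ⟨C, hC, h0⟩ := hermS_zero_apply (f := f) hc
  obtain ⟨g, hg⟩ := exists_schwartz_gaussian f (w := fun i => freq (c i) / 2)
    (fun i => by have := freq_pos (hc i); positivity)
  let K : ℝ := ∑ i, (inner ℝ ξ (f i)) ^ 2 / freq (c i)
  refine ⟨((C * Real.exp K : ℝ) : ℂ) • g, fun u => ?_⟩
  rw [smul_apply, norm_smul, h0, hg, Complex.norm_of_nonneg (by positivity),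
    Complex.norm_of_nonneg (by positivity), Complex.norm_of_nonneg (by positivity),
    mul_left_comm, ← Real.exp_add, mul_assoc, ← Real.exp_add]
  refine mul_le_mul_of_nonneg_left (Real.exp_le_exp.2 ?_) hC.le
  have h1 : |inner ℝ ξ u| ≤ ∑ i, ((inner ℝ ξ (f i)) ^ 2 / freq (c i) +
      freq (c i) * (inner ℝ (f i) u) ^ 2 / 4) := by
    rw [← f.sum_inner_mul_inner ξ u]
    refine (Finset.abs_sum_le_sum_abs _ _).trans (Finset.sum_le_sum fun i _ => ?_)
    have hw := freq_pos (hc i)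
    rw [abs_mul, ← sq_abs (inner ℝ ξ (f i)), ← sq_abs (inner ℝ (f i) u)]
    have := sq_nonneg (|inner ℝ ξ (f i)| - freq (c i) * |inner ℝ (f i) u| / 2)
    rw [div_add_div _ _ hw.ne' (by norm_num), le_div_iff₀ (by positivity)]
    nlinarith
  refine (add_le_add_left h1 _).trans (le_of_eq ?_)
  rw [Finset.sum_add_distrib]
  simp only [K, div_mul_eq_mul_div, ← Finset.sum_div]
  ring

variable [DecidableEq V]

/-- The span of the product Hermite functions is invariant under multiplication by coordinates. -/
lemma posL_mem_span (hc : ∀ i, 0 < c i) (ξ : EuclideanSpace ℝ V) {g : Schw V}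
    (hg : g ∈ Submodule.span ℂ (Set.range fun n : V → ℕ => hermS f c n)) :
    posL ξ g ∈ Submodule.span ℂ (Set.range fun n : V → ℕ => hermS f c n) := by
  have hb : ∀ n, hermS f c n ∈ Submodule.span ℂ (Set.range fun n : V → ℕ => hermS f c n) :=
    fun n => Submodule.subset_span ⟨n, rfl⟩
  induction hg using Submodule.span_induction with
  | mem x hx =>
    obtain ⟨n, rfl⟩ := hx
    rw [← f.sum_repr ξ, posL_sum, sum_apply]
    refine Submodule.sum_mem _ fun i _ => ?_
    rw [smul_apply, posL_hermS hc]
    exact Submodule.smul_mem _ _ (Submodule.smul_mem _ _ (Submodule.add_mem _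
      (Submodule.smul_mem _ _ (hb _)) (Submodule.smul_mem _ _ (hb _))))
  | zero => rw [map_zero]; exact Submodule.zero_mem _
  | add x y _ _ hx hy => rw [map_add]; exact Submodule.add_mem _ hx hy
  | smul a x _ hx => rw [map_smul]; exact Submodule.smul_mem _ _ hx

lemma span_hermS_orthogonal (hc : ∀ i, 0 < c i) :
    (Submodule.span ℂ (Set.range fun n : V → ℕ => schwEmb (hermS f c n)))ᗮ = ⊥ := by
  rw [Submodule.eq_bot_iff]
  intro φ hφ
  have h1 : ∀ g ∈ Submodule.span ℂ (Set.range fun n : V → ℕ => hermS f c n),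
      inner ℂ (schwEmb g) φ = 0 := by
    intro g hg
    refine (Submodule.mem_orthogonal _ _).1 hφ _ ?_
    have := Submodule.mem_map_of_mem (f := (schwEmb : Schw V →ₗ[ℂ] L2 V)) hg
    rwa [Submodule.map_span, ← Set.range_comp] at this
  have h2 : ∀ (ξ : EuclideanSpace ℝ V) (k : ℕ), ∃ g : Schw V,
      g ∈ Submodule.span ℂ (Set.range fun n : V → ℕ => hermS f c n) ∧
        ∀ u, g u = ((inner ℝ ξ u : ℝ) : ℂ) ^ k * hermS f c 0 u := by
    intro ξ k
    induction k with
    | zero => exact ⟨hermS f c 0, Submodule.subset_span ⟨0, rfl⟩, fun u => by simp⟩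
    | succ k ih =>
      obtain ⟨g, hg, hgu⟩ := ih
      exact ⟨posL ξ g, posL_mem_span hc ξ hg, fun u => by rw [posL_apply, hgu]; ring⟩
  have hin : ∀ g : Schw V, inner ℂ (schwEmb g) φ = ∫ u, inner ℂ (g u) (φ u) := by
    intro g
    rw [L2.inner_def]
    refine integral_congr_ae ?_
    filter_upwards [g.coeFn_toLp 2 volume] with u hu
    have : (schwEmb g : EuclideanSpace ℝ V → ℂ) u = g u := hu
    rw [this]
  obtain ⟨C, hC, h0⟩ := hermS_zero_apply (f := f) hc
  have hreal : ∀ u, (starRingEnd ℂ) (hermS f c 0 u) = hermS f c 0 u := fun u => by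
    rw [h0, Complex.conj_ofReal]
  have hF : ∀ᵐ u, hermS f c 0 u * φ u = 0 := by
    refine ae_eq_zero_of_moments_eq_zero ?_ (fun ξ => ?_) (fun ξ k => ?_)
    · exact MemLp.integrable_mul ((hermS f c 0).memLp 2 volume) (Lp.memLp φ)
    · obtain ⟨g, hg⟩ := exists_schwartz_bound_exp_mul_hermS_zero (f := f) hc ξ
      have hgi : Integrable fun u => ‖g u * φ u‖ :=
        (MemLp.integrable_mul (g.memLp 2 volume) (Lp.memLp φ)).norm
      refine hgi.mono' ?_ (.of_forall fun u => ?_)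
      · have m1 : AEStronglyMeasurable (fun u : EuclideanSpace ℝ V => Real.exp |inner ℝ ξ u|) :=
          Continuous.aestronglyMeasurable (by fun_prop)
        exact m1.mul ((hermS f c 0).continuous.aestronglyMeasurable.mul
          (Lp.aestronglyMeasurable φ)).norm
      · rw [Real.norm_of_nonneg (by positivity), norm_mul, norm_mul, ← mul_assoc]
        exact mul_le_mul_of_nonneg_right (hg u) (norm_nonneg _)
    · obtain ⟨g, hg, hgu⟩ := h2 ξ k
      rw [← h1 g hg, hin]
      refine integral_congr_ae (.of_forall fun u => ?_)
      simp only [hgu, RCLike.inner_apply, map_mul, map_pow, Complex.conj_ofReal, hreal]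
      ring
  rw [Lp.eq_zero_iff_ae_eq_zero]
  filter_upwards [hF] with u hu
  refine (mul_eq_zero.1 hu).resolve_left ?_
  rw [h0]
  have : C * Real.exp (-(∑ i, freq (c i) * (inner ℝ (f i) u) ^ 2) / 2) ≠ 0 := by positivity
  exact_mod_cast this

/-- The Hilbert basis of `L²(ℝ^V)` formed by the product Hermite functions. -/
def hermBasis (f : OrthonormalBasis V ℝ (EuclideanSpace ℝ V)) (hc : ∀ i, 0 < c i) :
    HilbertBasis (V → ℕ) ℂ (L2 V) :=
  HilbertBasis.mkOfOrthogonalEqBot (orthonormal_hermS (f := f) hc) (span_hermS_orthogonal hc)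

@[simp] lemma hermBasis_apply (hc : ∀ i, 0 < c i) (n : V → ℕ) :
    hermBasis f hc n = schwEmb (hermS f c n) := by
  rw [hermBasis, HilbertBasis.coe_mkOfOrthogonalEqBot]

end Basis

/-! ### Unitary groups diagonal in a Hilbert basis -/

section Evolution

variable {ι 𝓗 : Type*} [NormedAddCommGroup 𝓗] [InnerProductSpace ℂ 𝓗] [CompleteSpace 𝓗]
  (b : HilbertBasis ι ℂ 𝓗) (E : ι → ℝ)

/-- The phase `e^{-itE}`. -/
def phase (E t : ℝ) : ℂ := Complex.exp (-(Complex.I * (t * E)))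

lemma phase_eq (E t : ℝ) : phase E t = Complex.exp (((-(t * E) : ℝ) : ℂ) * Complex.I) := by
  rw [phase]; congr 1; push_cast; ring

lemma norm_phase (E t : ℝ) : ‖phase E t‖ = 1 := by
  rw [phase_eq, Complex.norm_exp_ofReal_mul_I]

lemma conj_phase_mul_phase (E t : ℝ) : (starRingEnd ℂ) (phase E t) * phase E t = 1 := by
  rw [← Complex.normSq_eq_conj_mul_self, Complex.normSq_eq_norm_sq, norm_phase]; simp

lemma phase_ne_zero (E t : ℝ) : phase E t ≠ 0 := Complex.exp_ne_zero _

lemma phase_add (E s t : ℝ) : phase E (s + t) = phase E s * phase E t := by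
  rw [phase, phase, phase, ← Complex.exp_add]; congr 1; push_cast; ring

@[simp] lemma phase_zero (E : ℝ) : phase E 0 = 1 := by simp [phase]

lemma hasDerivAt_phase (E t : ℝ) : HasDerivAt (phase E) (-Complex.I * E * phase E t) t := by
  have h : HasDerivAt (fun t : ℝ => -(Complex.I * ((t : ℂ) * E))) (-(Complex.I * E)) t := by
    have := (((hasDerivAt_id t).ofReal_comp.mul_const (E : ℂ)).const_mul Complex.I).neg
    exact this.congr_deriv (by simp)
  refine h.cexp.congr_deriv ?_
  rw [phase]; ring

lemma continuous_phase (E : ℝ) : Continuous (phase E) :=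
  continuous_iff_continuousAt.2 fun t => (hasDerivAt_phase E t).continuousAt

variable {b} in
lemma eq_of_inner_basis_eq {x y : 𝓗} (h : ∀ i, inner ℂ (b i) x = inner ℂ (b i) y) : x = y := by
  apply b.repr.injective
  ext i
  rw [b.repr_apply_apply, b.repr_apply_apply, h]

variable {b} in
lemma clm_ext_basis {A B : 𝓗 →L[ℂ] 𝓗} (h : ∀ i, A (b i) = B (b i)) : A = B := by
  refine ContinuousLinearMap.ext_on
    (Submodule.dense_iff_topologicalClosure_eq_top.2 b.dense_span) ?_
  rintro _ ⟨i, rfl⟩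
  exact h i

/-- The Hilbert basis `e^{-itE_i} b_i`. -/
def phaseBasis (t : ℝ) : HilbertBasis ι ℂ 𝓗 :=
  HilbertBasis.mkOfOrthogonalEqBot (v := fun i => phase (E i) t • b i)
    (by
      classical
      rw [orthonormal_iff_ite]
      intro i j
      rw [inner_smul_left, inner_smul_right, orthonormal_iff_ite.1 b.orthonormal i j]
      split_ifs with h
      · rw [h, mul_one, conj_phase_mul_phase]
      · simp)
    (by
      rw [Submodule.eq_bot_iff]
      intro φ hφ
      refine eq_of_inner_basis_eq (b := b) fun i => ?_
      have := (Submodule.mem_orthogonal _ _).1 hφ _ (Submodule.subset_span ⟨i, rfl⟩)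
      rw [inner_smul_left] at this
      rw [inner_zero_right]
      refine (mul_eq_zero.1 this).resolve_left ?_
      exact (map_ne_zero _).2 (phase_ne_zero _ _))

/-- The unitary operator with `b_i ↦ e^{-itE_i} b_i`. -/
def evol (t : ℝ) : 𝓗 →L[ℂ] 𝓗 :=
  ((b.repr.trans (phaseBasis b E t).repr.symm : 𝓗 ≃ₗᵢ[ℂ] 𝓗) : 𝓗 →L[ℂ] 𝓗)

lemma evol_basis (t : ℝ) (i : ι) : evol b E t (b i) = phase (E i) t • b i := by
  classical
  change (phaseBasis b E t).repr.symm (b.repr (b i)) = _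
  rw [b.repr_self, HilbertBasis.repr_symm_single, phaseBasis,
    HilbertBasis.coe_mkOfOrthogonalEqBot]

lemma norm_evol (t : ℝ) (ψ : 𝓗) : ‖evol b E t ψ‖ = ‖ψ‖ :=
  (b.repr.trans (phaseBasis b E t).repr.symm).norm_map ψ

lemma inner_evol_evol (t : ℝ) (φ ψ : 𝓗) :
    inner ℂ (evol b E t φ) (evol b E t ψ) = inner ℂ φ ψ :=
  (b.repr.trans (phaseBasis b E t).repr.symm).inner_map_map φ ψ

lemma evol_add (s t : ℝ) : evol b E (s + t) = evol b E s * evol b E t := by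
  refine clm_ext_basis (b := b) fun i => ?_
  rw [mul_apply_eq_comp, evol_basis, evol_basis, map_smul, evol_basis, smul_smul,
    phase_add, mul_comm]

lemma evol_zero : evol b E 0 = 1 := by
  refine clm_ext_basis (b := b) fun i => ?_
  rw [evol_basis, phase_zero, one_smul, one_apply_eq_self]

lemma inner_basis_evol (t : ℝ) (i : ι) (ψ : 𝓗) :
    inner ℂ (b i) (evol b E t ψ) = phase (E i) t * inner ℂ (b i) ψ := by
  have h := inner_evol_evol b E t (b i) ψ
  rw [evol_basis, inner_smul_left] at h
  rw [← h, ← mul_assoc, mul_comm (phase _ _), conj_phase_mul_phase, one_mul]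

lemma inner_evol_left (t : ℝ) (φ ψ : 𝓗) :
    inner ℂ (evol b E t φ) ψ = inner ℂ φ (evol b E (-t) ψ) := by
  rw [← inner_evol_evol b E t φ, ← mul_apply_eq_comp, ← evol_add, add_neg_cancel,
    evol_zero, one_apply_eq_self]

/-- Strong continuity: the evolution of a finite linear combination of basis vectors is continuous,
and these approximate the evolution of any vector uniformly in time. -/
lemma continuous_evol (ψ : 𝓗) : Continuous fun t => evol b E t ψ := by
  have hs := b.hasSum_repr ψ
  have hu : TendstoUniformly (fun (s : Finset ι) t => evol b E t (∑ i ∈ s, b.repr ψ i • b i))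
      (fun t => evol b E t ψ) Filter.atTop := by
    rw [Metric.tendstoUniformly_iff]
    intro ε hε
    filter_upwards [Metric.tendsto_nhds.1 hs ε hε] with s hs t
    rw [dist_eq_norm, ← map_sub, norm_evol, ← dist_eq_norm, dist_comm]
    exact hs
  refine hu.continuous (Filter.Frequently.of_forall fun s => ?_)
  simp only [map_sum, map_smul, evol_basis]
  exact continuous_finsetSum _ fun i _ => ((continuous_phase _).smul continuous_const).const_smul _

/-- The evolution in the Hilbert basis `b` is generated by any operator that multiplies the `i`-th
coefficient by `E_i`: on its domain, `U_t ψ = ψ - i ∫₀ᵗ U_s A ψ ds`. -/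
lemma isUnitaryGroup_evol {A : 𝓗 →ₗ.[ℂ] 𝓗}
    (hA : ∀ (ψ : A.domain) (i : ι), inner ℂ (b i) (A ψ) = E i * inner ℂ (b i) (ψ : 𝓗)) :
    IsUnitaryGroup A (evol b E) where
  map_zero := evol_zero b E
  map_add := evol_add b E
  isometry := norm_evol b E
  continuous := continuous_evol b E
  generator ψ := by
    have hc : Continuous fun s => evol b E s (-Complex.I • A ψ) := continuous_evol b E _
    have hint : (fun t => evol b E t (ψ : 𝓗)) =
        fun t => (ψ : 𝓗) + ∫ s in (0 : ℝ)..t, evol b E s (-Complex.I • A ψ) := by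
      ext t
      refine eq_of_inner_basis_eq (b := b) fun i => ?_
      have h1 : inner ℂ (b i) (∫ s in (0 : ℝ)..t, evol b E s (-Complex.I • A ψ)) =
          ∫ s in (0 : ℝ)..t, inner ℂ (b i) (evol b E s (-Complex.I • A ψ)) :=
        ((innerSL ℂ (b i)).intervalIntegral_comp_comm (hc.intervalIntegrable 0 t)).symm
      have h2 : ∀ s, HasDerivAt (fun s => phase (E i) s * inner ℂ (b i) (ψ : 𝓗))
          (inner ℂ (b i) (evol b E s (-Complex.I • A ψ))) s := fun s => by
        refine ((hasDerivAt_phase (E i) s).mul_const _).congr_deriv ?_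
        rw [inner_basis_evol, inner_smul_right, hA]
        ring
      rw [inner_add_right, h1, intervalIntegral.integral_eq_sub_of_hasDerivAt (fun s _ => h2 s)
        ((continuous_const.inner hc).intervalIntegrable 0 t), inner_basis_evol, phase_zero]
      ring
    rw [hint]
    have := (intervalIntegral.integral_hasDerivAt_right (hc.intervalIntegrable 0 0)
      hc.stronglyMeasurable.stronglyMeasurableAtFilter hc.continuousAt).const_add (ψ : 𝓗)
    rwa [evol_zero] at this

/-- A unitary group is determined by an orthonormal basis of eigenvectors of its generator. -/
lemma IsUnitaryGroup.eq_evol {A : 𝓗 →ₗ.[ℂ] 𝓗} {U : ℝ → 𝓗 →L[ℂ] 𝓗} (hU : IsUnitaryGroup A U)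
    (hA : ∀ i, (b i, (E i : ℂ) • b i) ∈ A.graph) : U = evol b E := by
  ext1 t
  refine clm_ext_basis (b := b) fun i => ?_
  obtain ⟨ψ, hψ, hAψ⟩ := A.mem_graph_iff.1 (hA i)
  simp only at hψ hAψ
  have hd : ∀ t, HasDerivAt (fun s => U s (b i)) ((-Complex.I * E i) • U t (b i)) t := by
    intro t
    have h0 := hU.generator ψ
    rw [hψ, hAψ] at h0
    have h1 : HasDerivAt (fun s => U (s - t) (b i)) (-Complex.I • (E i : ℂ) • b i) t := by
      have : HasDerivAt (fun s => U s (b i)) (-Complex.I • (E i : ℂ) • b i) (t - t) := by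
        rwa [sub_self]
      simpa using this.comp_sub_const t t
    have h2 := ((U t).restrictScalars ℝ).hasFDerivAt.comp_hasDerivAt t h1
    have h3 : (fun s => U s (b i)) = fun s => ((U t).restrictScalars ℝ) (U (s - t) (b i)) := by
      ext s
      rw [ContinuousLinearMap.coe_restrictScalars', ← mul_apply_eq_comp, ← hU.map_add,
        add_sub_cancel]
    rw [h3]
    refine h2.congr_deriv ?_
    rw [ContinuousLinearMap.coe_restrictScalars', map_smul, map_smul, smul_smul]
  have hd' : ∀ t, HasDerivAt (fun s => phase (-E i) s • U s (b i)) 0 t := by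
    intro t
    refine ((hasDerivAt_phase (-E i) t).smul (hd t)).congr_deriv ?_
    rw [smul_smul, ← add_smul]
    convert zero_smul ℂ _ using 2
    push_cast
    ring
  have hconst := is_const_of_deriv_eq_zero (fun t => (hd' t).differentiableAt)
    (fun t => (hd' t).deriv) t 0
  simp only [phase_zero, hU.map_zero, one_apply_eq_self, one_smul] at hconst
  have : phase (E i) t * phase (-E i) t = 1 := by
    rw [phase, phase, ← Complex.exp_add]
    convert Complex.exp_zero using 2
    push_cast
    ring
  rw [evol_basis]
  conv_rhs => rw [← hconst]
  rw [smul_smul, this, one_smul]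

lemma unitaryGroup_eq_evol {A : 𝓗 →ₗ.[ℂ] 𝓗}
    (hA : ∀ (ψ : A.domain) (i : ι), inner ℂ (b i) (A ψ) = E i * inner ℂ (b i) (ψ : 𝓗))
    (hA' : ∀ i, (b i, (E i : ℂ) • b i) ∈ A.graph) : unitaryGroup A = evol b E := by
  have h : ∃ U, IsUnitaryGroup A U := ⟨_, isUnitaryGroup_evol b E hA⟩
  rw [unitaryGroup, dif_pos h]
  exact h.choose_spec.eq_evol b E hA'

end Evolution

/-! ### Expectations in pure states -/

section Expectation

variable {𝓗 : Type*} [NormedAddCommGroup 𝓗] [InnerProductSpace ℂ 𝓗]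

lemma mem_graph_opMul {A B : 𝓗 →ₗ.[ℂ] 𝓗} {φ χ ψ : 𝓗} (hB : (φ, χ) ∈ B.graph)
    (hA : (χ, ψ) ∈ A.graph) : (φ, ψ) ∈ (opMul A B).graph := by
  obtain ⟨⟨φ, hφ⟩, rfl, rfl⟩ := B.mem_graph_iff.1 hB
  obtain ⟨⟨χ, hχ⟩, hχ', rfl⟩ := A.mem_graph_iff.1 hA
  simp only at hχ' hχ ⊢
  subst hχ'
  exact (opMul A B).mem_graph ⟨φ, hφ, hχ⟩

lemma hasExpectation_rankOne {A : 𝓗 →ₗ.[ℂ] 𝓗} {ψ χ : 𝓗} (h : (ψ, χ) ∈ A.graph) :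
    HasExpectation (InnerProductSpace.rankOne ℂ ψ ψ) A (inner ℂ ψ χ) := by
  have hg : ∀ v, (InnerProductSpace.rankOne ℂ ψ ψ v, inner ℂ ψ v • χ) ∈ A.graph := fun v =>
    A.graph.smul_mem (inner ℂ ψ v) h
  refine ⟨fun v => A.mem_domain_of_mem_graph (hg v), fun w e => ?_⟩
  have hval : ∀ i, A ⟨InnerProductSpace.rankOne ℂ ψ ψ (e i), A.mem_domain_of_mem_graph (hg (e i))⟩ =
      inner ℂ ψ (e i) • χ := fun i =>
    ((A.image_iff (A.mem_domain_of_mem_graph (hg (e i)))).2 (hg (e i))).symm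
  simp only [hval, inner_smul_right]
  exact e.hasSum_inner_mul_inner ψ χ

lemma HasExpectation.expectation_eq [CompleteSpace 𝓗] {ρ : 𝓗 →L[ℂ] 𝓗} {A : 𝓗 →ₗ.[ℂ] 𝓗} {z : ℂ}
    (h : HasExpectation ρ A z) : expectation ρ A = z := by
  have h' : ∃ z, HasExpectation ρ A z := ⟨z, h⟩
  rw [expectation, dif_pos h']
  obtain ⟨_, h1⟩ := h'.choose_spec
  obtain ⟨_, h2⟩ := h
  obtain ⟨w, e, -⟩ := exists_hilbertBasis ℂ 𝓗
  exact (h1 w e).unique (h2 w e)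

end Expectation

/-! ### Closures of symmetric operators on the Schwartz space -/

section Closure

variable {V : Type} [Fintype V]

/-- `T` is symmetric on the Schwartz space with respect to the `L²` inner product. -/
def IsSymmS (T : Schw V →L[ℂ] Schw V) : Prop :=
  ∀ g h : Schw V, inner ℂ (schwEmb (T g)) (schwEmb h) = inner ℂ (schwEmb g) (schwEmb (T h))

/-- The graph of `T` in `L² × L²`. -/
def graphS (T : Schw V →L[ℂ] Schw V) : Submodule ℂ (L2 V × L2 V) :=
  LinearMap.range ((schwEmb : Schw V →ₗ[ℂ] L2 V).prod (schwEmb ∘ₗ T.toLinearMap))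

lemma denseRange_schwEmb : DenseRange (schwEmb : Schw V →ₗ[ℂ] L2 V) :=
  SchwartzMap.denseRange_toLpCLM (E := EuclideanSpace ℝ V) (F := ℂ) (by norm_num)

/-- A symmetric operator is closable: a limit `(0, χ)` of points of its graph is orthogonal to the
Schwartz space. -/
lemma graph_closedOp {T : Schw V →L[ℂ] Schw V} (hT : IsSymmS T) :
    (closedOp T).graph = (graphS T).topologicalClosure := by
  have hgr : ∀ A : L2 V →ₗ.[ℂ] L2 V, A = { domain := LinearMap.range (schwEmb : Schw V →ₗ[ℂ] L2 V)
                                           toFun := schwEmb ∘ₗ T.toLinearMap ∘ₗ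
        (LinearEquiv.ofInjective (schwEmb : Schw V →ₗ[ℂ] L2 V) schwEmb_injective).symm.toLinearMap } →
      A.graph = graphS T := by
    rintro A rfl
    ext ⟨x, y⟩
    rw [LinearPMap.mem_graph_iff]
    constructor
    · rintro ⟨⟨_, g, rfl⟩, rfl, rfl⟩
      refine ⟨g, Prod.ext rfl ?_⟩
      have : (LinearEquiv.ofInjective (schwEmb : Schw V →ₗ[ℂ] L2 V) schwEmb_injective).symm
          ⟨schwEmb g, g, rfl⟩ = g := LinearEquiv.symm_apply_apply
        (LinearEquiv.ofInjective (schwEmb : Schw V →ₗ[ℂ] L2 V) schwEmb_injective) g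
      exact congrArg (fun g => schwEmb (T g)) this.symm
    · rintro ⟨g, hg⟩
      obtain ⟨rfl, rfl⟩ := Prod.ext_iff.1 hg
      refine ⟨⟨schwEmb g, g, rfl⟩, rfl, ?_⟩
      have : (LinearEquiv.ofInjective (schwEmb : Schw V →ₗ[ℂ] L2 V) schwEmb_injective).symm
          ⟨schwEmb g, g, rfl⟩ = g := LinearEquiv.symm_apply_apply
        (LinearEquiv.ofInjective (schwEmb : Schw V →ₗ[ℂ] L2 V) schwEmb_injective) g
      exact congrArg (fun g => schwEmb (T g)) this
  have hcl : ∀ p ∈ (graphS T).topologicalClosure, p.1 = 0 → p.2 = 0 := by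
    intro p hp h0
    have hadj : ∀ g : Schw V, inner ℂ (schwEmb g) p.2 = inner ℂ (schwEmb (T g)) p.1 := by
      intro g
      have hclosed : IsClosed {p : L2 V × L2 V |
          inner ℂ (schwEmb g) p.2 = inner ℂ (schwEmb (T g)) p.1} :=
        isClosed_eq (by fun_prop) (by fun_prop)
      refine closure_minimal ?_ hclosed hp
      rintro _ ⟨h, rfl⟩
      exact (hT g h).symm
    simp only [h0, inner_zero_right] at hadj
    refine (denseRange_schwEmb (V := V)).induction_on (p := fun x => inner ℂ x p.2 = 0)
      p.2 (isClosed_eq (by fun_prop) (by fun_prop)) hadj |> inner_self_eq_zero.1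
  unfold closedOp
  set A : L2 V →ₗ.[ℂ] L2 V := { domain := LinearMap.range (schwEmb : Schw V →ₗ[ℂ] L2 V)
                                toFun := _ } with hA
  have hAg := hgr A hA
  have hclos : A.IsClosable := ⟨(graphS T).topologicalClosure.toLinearPMap, by
    rw [Submodule.toLinearPMap_graph_eq _ hcl, hAg]⟩
  rw [← hclos.graph_closure_eq_closure_graph, hAg]

lemma mem_graph_closedOp {T : Schw V →L[ℂ] Schw V} (hT : IsSymmS T) (g : Schw V) :
    (schwEmb g, schwEmb (T g)) ∈ (closedOp T).graph := by
  rw [graph_closedOp hT]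
  exact Submodule.le_topologicalClosure _ ⟨g, rfl⟩

lemma inner_closedOp {T : Schw V →L[ℂ] Schw V} (hT : IsSymmS T) (g : Schw V)
    (ψ : (closedOp T).domain) :
    inner ℂ (schwEmb g) (closedOp T ψ) = inner ℂ (schwEmb (T g)) (ψ : L2 V) := by
  have hψ := (closedOp T).mem_graph ψ
  rw [graph_closedOp hT] at hψ
  have hclosed : IsClosed {p : L2 V × L2 V |
      inner ℂ (schwEmb g) p.2 = inner ℂ (schwEmb (T g)) p.1} :=
    isClosed_eq (by fun_prop) (by fun_prop)
  refine closure_minimal ?_ hclosed hψ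
  rintro _ ⟨h, rfl⟩
  exact (hT g h).symm

end Closure

/-! ### Coupled oscillators in normal coordinates -/

section NormalCoordinates

variable {V : Type} [Fintype V] [DecidableEq V]

lemma isSymmS_posL (v : EuclideanSpace ℝ V) : IsSymmS (posL v) := posL_symm v

lemma isSymmS_momL (v : EuclideanSpace ℝ V) : IsSymmS (momL v) := momL_symm v

lemma IsSymmS.add {S T : Schw V →L[ℂ] Schw V} (hS : IsSymmS S) (hT : IsSymmS T) :
    IsSymmS (S + T) := fun g h => by
  simp only [add_apply, map_add, inner_add_left, inner_add_right, hS g h, hT g h]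

lemma IsSymmS.smul {T : Schw V →L[ℂ] Schw V} (a : ℝ) (hT : IsSymmS T) :
    IsSymmS ((a : ℂ) • T) := fun g h => by
  simp only [smul_apply, map_smul, inner_smul_left, inner_smul_right, hT g h,
    Complex.conj_ofReal]

lemma IsSymmS.sum {ι : Type*} {s : Finset ι} {T : ι → Schw V →L[ℂ] Schw V}
    (hT : ∀ i, IsSymmS (T i)) : IsSymmS (∑ i ∈ s, T i) := fun g h => by
  simp only [sum_apply, map_sum, sum_inner, inner_sum, hT _ g h]

lemma IsSymmS.sq {T : Schw V →L[ℂ] Schw V} (hT : IsSymmS T) : IsSymmS (T ^ 2) := fun g h => by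
  rw [pow_two, mul_apply_eq_comp, mul_apply_eq_comp, hT, hT]

variable (f : OrthonormalBasis V ℝ (EuclideanSpace ℝ V)) (c : V → ℝ)

/-- The Hamiltonian `∑_i (P_i² + (c_i / 2) Q_i²)` in the coordinates of the orthonormal basis
`f`. -/
def normalHam : Schw V →L[ℂ] Schw V :=
  ∑ i, (momL (f i) ^ 2 + ((c i / 2 : ℝ) : ℂ) • posL (f i) ^ 2)

lemma isSymmS_normalHam : IsSymmS (normalHam f c) :=
  IsSymmS.sum fun _ => (isSymmS_momL _).sq.add ((isSymmS_posL _).sq.smul _)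

/-- The eigenvalue of `normalHam f c` at the product Hermite function with multi-index `n`. -/
def energy (n : V → ℕ) : ℝ := ∑ i, freq (c i) * (2 * n i + 1)

variable {c}

lemma normalHam_hermS (hc : ∀ i, 0 < c i) (n : V → ℕ) :
    normalHam f c (hermS f c n) = (energy c n : ℂ) • hermS f c n := by
  rw [normalHam, sum_apply, energy, Complex.ofReal_sum, Finset.sum_smul]
  refine Finset.sum_congr rfl fun i _ => ?_
  rw [← oscillator_hermS hc, add_apply, smul_apply, pow_two, pow_two, mul_apply_eq_comp,
    mul_apply_eq_comp]

lemma energy_raise (n : V → ℕ) (i : V) : energy c (raise n i) = energy c n + 2 * freq (c i) := by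
  unfold energy
  rw [← Finset.add_sum_erase _ _ (Finset.mem_univ i), ← Finset.add_sum_erase _ _ (Finset.mem_univ i),
    raise_self, Finset.sum_congr rfl fun j hj => by
      rw [raise_of_ne n (Finset.ne_of_mem_erase hj)]]
  push_cast
  ring

/-- The evolution `e^{-itH}` of `H = normalHam f c`. -/
def normalEvol (hc : ∀ i, 0 < c i) (t : ℝ) : L2 V →L[ℂ] L2 V := evol (hermBasis f hc) (energy c) t

lemma normalEvol_hermS (hc : ∀ i, 0 < c i) (t : ℝ) (n : V → ℕ) :
    normalEvol f hc t (schwEmb (hermS f c n)) = phase (energy c n) t • schwEmb (hermS f c n) := by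
  rw [← hermBasis_apply hc, normalEvol, evol_basis]

lemma inner_hermBasis_normalHam (hc : ∀ i, 0 < c i) (ψ : (closedOp (normalHam f c)).domain)
    (n : V → ℕ) :
    inner ℂ (hermBasis f hc n) (closedOp (normalHam f c) ψ) =
      energy c n * inner ℂ (hermBasis f hc n) (ψ : L2 V) := by
  rw [hermBasis_apply, inner_closedOp (isSymmS_normalHam f c), normalHam_hermS f hc, map_smul,
    inner_smul_left, Complex.conj_ofReal]

lemma isUnitaryGroup_normalEvol (hc : ∀ i, 0 < c i) :
    IsUnitaryGroup (closedOp (normalHam f c)) (normalEvol f hc) :=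
  isUnitaryGroup_evol _ _ (inner_hermBasis_normalHam f hc)

lemma unitaryGroup_normalHam (hc : ∀ i, 0 < c i) :
    unitaryGroup (closedOp (normalHam f c)) = normalEvol f hc := by
  refine unitaryGroup_eq_evol _ _ (inner_hermBasis_normalHam f hc) fun n => ?_
  rw [hermBasis_apply, ← map_smul, ← normalHam_hermS f hc]
  exact mem_graph_closedOp (isSymmS_normalHam f c) _

/-! ### Ladder operators and expansions -/

variable (c)

/-- The lowering operator `a_i`. -/
def lowS (i : V) : Schw V →L[ℂ] Schw V :=
  (1 / 2 : ℂ) • (((√(2 * freq (c i)) : ℝ) : ℂ) • posL (f i) +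
    (Complex.I * ((1 / √(freq (c i) / 2) : ℝ) : ℂ)) • momL (f i))

/-- The raising operator `a_i†`. -/
def raiS (i : V) : Schw V →L[ℂ] Schw V :=
  (1 / 2 : ℂ) • (((√(2 * freq (c i)) : ℝ) : ℂ) • posL (f i) -
    (Complex.I * ((1 / √(freq (c i) / 2) : ℝ) : ℂ)) • momL (f i))

variable {c}

lemma sqrt_two_freq_ne_zero {c : ℝ} (hc : 0 < c) : ((√(2 * freq c) : ℝ) : ℂ) ≠ 0 := by
  have := freq_pos hc
  norm_cast
  positivity

lemma sqrt_half_freq_ne_zero {c : ℝ} (hc : 0 < c) : ((√(freq c / 2) : ℝ) : ℂ) ≠ 0 := by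
  have := freq_pos hc
  norm_cast
  positivity

lemma posL_eq_ladder (hc : ∀ i, 0 < c i) (i : V) :
    posL (f i) = ((1 / √(2 * freq (c i)) : ℝ) : ℂ) • (lowS f c i + raiS f c i) := by
  have h := sqrt_two_freq_ne_zero (hc i)
  ext g u
  simp only [lowS, raiS, smul_apply, add_apply, sub_apply, smul_eq_mul]
  push_cast
  field_simp
  ring

lemma momL_eq_ladder (hc : ∀ i, 0 < c i) (i : V) :
    momL (f i) = (-Complex.I * ((√(freq (c i) / 2) : ℝ) : ℂ)) • (lowS f c i - raiS f c i) := by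
  have h := sqrt_half_freq_ne_zero (hc i)
  have hI := Complex.I_sq
  ext g u
  simp only [lowS, raiS, smul_apply, add_apply, sub_apply, smul_eq_mul]
  push_cast
  field_simp
  linear_combination 2 * (momL (f i) g u) * hI

lemma momL_eq_ladder_add (hc : ∀ i, 0 < c i) (i : V) :
    momL (f i) = (-Complex.I * ((√(freq (c i) / 2) : ℝ) : ℂ)) •
      (lowS f c i + (-1 : ℂ) • raiS f c i) := by
  rw [momL_eq_ladder f hc, sub_eq_add_neg, neg_one_smul]

lemma lowS_hermS (hc : ∀ i, 0 < c i) (i : V) (n : V → ℕ) :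
    lowS f c i (hermS f c n) = ((√(n i : ℝ) : ℝ) : ℂ) • hermS f c (lower n i) := by
  have h := sqrt_two_freq_ne_zero (hc i)
  have h' := sqrt_half_freq_ne_zero (hc i)
  have hI := Complex.I_sq
  rw [lowS, smul_apply, add_apply, smul_apply, smul_apply, posL_hermS hc, momL_hermS hc]
  ext u
  simp only [smul_apply, add_apply, sub_apply, smul_eq_mul]
  generalize hermS f c (lower n i) u = A
  generalize hermS f c (raise n i) u = B
  generalize ((√((n i + 1 : ℕ) : ℝ) : ℝ) : ℂ) = r
  push_cast
  field_simp
  linear_combination -(((√(n i : ℝ) : ℝ) : ℂ) * A - r * B) * hI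

lemma raiS_hermS (hc : ∀ i, 0 < c i) (i : V) (n : V → ℕ) :
    raiS f c i (hermS f c n) = ((√((n i + 1 : ℕ) : ℝ) : ℝ) : ℂ) • hermS f c (raise n i) := by
  have h := sqrt_two_freq_ne_zero (hc i)
  have h' := sqrt_half_freq_ne_zero (hc i)
  have hI := Complex.I_sq
  rw [raiS, smul_apply, sub_apply, smul_apply, smul_apply, posL_hermS hc, momL_hermS hc]
  ext u
  simp only [smul_apply, add_apply, sub_apply, smul_eq_mul]
  generalize hermS f c (lower n i) u = A
  generalize hermS f c (raise n i) u = B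
  generalize ((√((n i + 1 : ℕ) : ℝ) : ℝ) : ℂ) = r
  push_cast
  field_simp
  linear_combination (((√(n i : ℝ) : ℝ) : ℂ) * A - r * B) * hI

lemma lowS_adjoint (i : V) (g h : Schw V) :
    inner ℂ (schwEmb (lowS f c i g)) (schwEmb h) = inner ℂ (schwEmb g) (schwEmb (raiS f c i h)) := by
  simp only [lowS, raiS, smul_apply, add_apply, sub_apply, map_smul, map_add, map_sub,
    inner_smul_left, inner_smul_right, inner_add_left, inner_sub_right, posL_symm, momL_symm,
    map_mul, Complex.conj_I, Complex.conj_ofReal, map_div₀, map_one, map_ofNat]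
  ring

lemma raiS_adjoint (i : V) (g h : Schw V) :
    inner ℂ (schwEmb (raiS f c i g)) (schwEmb h) = inner ℂ (schwEmb g) (schwEmb (lowS f c i h)) := by
  rw [← inner_conj_symm, ← lowS_adjoint, inner_conj_symm]

variable (c) in
/-- `R` may be applied term by term to the Hermite expansion of a Schwartz function. In other
words, the product Hermite functions span a core for `R` on the Schwartz space. -/
def TermwiseS (R : Schw V →L[ℂ] Schw V) : Prop :=
  ∀ g : Schw V, HasSum (fun n => inner ℂ (schwEmb (hermS f c n)) (schwEmb g) •
    schwEmb (R (hermS f c n))) (schwEmb (R g))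

variable {f} in
lemma TermwiseS.add {R S : Schw V →L[ℂ] Schw V} (hR : TermwiseS f c R) (hS : TermwiseS f c S) :
    TermwiseS f c (R + S) := fun g => by
  simpa only [add_apply, map_add, smul_add] using! (hR g).add (hS g)

variable {f} in
lemma TermwiseS.smul {R : Schw V →L[ℂ] Schw V} (a : ℂ) (hR : TermwiseS f c R) :
    TermwiseS f c (a • R) := fun g => by
  simpa only [smul_apply, map_smul, smul_comm _ a] using! (hR g).const_smul a

variable {f} in
lemma TermwiseS.sum {ι : Type*} {s : Finset ι} {R : ι → Schw V →L[ℂ] Schw V}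
    (hR : ∀ i, TermwiseS f c (R i)) : TermwiseS f c (∑ i ∈ s, R i) := fun g => by
  simpa only [sum_apply, map_sum, Finset.smul_sum] using! hasSum_sum fun i (_ : i ∈ s) => hR i g

lemma raise_injective (i : V) : Function.Injective fun n : V → ℕ => raise n i :=
  Function.LeftInverse.injective (g := fun n => lower n i) fun n => lower_raise n i

lemma eq_zero_of_notMem_range_raise {i : V} {n : V → ℕ}
    (hn : n ∉ Set.range fun n : V → ℕ => raise n i) : n i = 0 := by
  by_contra h
  exact hn ⟨lower n i, raise_lower h⟩

/-- Applying `a_i` to the Hermite expansion of `g` term by term gives the Hermite expansion of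
`a_i g`, as the adjoint `a_i†` acts on the indices as a shift; no convergence of the expansion of
`g` beyond that in `L²` is needed. -/
lemma termwiseS_lowS (hc : ∀ i, 0 < c i) (i : V) : TermwiseS f c (lowS f c i) := fun g => by
  rw [← (raise_injective i).hasSum_iff]
  · have e : ((fun n => inner ℂ (schwEmb (hermS f c n)) (schwEmb g) •
        schwEmb (lowS f c i (hermS f c n))) ∘ fun n => raise n i) = fun n =>
        (hermBasis f hc).repr (schwEmb (lowS f c i g)) n • hermBasis f hc n := by
      ext1 n
      rw [Function.comp_apply, HilbertBasis.repr_apply_apply, hermBasis_apply, ← raiS_adjoint,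
        raiS_hermS f hc, lowS_hermS f hc, map_smul, map_smul, inner_smul_left, Complex.conj_ofReal,
        raise_self, lower_raise, smul_smul, mul_comm]
    rw [e]
    exact (hermBasis f hc).hasSum_repr (schwEmb (lowS f c i g))
  · intro n hn
    rw [lowS_hermS f hc, eq_zero_of_notMem_range_raise hn]
    simp

lemma termwiseS_raiS (hc : ∀ i, 0 < c i) (i : V) : TermwiseS f c (raiS f c i) := fun g => by
  have h := (hermBasis f hc).hasSum_repr (schwEmb (raiS f c i g))
  have hco : ∀ n, (hermBasis f hc).repr (schwEmb (raiS f c i g)) n • hermBasis f hc n =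
      (((√(n i : ℝ) : ℝ) : ℂ) * inner ℂ (schwEmb (hermS f c (lower n i))) (schwEmb g)) •
        schwEmb (hermS f c n) := fun n => by
    rw [HilbertBasis.repr_apply_apply, hermBasis_apply, ← lowS_adjoint, lowS_hermS f hc, map_smul,
      inner_smul_left, Complex.conj_ofReal]
  simp only [hco] at h
  rw [← (raise_injective i).hasSum_iff] at h
  · have e : ((fun n => (((√(n i : ℝ) : ℝ) : ℂ) * inner ℂ (schwEmb (hermS f c (lower n i)))
        (schwEmb g)) • schwEmb (hermS f c n)) ∘ fun n => raise n i) = fun n =>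
        inner ℂ (schwEmb (hermS f c n)) (schwEmb g) • schwEmb (raiS f c i (hermS f c n)) := by
      ext1 n
      rw [Function.comp_apply, raiS_hermS f hc, map_smul, raise_self, lower_raise, smul_smul,
        mul_comm]
    rwa [e] at h
  · intro n hn
    rw [eq_zero_of_notMem_range_raise hn]
    simp

lemma posL_eq_sum (v : EuclideanSpace ℝ V) :
    posL v = ∑ i, ((inner ℝ (f i) v : ℝ) : ℂ) • posL (f i) := by
  conv_lhs => rw [← f.sum_repr' v]
  exact posL_sum _ _ _

lemma momL_eq_sum (v : EuclideanSpace ℝ V) :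
    momL v = ∑ i, ((inner ℝ (f i) v : ℝ) : ℂ) • momL (f i) := by
  conv_lhs => rw [← f.sum_repr' v]
  exact momL_sum _ _ _

lemma termwiseS_posL (hc : ∀ i, 0 < c i) (v : EuclideanSpace ℝ V) : TermwiseS f c (posL v) := by
  rw [posL_eq_sum f v]
  refine TermwiseS.sum fun i => TermwiseS.smul _ ?_
  rw [posL_eq_ladder f hc]
  exact ((termwiseS_lowS f hc i).add (termwiseS_raiS f hc i)).smul _

lemma termwiseS_momL (hc : ∀ i, 0 < c i) (v : EuclideanSpace ℝ V) : TermwiseS f c (momL v) := by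
  rw [momL_eq_sum f v]
  refine TermwiseS.sum fun i => TermwiseS.smul _ ?_
  rw [momL_eq_ladder_add f hc]
  exact ((termwiseS_lowS f hc i).add ((termwiseS_raiS f hc i).smul (-1))).smul _

/-! ### Heisenberg equations -/

variable {f} in
/-- `T e^{-itH} = e^{-itH} R` on the eigenfunctions of `H = normalHam f c`. -/
def Intertwines (hc : ∀ i, 0 < c i) (t : ℝ) (T R : Schw V →L[ℂ] Schw V) : Prop :=
  ∀ n, phase (energy c n) t • schwEmb (T (hermS f c n)) =
    normalEvol f hc t (schwEmb (R (hermS f c n)))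

variable {f}

lemma Intertwines.add {hc : ∀ i, 0 < c i} {t : ℝ} {T R T' R' : Schw V →L[ℂ] Schw V}
    (h : Intertwines (f := f) hc t T R) (h' : Intertwines (f := f) hc t T' R') :
    Intertwines (f := f) hc t (T + T') (R + R') := fun n => by
  simp only [add_apply, map_add, smul_add, h n, h' n]

lemma Intertwines.smul {hc : ∀ i, 0 < c i} {t : ℝ} (a : ℂ) {T R : Schw V →L[ℂ] Schw V}
    (h : Intertwines (f := f) hc t T R) : Intertwines (f := f) hc t (a • T) (a • R) := fun n => by
  simp only [smul_apply, map_smul, smul_comm _ a, h n]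

lemma Intertwines.sum {ι : Type*} {s : Finset ι} {hc : ∀ i, 0 < c i} {t : ℝ}
    {T R : ι → Schw V →L[ℂ] Schw V} (h : ∀ i, Intertwines (f := f) hc t (T i) (R i)) :
    Intertwines (f := f) hc t (∑ i ∈ s, T i) (∑ i ∈ s, R i) := fun n => by
  simp only [sum_apply, map_sum, Finset.smul_sum, h _ n]

lemma intertwines_lowS (hc : ∀ i, 0 < c i) (t : ℝ) (i : V) :
    Intertwines (f := f) hc t (lowS f c i) (phase (2 * freq (c i)) t • lowS f c i) := fun n => by
  rw [smul_apply, lowS_hermS f hc]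
  simp only [map_smul, normalEvol_hermS]
  by_cases hn : n i = 0
  · simp [hn]
  · have h : phase (energy c n) t =
        phase (2 * freq (c i)) t * phase (energy c (lower n i)) t := by
      conv_lhs => rw [← raise_lower hn]
      rw [energy_raise, phase, phase, phase, ← Complex.exp_add]
      congr 1
      push_cast
      ring
    rw [h]
    simp only [smul_smul]
    congr 1
    ring

lemma intertwines_raiS (hc : ∀ i, 0 < c i) (t : ℝ) (i : V) :
    Intertwines (f := f) hc t (raiS f c i) (phase (-(2 * freq (c i))) t • raiS f c i) :=
  fun n => by
  rw [smul_apply, raiS_hermS f hc]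
  simp only [map_smul, normalEvol_hermS]
  have h : phase (energy c n) t =
      phase (-(2 * freq (c i))) t * phase (energy c (raise n i)) t := by
    rw [energy_raise, phase, phase, phase, ← Complex.exp_add]
    congr 1
    push_cast
    ring
  rw [h]
  simp only [smul_smul]
  congr 1
  ring

lemma phase_eq_cos_sub_sin (w t : ℝ) : phase (2 * w) t =
    ((Real.cos (2 * w * t) : ℝ) : ℂ) - ((Real.sin (2 * w * t) : ℝ) : ℂ) * Complex.I := by
  rw [phase_eq, Complex.exp_mul_I, ← Complex.ofReal_cos, ← Complex.ofReal_sin, mul_comm t,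
    Real.cos_neg, Real.sin_neg]
  push_cast
  ring

lemma phase_neg_eq_cos_add_sin (w t : ℝ) : phase (-(2 * w)) t =
    ((Real.cos (2 * w * t) : ℝ) : ℂ) + ((Real.sin (2 * w * t) : ℝ) : ℂ) * Complex.I := by
  rw [← mul_neg, phase_eq_cos_sub_sin, mul_neg, neg_mul, Real.cos_neg, Real.sin_neg]
  push_cast
  ring

lemma sqrt_two_freq_mul {c : ℝ} (hc : 0 < c) :
    ((√(2 * freq c) : ℝ) : ℂ) * ((√(freq c / 2) : ℝ) : ℂ) = freq c := by
  have := freq_pos hc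
  rw [← Complex.ofReal_mul, ← Real.sqrt_mul (by positivity),
    show 2 * freq c * (freq c / 2) = freq c ^ 2 by ring, Real.sqrt_sq this.le]

lemma intertwines_posL (hc : ∀ i, 0 < c i) (t : ℝ) (i : V) :
    Intertwines (f := f) hc t (posL (f i))
      (((Real.cos (2 * freq (c i) * t) : ℝ) : ℂ) • posL (f i) +
        ((Real.sin (2 * freq (c i) * t) / freq (c i) : ℝ) : ℂ) • momL (f i)) := by
  have h := ((intertwines_lowS (f := f) hc t i).add (intertwines_raiS hc t i)).smul
    ((1 / √(2 * freq (c i)) : ℝ) : ℂ)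
  rw [← posL_eq_ladder f hc] at h
  convert h using 1
  rw [posL_eq_ladder f hc, momL_eq_ladder f hc, phase_eq_cos_sub_sin, phase_neg_eq_cos_add_sin]
  have h2 := sqrt_two_freq_ne_zero (hc i)
  have h3 := sqrt_half_freq_ne_zero (hc i)
  ext g u
  simp only [smul_apply, add_apply, sub_apply, smul_eq_mul]
  push_cast
  rw [← sqrt_two_freq_mul (hc i)]
  generalize ((√(2 * freq (c i)) : ℝ) : ℂ) = a at *
  generalize ((√(freq (c i) / 2) : ℝ) : ℂ) = b at *
  field_simp
  ring

lemma intertwines_momL (hc : ∀ i, 0 < c i) (t : ℝ) (i : V) :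
    Intertwines (f := f) hc t (momL (f i))
      (((-(freq (c i) * Real.sin (2 * freq (c i) * t)) : ℝ) : ℂ) • posL (f i) +
        ((Real.cos (2 * freq (c i) * t) : ℝ) : ℂ) • momL (f i)) := by
  have h := ((intertwines_lowS (f := f) hc t i).add ((intertwines_raiS hc t i).smul (-1))).smul
    (-Complex.I * ((√(freq (c i) / 2) : ℝ) : ℂ))
  rw [← momL_eq_ladder_add f hc] at h
  convert h using 1
  rw [posL_eq_ladder f hc, momL_eq_ladder f hc, phase_eq_cos_sub_sin, phase_neg_eq_cos_add_sin]
  have h2 := sqrt_two_freq_ne_zero (hc i)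
  have h3 := sqrt_half_freq_ne_zero (hc i)
  have hI := Complex.I_sq
  ext g u
  simp only [smul_apply, add_apply, sub_apply, smul_eq_mul]
  push_cast
  rw [← sqrt_two_freq_mul (hc i)]
  generalize ((√(2 * freq (c i)) : ℝ) : ℂ) = a at *
  generalize ((√(freq (c i) / 2) : ℝ) : ℂ) = b at *
  generalize Complex.sin _ = s
  generalize Complex.cos _ = k
  generalize lowS f c i g u = A
  generalize raiS f c i g u = B
  field_simp
  linear_combination (-s * (A + B)) * hI

/-- An operator that intertwines on eigenfunctions does so on the Schwartz space, with the closure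
of `T` in place of `T`: the Hermite expansion of `g` may be evolved term by term. -/
lemma Intertwines.mem_graph {hc : ∀ i, 0 < c i} {t : ℝ} {T R : Schw V →L[ℂ] Schw V}
    (h : Intertwines (f := f) hc t T R) (hT : IsSymmS T) (hR : TermwiseS f c R) (g : Schw V) :
    (normalEvol f hc t (schwEmb g), normalEvol f hc t (schwEmb (R g))) ∈ (closedOp T).graph := by
  have h1 := ((hermBasis f hc).hasSum_repr (schwEmb g)).mapL (normalEvol f hc t)
  have h2 := (hR g).mapL (normalEvol f hc t)
  have h3 := h1.prodMk h2
  rw [graph_closedOp hT]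
  refine (graphS T).isClosed_topologicalClosure.mem_of_tendsto h3 (.of_forall fun s => ?_)
  refine Submodule.sum_mem _ fun n _ => Submodule.le_topologicalClosure _ ?_
  refine ⟨(inner ℂ (schwEmb (hermS f c n)) (schwEmb g) * phase (energy c n) t) • hermS f c n, ?_⟩
  refine Prod.ext ?_ ?_
  · simp only [LinearMap.prod_apply, Function.prod_apply, map_smul, HilbertBasis.repr_apply_apply,
      hermBasis_apply, normalEvol_hermS, smul_smul, Prod.smul_mk]
  · simp only [LinearMap.prod_apply, Function.prod_apply, LinearMap.comp_apply, map_smul, ← h n,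
      mul_smul, ContinuousLinearMap.coe_coe, Prod.smul_mk]

end NormalCoordinates

/-! ### The propagator of positions and momenta -/

section Propagator

variable {V : Type} [Fintype V] [DecidableEq V]

/-- The kernel `∑_i f_i(x) φ_i f_i(y)` of the operator that is diagonal in the basis `f`. -/
def diagKernel (f : OrthonormalBasis V ℝ (EuclideanSpace ℝ V)) (φ : V → ℝ) : Matrix V V ℝ :=
  fun x y => ∑ i, f i x * φ i * f i y

/-- The matrix `M(t)` with `e^{itH} r_i e^{-itH} = ∑_k M(t)_{ik} r_k`, where `r = (q, p)` and
`H = normalHam f c`. -/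
def propagator (f : OrthonormalBasis V ℝ (EuclideanSpace ℝ V)) (c : V → ℝ) (t : ℝ) :
    Matrix (V ⊕ V) (V ⊕ V) ℝ :=
  Matrix.fromBlocks
    (diagKernel f fun i => Real.cos (2 * freq (c i) * t))
    (diagKernel f fun i => Real.sin (2 * freq (c i) * t) / freq (c i))
    (diagKernel f fun i => -(freq (c i) * Real.sin (2 * freq (c i) * t)))
    (diagKernel f fun i => Real.cos (2 * freq (c i) * t))

/-- The operators `(q, p)` on the Schwartz space. -/
def qpS : V ⊕ V → (Schw V →L[ℂ] Schw V) := Sum.elim posS momS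

lemma qp_eq_closedOp (i : V ⊕ V) : qp i = closedOp (qpS i) := by
  cases i <;> rfl

lemma isSymmS_qpS (i : V ⊕ V) : IsSymmS (qpS i) := by
  cases i with
  | inl x => rw [qpS, Sum.elim_inl, posS_eq_posL]; exact isSymmS_posL _
  | inr x => rw [qpS, Sum.elim_inr, momS_eq_momL]; exact isSymmS_momL _

variable {f : OrthonormalBasis V ℝ (EuclideanSpace ℝ V)} {c : V → ℝ}

lemma termwiseS_qpS (hc : ∀ i, 0 < c i) (i : V ⊕ V) : TermwiseS f c (qpS i) := by
  cases i with
  | inl x => rw [qpS, Sum.elim_inl, posS_eq_posL]; exact termwiseS_posL f hc _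
  | inr x => rw [qpS, Sum.elim_inr, momS_eq_momL]; exact termwiseS_momL f hc _

lemma sum_apply_smul_single (v : EuclideanSpace ℝ V) :
    ∑ y, v y • EuclideanSpace.single y (1 : ℝ) = v := by
  have := (EuclideanSpace.basisFun V ℝ).sum_repr v
  simpa using this

lemma posL_eq_sum_posS (v : EuclideanSpace ℝ V) : posL v = ∑ y, ((v y : ℝ) : ℂ) • posS y := by
  conv_lhs => rw [← sum_apply_smul_single v]
  rw [posL_sum]
  simp only [posS_eq_posL]

lemma momL_eq_sum_momS (v : EuclideanSpace ℝ V) : momL v = ∑ y, ((v y : ℝ) : ℂ) • momS y := by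
  conv_lhs => rw [← sum_apply_smul_single v]
  rw [momL_sum]
  simp only [momS_eq_momL]

lemma sum_smul_posL_add_momL (f : OrthonormalBasis V ℝ (EuclideanSpace ℝ V)) (φ χ : V → ℝ)
    (x : V) :
    ∑ i, ((f i x : ℝ) : ℂ) • (((φ i : ℝ) : ℂ) • posL (f i) + ((χ i : ℝ) : ℂ) • momL (f i)) =
      ∑ y, ((diagKernel f φ x y : ℝ) : ℂ) • posS y +
        ∑ y, ((diagKernel f χ x y : ℝ) : ℂ) • momS y := by
  simp only [diagKernel, Complex.ofReal_sum, Finset.sum_smul, posL_eq_sum_posS (f _),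
    momL_eq_sum_momS (f _), smul_add, Finset.sum_add_distrib, Finset.smul_sum, smul_smul,
    Complex.ofReal_mul, mul_assoc]
  congr 1 <;> exact Finset.sum_comm

lemma inner_single_right_eq (v : EuclideanSpace ℝ V) (x : V) :
    inner ℝ v (EuclideanSpace.single x (1 : ℝ)) = v x := by
  rw [EuclideanSpace.inner_single_right]
  simp

lemma intertwines_qpS (hc : ∀ i, 0 < c i) (t : ℝ) (i : V ⊕ V) :
    Intertwines (f := f) hc t (qpS i)
      (∑ k, ((propagator f c t i k : ℝ) : ℂ) • qpS k) := by
  rw [Fintype.sum_sum_type]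
  cases i with
  | inl x =>
    have h := Intertwines.sum (s := Finset.univ) fun i =>
      (intertwines_posL (f := f) hc t i).smul ((f i x : ℝ) : ℂ)
    rw [sum_smul_posL_add_momL] at h
    rw [qpS, Sum.elim_inl, posS_eq_posL, posL_eq_sum f]
    simp only [inner_single_right_eq]
    exact h
  | inr x =>
    have h := Intertwines.sum (s := Finset.univ) fun i =>
      (intertwines_momL (f := f) hc t i).smul ((f i x : ℝ) : ℂ)
    rw [sum_smul_posL_add_momL] at h
    rw [qpS, Sum.elim_inr, momS_eq_momL, momL_eq_sum f]
    simp only [inner_single_right_eq]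
    exact h

/-- The Heisenberg equations: `r_i e^{-itH} g = e^{-itH} ∑_k M(t)_{ik} r_k g` for Schwartz
functions `g`. -/
lemma qp_evol_mem_graph (hc : ∀ i, 0 < c i) (t : ℝ) (i : V ⊕ V) (g : Schw V) :
    (normalEvol f hc t (schwEmb g),
      normalEvol f hc t (schwEmb (∑ k, ((propagator f c t i k : ℝ) : ℂ) • qpS k g))) ∈
        (qp i).graph := by
  rw [qp_eq_closedOp]
  have hR : TermwiseS f c (∑ k, ((propagator f c t i k : ℝ) : ℂ) • qpS k) :=
    TermwiseS.sum fun k => (termwiseS_qpS hc k).smul _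
  have h := (intertwines_qpS (f := f) hc t i).mem_graph (isSymmS_qpS i) hR g
  simpa only [sum_apply, smul_apply] using h

lemma schrodinger_rankOne (hc : ∀ i, 0 < c i) {H : L2 V →ₗ.[ℂ] L2 V}
    (hH : H = closedOp (normalHam f c)) (t : ℝ) (ψ : L2 V) :
    schrodinger H (InnerProductSpace.rankOne ℂ ψ ψ) t =
      InnerProductSpace.rankOne ℂ (normalEvol f hc t ψ) (normalEvol f hc t ψ) := by
  ext1 v
  rw [schrodinger, hH, unitaryGroup_normalHam f hc, mul_apply_eq_comp, mul_apply_eq_comp,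
    InnerProductSpace.rankOne_apply, InnerProductSpace.rankOne_apply, map_smul, normalEvol,
    normalEvol, inner_evol_left]

lemma inner_normalEvol (hc : ∀ i, 0 < c i) (t : ℝ) (φ ψ : L2 V) :
    inner ℂ (normalEvol f hc t φ) (normalEvol f hc t ψ) = inner ℂ φ ψ :=
  inner_evol_evol _ _ t φ ψ

lemma hasExpectation_qp (hc : ∀ i, 0 < c i) {H : L2 V →ₗ.[ℂ] L2 V}
    (hH : H = closedOp (normalHam f c)) (t : ℝ) (g : Schw V) (i : V ⊕ V) :
    HasExpectation (schrodinger H (InnerProductSpace.rankOne ℂ (schwEmb g) (schwEmb g)) t) (qp i)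
      (∑ k, ((propagator f c t i k : ℝ) : ℂ) * inner ℂ (schwEmb g) (schwEmb (qpS k g))) := by
  rw [schrodinger_rankOne hc hH]
  have h := hasExpectation_rankOne (qp_evol_mem_graph (f := f) hc t i g)
  rw [inner_normalEvol] at h
  simpa only [map_sum, map_smul, inner_sum, inner_smul_right] using h

/-- The evolved state is in the domain of `r_i r_j`: two applications of the Heisenberg equations
stay in the image of the Schwartz space under the evolution. -/
lemma hasExpectation_opMul_qp (hc : ∀ i, 0 < c i) {H : L2 V →ₗ.[ℂ] L2 V}
    (hH : H = closedOp (normalHam f c)) (t : ℝ) (g : Schw V) (i j : V ⊕ V) :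
    HasExpectation (schrodinger H (InnerProductSpace.rankOne ℂ (schwEmb g) (schwEmb g)) t)
      (opMul (qp i) (qp j))
      (∑ k, ∑ l, ((propagator f c t i k : ℝ) : ℂ) * ((propagator f c t j l : ℝ) : ℂ) *
        inner ℂ (schwEmb (qpS k g)) (schwEmb (qpS l g))) := by
  rw [schrodinger_rankOne hc hH]
  have h := hasExpectation_rankOne (mem_graph_opMul (qp_evol_mem_graph (f := f) hc t j g)
    (qp_evol_mem_graph (f := f) hc t i _))
  rw [inner_normalEvol] at h
  have e : inner ℂ (schwEmb g) (schwEmb (∑ k, ((propagator f c t i k : ℝ) : ℂ) •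
      qpS k (∑ l, ((propagator f c t j l : ℝ) : ℂ) • qpS l g))) =
      ∑ k, ∑ l, ((propagator f c t i k : ℝ) : ℂ) * ((propagator f c t j l : ℝ) : ℂ) *
        inner ℂ (schwEmb (qpS k g)) (schwEmb (qpS l g)) := by
    simp only [map_sum, map_smul, inner_sum, inner_smul_right, mul_assoc, Finset.smul_sum,
      isSymmS_qpS _ g]
  rwa [e] at h

end Propagator

/-! ### Normal coordinates of the oscillator system -/

section Model

lemma sum_edgeFinset_eq {V : Type} [Fintype V] [DecidableEq V] (G : SimpleGraph V)
    [DecidableRel G.Adj] (F : Sym2 V → ℝ) :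
    2 * ∑ e ∈ G.edgeFinset, F e = ∑ i, ∑ j, if G.Adj i j then F s(i, j) else 0 := by
  have h1 : ∑ i, ∑ j, (if G.Adj i j then F s(i, j) else 0) = ∑ d : G.Dart, F d.edge := by
    rw [← Finset.sum_product' (f := fun i j => if G.Adj i j then F s(i, j) else 0),
      ← Finset.sum_filter]
    symm
    refine Finset.sum_bij (fun d _ => d.toProd) (fun d _ => ?_) (fun d _ d' _ h => ?_)
      (fun p hp => ?_) (fun d _ => rfl)
    · simp [d.adj]
    · exact SimpleGraph.Dart.ext _ _ h
    · exact ⟨⟨p, (Finset.mem_filter.1 hp).2⟩, Finset.mem_univ _, rfl⟩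
  have h2 : ∑ d : G.Dart, F d.edge =
      ∑ e ∈ G.edgeFinset, ∑ d : G.Dart with d.edge = e, F d.edge :=
    (Finset.sum_fiberwise_of_maps_to (fun d _ => by
      rw [SimpleGraph.mem_edgeFinset]; exact d.edge_mem) _).symm
  rw [h1, h2, Finset.mul_sum]
  refine Finset.sum_congr rfl fun e he => ?_
  rw [Finset.sum_congr rfl (g := fun _ => F e) (fun d hd => by rw [(Finset.mem_filter.1 hd).2]),
    Finset.sum_const, G.dart_edge_fiber_card e (SimpleGraph.mem_edgeFinset.1 he)]
  simp

lemma dotProduct_mulVec_eq_sum_eigenvalues {V : Type} [Fintype V] [DecidableEq V]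
    {A : Matrix V V ℝ} (hA : A.IsHermitian) (u : EuclideanSpace ℝ V) :
    (u : V → ℝ) ⬝ᵥ A.mulVec u =
      ∑ i, hA.eigenvalues i * (inner ℝ (hA.eigenvectorBasis i) u) ^ 2 := by
  have h1 : ∀ v w : EuclideanSpace ℝ V, inner ℝ v w = (v : V → ℝ) ⬝ᵥ w := fun v w => by
    rw [EuclideanSpace.inner_eq_star_dotProduct, star_trivial, dotProduct_comm]
  have h2 : ∀ i, inner ℝ (hA.eigenvectorBasis i) (WithLp.toLp 2 (A.mulVec u)) =
      hA.eigenvalues i * inner ℝ (hA.eigenvectorBasis i) u := fun i => by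
    have hT : A.transpose = A := by
      have := hA.eq
      rwa [Matrix.conjTranspose_eq_transpose_of_trivial] at this
    rw [h1, h1, Matrix.dotProduct_mulVec, ← Matrix.mulVec_transpose, hT,
      hA.mulVec_eigenvectorBasis, smul_dotProduct, smul_eq_mul]
  have h3 := hA.eigenvectorBasis.sum_inner_mul_inner u (WithLp.toLp 2 (A.mulVec u))
  rw [h1] at h3
  refine h3.symm.trans (Finset.sum_congr rfl fun i _ => ?_)
  rw [h2, real_inner_comm]
  ring

variable {d : ℕ} (lam : ℝ) (κ : (Fin d → ℤ) → ℝ) (Λ : Finset (Fin d → ℤ))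

/-- The orthonormal basis of normal modes of `h_Λ`. -/
def modes : OrthonormalBasis Λ ℝ (EuclideanSpace ℝ Λ) :=
  (effHam_isHermitian lam κ Λ).eigenvectorBasis

/-- Twice the eigenvalues of `h_Λ`: these are the parameters of the normal modes. -/
def modeParam (i : Λ) : ℝ := 2 * (effHam_isHermitian lam κ Λ).eigenvalues i

lemma dotProduct_effHam_mulVec (u : Λ → ℝ) :
    u ⬝ᵥ (effHam lam κ Λ).mulVec u = lam * ((∑ x, ∑ y, if (nnGraph Λ).Adj x y then
      (u x - u y) ^ 2 else 0) / 2) + ∑ x : Λ, κ x.1 / 2 * u x ^ 2 := by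
  rw [← SimpleGraph.lapMatrix_toLinearMap₂' (R := ℝ), Matrix.toLinearMap₂'_apply', effHam,
    Matrix.add_mulVec, dotProduct_add, Matrix.smul_mulVec, dotProduct_smul, smul_eq_mul]
  congr 1
  simp only [dotProduct, Matrix.mulVec_diagonal]
  refine Finset.sum_congr rfl fun x _ => by ring

/-- The Hamiltonian decouples in the normal modes of `h_Λ`: its kinetic part is minus the Laplacian,
which looks the same in all orthonormal bases, and its potential is the quadratic form of `h_Λ`. -/
lemma hamS_eq_normalHam :
    hamS lam κ Λ = normalHam (modes lam κ Λ) (modeParam lam κ Λ) := by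
  have hmom : ∀ (b : OrthonormalBasis Λ ℝ (EuclideanSpace ℝ Λ)) (g : Schw Λ),
      ∑ i, (momL (b i) ^ 2) g = -Laplacian.laplacian g := by
    intro b g
    rw [SchwartzMap.laplacian_eq_sum b, ← Finset.sum_neg_distrib]
    refine Finset.sum_congr rfl fun i _ => ?_
    rw [pow_two, mul_apply_eq_comp]
    simp only [momL, smul_apply, map_smul, smul_smul]
    rw [neg_mul_neg, Complex.I_mul_I, neg_one_smul]
    rfl
  ext g u
  have h1 : hamS lam κ Λ g u = (∑ x : Λ, (momS x ^ 2) g) u +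
      (((u : Λ → ℝ) ⬝ᵥ (effHam lam κ Λ).mulVec u : ℝ) : ℂ) * g u := by
    let F : Sym2 Λ → ℝ := Sym2.lift ⟨fun x y => lam * (u x - u y) ^ 2, fun x y => by ring⟩
    have hF : ∀ e : Sym2 Λ, (Sym2.lift ⟨fun x y => (lam : ℂ) • (posS x - posS y) ^ 2, fun x y => by
        beta_reduce
        rw [← neg_sub (posS y) (posS x), neg_sq]⟩ e : Schw Λ →L[ℂ] Schw Λ) g u =
        ((F e : ℝ) : ℂ) * g u := by
      intro e
      induction e using Sym2.ind with
      | _ x y =>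
        simp only [F, Sym2.lift_mk, smul_apply, pow_two, mul_apply_eq_comp, sub_apply, posS_apply,
          smul_eq_mul]
        push_cast
        ring
    have hE : ∑ e ∈ (nnGraph Λ).edgeFinset, F e = lam * ((∑ x, ∑ y,
        if (nnGraph Λ).Adj x y then (u x - u y) ^ 2 else 0) / 2) := by
      have := sum_edgeFinset_eq (nnGraph Λ) F
      rw [← mul_right_inj' (two_ne_zero (α := ℝ)), this, mul_left_comm, mul_div_cancel₀ _
        two_ne_zero, Finset.mul_sum]
      refine Finset.sum_congr rfl fun x _ => ?_
      rw [Finset.mul_sum]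
      refine Finset.sum_congr rfl fun y _ => ?_
      simp only [F, Sym2.lift_mk, mul_ite, mul_zero]
    rw [dotProduct_effHam_mulVec, ← hE, hamS, add_apply, add_apply, sum_apply, sum_apply,
      sum_apply, sum_apply]
    simp only [hF, add_apply, smul_apply, Finset.sum_add_distrib, sum_apply]
    push_cast
    rw [add_mul, Finset.sum_mul, Finset.sum_mul, add_assoc]
    congr 1
    rw [add_comm]
    congr 1
    refine Finset.sum_congr rfl fun x _ => ?_
    simp only [Function.iterate_succ, Function.iterate_zero, Function.comp_apply, id, posS_apply,
      smul_eq_mul]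
    ring
  have h2 : normalHam (modes lam κ Λ) (modeParam lam κ Λ) g u =
      (∑ i, (momL (modes lam κ Λ i) ^ 2) g) u +
      ((∑ i, (effHam_isHermitian lam κ Λ).eigenvalues i *
        (inner ℝ ((effHam_isHermitian lam κ Λ).eigenvectorBasis i) u) ^ 2 : ℝ) : ℂ) * g u := by
    rw [normalHam, sum_apply]
    simp only [add_apply, smul_apply, Finset.sum_add_distrib, sum_apply]
    congr 1
    rw [Complex.ofReal_sum, Finset.sum_mul]
    refine Finset.sum_congr rfl fun i _ => ?_
    rw [pow_two, mul_apply_eq_comp, posL_apply, posL_apply, modeParam, modes]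
    simp only [smul_eq_mul]
    push_cast
    ring
  rw [h1, h2, dotProduct_mulVec_eq_sum_eigenvalues (effHam_isHermitian lam κ Λ), hmom,
    ← hmom (EuclideanSpace.basisFun Λ ℝ)]
  simp [momS_eq_momL]

end Model

/-! ### Moments of product Hermite states -/

section Moments

variable {V : Type} [Fintype V] [DecidableEq V]
  {f : OrthonormalBasis V ℝ (EuclideanSpace ℝ V)} {c : V → ℝ}

lemma inner_hermS (hc : ∀ i, 0 < c i) (m n : V → ℕ) :
    inner ℂ (schwEmb (hermS f c m)) (schwEmb (hermS f c n)) = if m = n then 1 else 0 :=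
  orthonormal_iff_ite.1 (orthonormal_hermS hc) m n

lemma raise_eq_raise_iff (n : V → ℕ) (i j : V) : raise n i = raise n j ↔ i = j := by
  refine ⟨fun h => ?_, fun h => by rw [h]⟩
  by_contra hij
  have := congrFun h i
  rw [raise_self, raise_of_ne n hij] at this
  lia

lemma lower_ne_lower {n : V → ℕ} {i j : V} (hij : i ≠ j) (hi : n i ≠ 0) :
    lower n i ≠ lower n j := fun h => by
  have := congrFun h i
  rw [lower_self, lower_of_ne n hij] at this
  lia

/-- Inner products of the combinations of `√n_i φ_{n - δ_i}` and `√(n_i + 1) φ_{n + δ_i}` that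
position and momentum make out of `φ_n`. -/
lemma inner_ladder (hc : ∀ i, 0 < c i) (n : V → ℕ) (i j : V) (a b a' b' : ℂ) :
    inner ℂ (schwEmb (a • (((√(n i : ℝ) : ℝ) : ℂ) • hermS f c (lower n i)) +
        b • (((√((n i + 1 : ℕ) : ℝ) : ℝ) : ℂ) • hermS f c (raise n i))))
      (schwEmb (a' • (((√(n j : ℝ) : ℝ) : ℂ) • hermS f c (lower n j)) +
        b' • (((√((n j + 1 : ℕ) : ℝ) : ℝ) : ℂ) • hermS f c (raise n j)))) =
      if i = j then (starRingEnd ℂ) a * a' * (n i : ℂ) + (starRingEnd ℂ) b * b' * (n i + 1 : ℂ)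
        else 0 := by
  have e1 : ∀ m : ℕ, ((√(m : ℝ) : ℝ) : ℂ) * ((√(m : ℝ) : ℝ) : ℂ) = m := fun m => by
    rw [← Complex.ofReal_mul, Real.mul_self_sqrt (by positivity)]; simp
  simp only [map_add, map_smul, inner_add_left, inner_add_right, inner_smul_left,
    inner_smul_right, Complex.conj_ofReal, inner_hermS hc, lower_ne_raise, (lower_ne_raise _ _ _).symm,
    raise_eq_raise_iff, if_false, mul_zero, add_zero, zero_add]
  by_cases hij : i = j
  · subst hij
    have e2 := e1 (n i)
    have e3 := e1 (n i + 1)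
    simp only [if_true, mul_one]
    push_cast at e3 ⊢
    linear_combination (starRingEnd ℂ) a * a' * e2 + (starRingEnd ℂ) b * b' * e3
  · rw [if_neg hij, if_neg hij]
    by_cases hi : n i = 0
    · simp [hi]
    · rw [if_neg (lower_ne_lower hij hi)]
      simp

lemma inner_hermS_ladder (hc : ∀ i, 0 < c i) (n : V → ℕ) (i : V) (a b : ℂ) :
    inner ℂ (schwEmb (hermS f c n))
      (schwEmb (a • (((√(n i : ℝ) : ℝ) : ℂ) • hermS f c (lower n i)) +
        b • (((√((n i + 1 : ℕ) : ℝ) : ℝ) : ℂ) • hermS f c (raise n i)))) = 0 := by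
  have h1 : n ≠ raise n i := fun h => by
    have := congrFun h i
    rw [raise_self] at this
    lia
  simp only [map_add, map_smul, inner_add_right, inner_smul_right, inner_hermS hc]
  rw [if_neg h1]
  by_cases hi : n i = 0
  · simp [hi]
  · have h2 : n ≠ lower n i := fun h => by
      have := congrFun h i
      rw [lower_self] at this
      lia
    rw [if_neg h2]
    simp

/-- The second moments `⟨r_k r_l⟩` of the product Hermite state with parameters `c` and
multi-index `n`, where `r = (q, p)`. The formula is meant for `c > 0`. -/
def moment (c : V → ℝ) (n : V → ℕ) : V ⊕ V → V ⊕ V → ℂ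
  | .inl x, .inl y => if x = y then (((2 * n x + 1) / (2 * freq (c x)) : ℝ) : ℂ) else 0
  | .inl x, .inr y => if x = y then Complex.I / 2 else 0
  | .inr x, .inl y => if x = y then -Complex.I / 2 else 0
  | .inr x, .inr y => if x = y then ((freq (c x) * (2 * n x + 1) / 2 : ℝ) : ℂ) else 0

/-- The product Hermite function in the standard coordinates. -/
def hermStd (c : V → ℝ) (n : V → ℕ) : Schw V := hermS (EuclideanSpace.basisFun V ℝ) c n

lemma posS_hermStd (hc : ∀ i, 0 < c i) (n : V → ℕ) (x : V) : posS x (hermStd c n) =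
    ((1 / √(2 * freq (c x)) : ℝ) : ℂ) •
      (((√(n x : ℝ) : ℝ) : ℂ) • hermS (EuclideanSpace.basisFun V ℝ) c (lower n x)) +
    ((1 / √(2 * freq (c x)) : ℝ) : ℂ) •
      (((√((n x + 1 : ℕ) : ℝ) : ℝ) : ℂ) • hermS (EuclideanSpace.basisFun V ℝ) c (raise n x)) := by
  have := posL_hermS (f := EuclideanSpace.basisFun V ℝ) hc n x
  rw [EuclideanSpace.basisFun_apply] at this
  rw [posS_eq_posL, hermStd, this, smul_add]

lemma momS_hermStd (hc : ∀ i, 0 < c i) (n : V → ℕ) (x : V) : momS x (hermStd c n) =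
    (-Complex.I * ((√(freq (c x) / 2) : ℝ) : ℂ)) •
      (((√(n x : ℝ) : ℝ) : ℂ) • hermS (EuclideanSpace.basisFun V ℝ) c (lower n x)) +
    (Complex.I * ((√(freq (c x) / 2) : ℝ) : ℂ)) •
      (((√((n x + 1 : ℕ) : ℝ) : ℝ) : ℂ) • hermS (EuclideanSpace.basisFun V ℝ) c (raise n x)) := by
  have := momL_hermS (f := EuclideanSpace.basisFun V ℝ) hc n x
  rw [EuclideanSpace.basisFun_apply] at this
  rw [momS_eq_momL, hermStd, this, smul_sub, neg_mul, neg_smul, neg_smul, sub_neg_eq_add]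

lemma mean_hermStd (hc : ∀ i, 0 < c i) (n : V → ℕ) (k : V ⊕ V) :
    inner ℂ (schwEmb (hermStd c n)) (schwEmb (qpS k (hermStd c n))) = 0 := by
  cases k with
  | inl x =>
    rw [qpS, Sum.elim_inl, posS_hermStd hc]
    exact inner_hermS_ladder hc n x _ _
  | inr x =>
    rw [qpS, Sum.elim_inr, momS_hermStd hc]
    exact inner_hermS_ladder hc n x _ _

lemma moment_hermStd (hc : ∀ i, 0 < c i) (n : V → ℕ) (k l : V ⊕ V) :
    inner ℂ (schwEmb (qpS k (hermStd c n))) (schwEmb (qpS l (hermStd c n))) = moment c n k l := by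
  have hα : ∀ x, ((1 / √(2 * freq (c x)) : ℝ) : ℂ) * ((1 / √(2 * freq (c x)) : ℝ) : ℂ) =
      1 / (2 * freq (c x)) := fun x => by
    have := freq_pos (hc x)
    rw [← Complex.ofReal_mul, div_mul_div_comm, Real.mul_self_sqrt (by positivity)]; simp
  have hβ : ∀ x, ((√(freq (c x) / 2) : ℝ) : ℂ) * ((√(freq (c x) / 2) : ℝ) : ℂ) =
      freq (c x) / 2 := fun x => by
    have := freq_pos (hc x)
    rw [← Complex.ofReal_mul, Real.mul_self_sqrt (by positivity)]; simp
  have hαβ : ∀ x, ((1 / √(2 * freq (c x)) : ℝ) : ℂ) * ((√(freq (c x) / 2) : ℝ) : ℂ) = 1 / 2 :=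
    fun x => by
      have h1 := sqrt_two_freq_ne_zero (hc x)
      have h2 : ((√(2 * freq (c x)) : ℝ) : ℂ) * ((√(2 * freq (c x)) : ℝ) : ℂ) =
          2 * freq (c x) := by
        have := freq_pos (hc x)
        rw [← Complex.ofReal_mul, Real.mul_self_sqrt (by positivity)]; simp
      have h3 := sqrt_two_freq_mul (hc x)
      push_cast
      field_simp
      apply mul_left_cancel₀ h1
      linear_combination 2 * h3 - h2
  have hI := Complex.I_sq
  rcases k with x | x <;> rcases l with y | y <;>
    simp only [qpS, Sum.elim_inl, Sum.elim_inr, posS_hermStd hc, momS_hermStd hc,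
      inner_ladder hc, moment] <;>
    by_cases hxy : x = y <;> simp only [hxy, if_true, if_false] <;>
    (subst hxy; simp only [map_mul, map_neg, Complex.conj_I, Complex.conj_ofReal])
  · have hw : (freq (c x) : ℂ) ≠ 0 := by exact_mod_cast (freq_pos (hc x)).ne'
    rw [hα]
    push_cast
    field_simp
    ring
  · linear_combination Complex.I * hαβ x
  · linear_combination -Complex.I * hαβ x
  · push_cast
    linear_combination -((2 * n x + 1) * ((√(freq (c x) / 2) : ℝ) : ℂ) *
      ((√(freq (c x) / 2) : ℝ) : ℂ)) * hI + (2 * n x + 1) * hβ x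

end Moments

/-! ### The quenched correlations -/

section Model

variable {d : ℕ} {lam : ℝ} {κ : (Fin d → ℤ) → ℝ} {Λ : Finset (Fin d → ℤ)}

lemma prodVec_eq (hκ : ∀ x : Λ, 0 < κ x.1) (n : Λ → ℕ) :
    prodVec κ Λ n = schwEmb (hermStd (fun x : Λ => κ x.1) n) := by
  have hfun : (fun u : EuclideanSpace ℝ Λ => ∏ x, ((hermiteFun (κ x.1) (n x) (u x) : ℝ) : ℂ)) =
      hermStd (fun x : Λ => κ x.1) n := by
    ext u
    rw [hermStd, hermS_apply hκ]
    refine Finset.prod_congr rfl fun x _ => ?_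
    rw [EuclideanSpace.basisFun_apply, EuclideanSpace.inner_single_left]
    simp
  have hmem := (hermStd (fun x : Λ => κ x.1) n).memLp 2 (volume : Measure (EuclideanSpace ℝ Λ))
  have h : MemLp (fun u : EuclideanSpace ℝ Λ =>
      ∏ x, ((hermiteFun (κ x.1) (n x) (u x) : ℝ) : ℂ)) 2 := by rwa [hfun]
  rw [prodVec, dif_pos h]
  change _ = hmem.toLp
  congr 1

lemma eigenvalues_effHam_eq (i : Λ) :
    (effHam_isHermitian lam κ Λ).eigenvalues i =
      lam * ((∑ x, ∑ y, if (nnGraph Λ).Adj x y then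
        (modes lam κ Λ i x - modes lam κ Λ i y) ^ 2 else 0) / 2) +
        ∑ x : Λ, κ x.1 / 2 * modes lam κ Λ i x ^ 2 := by
  rw [← dotProduct_effHam_mulVec,
    dotProduct_mulVec_eq_sum_eigenvalues (effHam_isHermitian lam κ Λ), Finset.sum_eq_single i]
  · rw [modes, real_inner_self_eq_norm_sq, OrthonormalBasis.norm_eq_one]
    ring
  · intro j _ hj
    rw [modes, OrthonormalBasis.inner_eq_zero _ hj]
    ring
  · simp

lemma sum_modes_sq (i : Λ) : ∑ x, modes lam κ Λ i x ^ 2 = 1 := by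
  have := (modes lam κ Λ).norm_eq_one i
  rw [EuclideanSpace.norm_eq, Real.sqrt_eq_one] at this
  simpa only [Real.norm_eq_abs, sq_abs] using this

lemma eigenvalues_effHam_pos (hlam : 0 < lam) (hκ : ∀ x : Λ, 0 < κ x.1) (i : Λ) :
    0 < (effHam_isHermitian lam κ Λ).eigenvalues i := by
  rw [eigenvalues_effHam_eq]
  refine add_pos_of_nonneg_of_pos ?_ ?_
  · refine mul_nonneg hlam.le (div_nonneg (Finset.sum_nonneg fun x _ => Finset.sum_nonneg fun y _ =>
      ?_) (by norm_num))
    split_ifs <;> positivity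
  · have h1 : ∀ x ∈ Finset.univ, 0 ≤ κ x.1 / 2 * modes lam κ Λ i x ^ 2 := fun x _ =>
      mul_nonneg (by linarith [hκ x]) (sq_nonneg _)
    refine lt_of_le_of_ne (Finset.sum_nonneg h1) fun h0 => ?_
    have h2 := (Finset.sum_eq_zero_iff_of_nonneg h1).1 h0.symm
    have h3 := sum_modes_sq (lam := lam) (κ := κ) i
    rw [Finset.sum_eq_zero] at h3
    · exact zero_ne_one h3
    · intro x hx
      exact (mul_eq_zero.1 (h2 x hx)).resolve_left (by linarith [hκ x])

lemma modeParam_pos (hlam : 0 < lam) (hκ : ∀ x : Λ, 0 < κ x.1) (i : Λ) :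
    0 < modeParam lam κ Λ i := by
  have := eigenvalues_effHam_pos hlam hκ i
  unfold modeParam
  linarith

lemma quenchWellDefined_prodState (hlam : 0 < lam) (hκ : ∀ x : Λ, 0 < κ x.1) (n : Λ → ℕ) :
    QuenchWellDefined lam κ Λ (prodState κ Λ n) := by
  have hH : ham lam κ Λ = closedOp (normalHam (modes lam κ Λ) (modeParam lam κ Λ)) := by
    rw [ham, hamS_eq_normalHam]
  refine ⟨⟨_, hH ▸ isUnitaryGroup_normalEvol (modes lam κ Λ) (modeParam_pos hlam hκ)⟩,
    fun t i j => ?_⟩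
  rw [prodState, prodVec_eq hκ]
  exact ⟨⟨_, hasExpectation_qp (modeParam_pos hlam hκ) hH t _ i⟩,
    ⟨_, hasExpectation_opMul_qp (modeParam_pos hlam hκ) hH t _ i j⟩⟩

/-- The quenched correlations of a product Hermite state: the first moments vanish, and the
second moments are transported by the propagator. -/
lemma quenchCorr_prodState (hlam : 0 < lam) (hκ : ∀ x : Λ, 0 < κ x.1) (n : Λ → ℕ) (t : ℝ)
    (i j : Λ ⊕ Λ) :
    quenchCorr lam κ Λ (prodState κ Λ n) t i j =
      ∑ k, ∑ l, ((propagator (modes lam κ Λ) (modeParam lam κ Λ) t i k : ℝ) : ℂ) *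
        ((propagator (modes lam κ Λ) (modeParam lam κ Λ) t j l : ℝ) : ℂ) *
          moment (fun x : Λ => κ x.1) n k l := by
  have hH : ham lam κ Λ = closedOp (normalHam (modes lam κ Λ) (modeParam lam κ Λ)) := by
    rw [ham, hamS_eq_normalHam]
  have hc := modeParam_pos hlam hκ
  simp only [quenchCorr, prodState, prodVec_eq hκ,
    (hasExpectation_qp hc hH t _ _).expectation_eq,
    (hasExpectation_opMul_qp hc hH t _ _ _).expectation_eq, mean_hermStd hκ, moment_hermStd hκ,
    mul_zero, Finset.sum_const_zero, sub_zero]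

end Model

/-! ### Propagator and singular eigenfunction correlators -/

section Model

variable {d : ℕ} {lam : ℝ} {κ : (Fin d → ℤ) → ℝ} {Λ : Finset (Fin d → ℤ)}

lemma freq_modeParam (i : Λ) : freq (modeParam lam κ Λ i) =
    √((effHam_isHermitian lam κ Λ).eigenvalues i) := by
  rw [freq, modeParam, mul_div_cancel_left₀ _ (two_ne_zero' ℝ)]

lemma effHamFun_apply (F : ℝ → ℂ) (x y : Λ) : effHamFun lam κ Λ F x y =
    ∑ i, (modes lam κ Λ i x : ℂ) * F ((effHam_isHermitian lam κ Λ).eigenvalues i) *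
      (modes lam κ Λ i y : ℂ) := by
  rw [effHamFun]
  simp only [Matrix.mul_apply, Matrix.diagonal_apply, Matrix.transpose_apply, Matrix.map_apply,
    Matrix.IsHermitian.eigenvectorUnitary_apply, mul_ite, mul_zero, Finset.sum_ite_eq',
    Finset.mem_univ, if_true, modes]

/-- If `|√r φ(r)| ≤ K` at the eigenvalues `r` of `h_Λ`, then `φ(h_Λ) = K h_Λ^{-1/2} g(h_Λ)` with
`|g| ≤ 1`. -/
lemma enorm_diagKernel_rpow_le (hlam : 0 < lam) (hκ : ∀ x : Λ, 0 < κ x.1) {K : ℝ} (hK : 0 < K)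
    (φ : ℝ → ℝ)
    (hφ : ∀ i, |√((effHam_isHermitian lam κ Λ).eigenvalues i) *
      φ ((effHam_isHermitian lam κ Λ).eigenvalues i)| ≤ K) (s : ℝ) (hs : 0 ≤ s) (x y : Λ) :
    ‖diagKernel (modes lam κ Λ) (fun i => φ ((effHam_isHermitian lam κ Λ).eigenvalues i)) x y‖ₑ ^ s
      ≤ ENNReal.ofReal K ^ s * singCorr lam κ Λ s x y := by
  -- The supremum runs over functions bounded by one on the whole line, so `g` is cut off where the
  -- hypothesis says nothing about `φ`.
  let g : ℝ → ℂ := fun r => if |√r * φ r| ≤ K then ((√r * φ r / K : ℝ) : ℂ) else 0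
  have hg : ∀ r, ‖g r‖ ≤ 1 := fun r => by
    simp only [g]
    split_ifs with h
    · rw [Complex.norm_real, Real.norm_eq_abs, abs_div, abs_of_pos hK]
      exact (div_le_one hK).2 h
    · simp
  have hval : ((diagKernel (modes lam κ Λ)
      (fun i => φ ((effHam_isHermitian lam κ Λ).eigenvalues i)) x y : ℝ) : ℂ) =
      (K : ℂ) * effHamFun lam κ Λ (fun r => ((r ^ (-(1 / 2) : ℝ) : ℝ) : ℂ) * g r) x y := by
    rw [effHamFun_apply, diagKernel, Complex.ofReal_sum, Finset.mul_sum]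
    refine Finset.sum_congr rfl fun i _ => ?_
    have hpos := eigenvalues_effHam_pos (Λ := Λ) hlam hκ i
    simp only [g]
    rw [if_pos (hφ i)]
    generalize (effHam_isHermitian lam κ Λ).eigenvalues i = r at hpos ⊢
    have h1 : r ^ (-(1 / 2) : ℝ) * √r = 1 := by
      rw [Real.sqrt_eq_rpow, ← Real.rpow_add hpos]
      norm_num
    have h2 : φ r = K * (r ^ (-(1 / 2) : ℝ) * (√r * φ r / K)) := by
      field_simp
      rw [mul_assoc, h1, mul_one]
    conv_lhs => rw [h2]
    push_cast
    ring
  have h3 : ‖diagKernel (modes lam κ Λ)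
      (fun i => φ ((effHam_isHermitian lam κ Λ).eigenvalues i)) x y‖ₑ = ENNReal.ofReal K *
      ‖effHamFun lam κ Λ (fun r => ((r ^ (-(1 / 2) : ℝ) : ℝ) : ℂ) * g r) x y‖ₑ := by
    have e1 : ∀ a : ℝ, ‖a‖ₑ = ‖(a : ℂ)‖ₑ := fun a => by
      rw [← ofReal_norm, ← ofReal_norm, Complex.norm_real]
    rw [e1, hval, enorm_mul, ← e1, Real.enorm_eq_ofReal hK.le]
  rw [h3, ENNReal.mul_rpow_of_nonneg _ _ hs]
  refine mul_le_mul_right ?_ _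
  exact le_iSup₂_of_le (f := fun (g : ℝ → ℂ) (_ : ∀ r, ‖g r‖ ≤ 1) =>
    ‖effHamFun lam κ Λ (fun r => ((r ^ (-(1 / 2) : ℝ) : ℝ) : ℂ) * g r) x y‖ₑ ^ s) g hg le_rfl

/-- The lattice site of an index of `(q, p)`. -/
def site {V : Type} : V ⊕ V → V := Sum.elim id id

/-- A bound for `1` and for the spectrum of `h_Λ` that does not depend on `Λ`. -/
def specBound (d : ℕ) (lam kmax : ℝ) : ℝ := 1 + 2 * 3 ^ d * lam + |kmax| / 2

lemma one_le_specBound (d : ℕ) {lam : ℝ} (hlam : 0 < lam) (kmax : ℝ) :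
    1 ≤ specBound d lam kmax := by
  have : 0 ≤ 2 * 3 ^ d * lam := by positivity
  have := abs_nonneg kmax
  unfold specBound
  linarith

/-- The neighbors of `x` lie in the cube of side three around `x`. -/
lemma card_neighbors_le (x : Λ) : (Finset.univ.filter fun y => (nnGraph Λ).Adj x y).card ≤ 3 ^ d := by
  have h1 : (Finset.univ.filter fun y => (nnGraph Λ).Adj x y).card ≤
      (Finset.Icc (x.1 - 1) (x.1 + 1)).card := by
    refine Finset.card_le_card_of_injOn Subtype.val (fun y hy => ?_) Subtype.val_injective.injOn
    have hadj' : (nnGraph Λ).Adj x y := by simpa using hy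
    have hadj : dist1 x.1 y.1 = 1 := hadj'
    have h2 : ∀ i, |x.1 i - y.1 i| ≤ 1 := fun i => by
      rw [← hadj]
      exact Finset.single_le_sum (f := fun i => |x.1 i - y.1 i|) (fun i _ => abs_nonneg _)
        (Finset.mem_univ i)
    simp only [Finset.coe_Icc, Set.mem_Icc, Pi.le_def, Pi.sub_apply, Pi.add_apply, Pi.one_apply]
    exact ⟨fun i => by have := abs_le.1 (h2 i); lia, fun i => by have := abs_le.1 (h2 i); lia⟩
  refine h1.trans (le_of_eq ?_)
  rw [Pi.card_Icc]
  simp only [Int.card_Icc, Pi.sub_apply, Pi.add_apply, Pi.one_apply]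
  have : ∀ i, (x.1 i + 1 + 1 - (x.1 i - 1)).toNat = 3 := fun i => by lia
  simp [this]

lemma eigenvalues_effHam_le (hlam : 0 < lam) {kmax : ℝ} (hκ : ∀ x : Λ, κ x.1 ≤ kmax) (i : Λ) :
    (effHam_isHermitian lam κ Λ).eigenvalues i ≤ specBound d lam kmax := by
  rw [eigenvalues_effHam_eq]
  have h1 := sum_modes_sq (lam := lam) (κ := κ) i
  generalize modes lam κ Λ i = v at *
  have h2 : ∑ x : Λ, κ x.1 / 2 * v x ^ 2 ≤ |kmax| / 2 := by
    rw [← mul_one (|kmax| / 2), ← h1, Finset.mul_sum]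
    refine Finset.sum_le_sum fun x _ => mul_le_mul_of_nonneg_right ?_ (sq_nonneg _)
    have := (hκ x).trans (le_abs_self kmax)
    linarith
  have h3 : ∀ w : Λ → ℝ, ∑ x : Λ, ∑ y, (if (nnGraph Λ).Adj x y then w x ^ 2 else 0) ≤
      3 ^ d * ∑ x, w x ^ 2 := fun w => by
    rw [Finset.mul_sum]
    refine Finset.sum_le_sum fun x _ => ?_
    rw [← Finset.sum_filter, Finset.sum_const, nsmul_eq_mul]
    refine mul_le_mul_of_nonneg_right ?_ (sq_nonneg _)
    exact_mod_cast card_neighbors_le x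
  have h4 : ∑ x : Λ, ∑ y, (if (nnGraph Λ).Adj x y then (v x - v y) ^ 2 else 0) ≤
      2 * ∑ x : Λ, ∑ y, (if (nnGraph Λ).Adj x y then v x ^ 2 else 0) +
        2 * ∑ x : Λ, ∑ y, (if (nnGraph Λ).Adj x y then v y ^ 2 else 0) := by
    simp only [Finset.mul_sum, ← Finset.sum_add_distrib]
    refine Finset.sum_le_sum fun x _ => Finset.sum_le_sum fun y _ => ?_
    split_ifs
    · nlinarith [sq_nonneg (v x + v y)]
    · simp
  have h5 : ∑ x : Λ, ∑ y, (if (nnGraph Λ).Adj x y then v y ^ 2 else 0) =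
      ∑ x : Λ, ∑ y, (if (nnGraph Λ).Adj x y then v x ^ 2 else 0) := by
    rw [Finset.sum_comm]
    simp only [(nnGraph Λ).adj_comm]
  have h6 := h3 v
  rw [h1, mul_one] at h6
  rw [h5] at h4
  have h7 : lam * ((∑ x : Λ, ∑ y, (if (nnGraph Λ).Adj x y then (v x - v y) ^ 2 else 0)) / 2) ≤
      lam * (2 * 3 ^ d) := mul_le_mul_of_nonneg_left (by linarith) hlam.le
  unfold specBound
  linarith

/-- Every entry of the propagator is bounded by the singular eigenfunction correlator. -/
lemma enorm_propagator_rpow_le (hlam : 0 < lam) (hκ : ∀ x : Λ, 0 < κ x.1) {kmax : ℝ}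
    (hκ' : ∀ x : Λ, κ x.1 ≤ kmax) (t : ℝ) {s : ℝ} (hs : 0 ≤ s) (i k : Λ ⊕ Λ) :
    ‖propagator (modes lam κ Λ) (modeParam lam κ Λ) t i k‖ₑ ^ s ≤
      ENNReal.ofReal (specBound d lam kmax) ^ s * singCorr lam κ Λ s (site i) (site k) := by
  have hB := one_le_specBound d hlam kmax
  have hB0 : 0 < specBound d lam kmax := by linarith
  have hev : ∀ j, 0 < (effHam_isHermitian lam κ Λ).eigenvalues j ∧
      (effHam_isHermitian lam κ Λ).eigenvalues j ≤ specBound d lam kmax := fun j =>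
    ⟨eigenvalues_effHam_pos hlam hκ j, eigenvalues_effHam_le hlam hκ' j⟩
  have hsq : ∀ j, √((effHam_isHermitian lam κ Λ).eigenvalues j) ≤ specBound d lam kmax :=
    fun j => Real.sqrt_le_iff.2 ⟨hB0.le, (hev j).2.trans (by nlinarith)⟩
  have hcos : ∀ x y : Λ, ‖diagKernel (modes lam κ Λ)
      (fun i => Real.cos (2 * freq (modeParam lam κ Λ i) * t)) x y‖ₑ ^ s ≤
      ENNReal.ofReal (specBound d lam kmax) ^ s * singCorr lam κ Λ s x y := fun x y => by
    simp only [freq_modeParam]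
    refine enorm_diagKernel_rpow_le hlam hκ hB0 (fun r => Real.cos (2 * √r * t)) (fun j => ?_) s hs
      x y
    rw [abs_mul, abs_of_nonneg (Real.sqrt_nonneg _)]
    exact (mul_le_of_le_one_right (Real.sqrt_nonneg _) (Real.abs_cos_le_one _)).trans (hsq j)
  rcases i with x | x <;> rcases k with y | y
  · exact hcos x y
  · change ‖diagKernel _ (fun i => Real.sin (2 * freq (modeParam lam κ Λ i) * t) /
      freq (modeParam lam κ Λ i)) x y‖ₑ ^ s ≤ _
    simp only [freq_modeParam]
    refine enorm_diagKernel_rpow_le hlam hκ hB0 (fun r => Real.sin (2 * √r * t) / √r) (fun j => ?_)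
      s hs x y
    rw [mul_div_cancel₀ _ (Real.sqrt_pos.2 (hev j).1).ne']
    exact (Real.abs_sin_le_one _).trans hB
  · change ‖diagKernel _ (fun i => -(freq (modeParam lam κ Λ i) *
      Real.sin (2 * freq (modeParam lam κ Λ i) * t))) x y‖ₑ ^ s ≤ _
    simp only [freq_modeParam]
    refine enorm_diagKernel_rpow_le hlam hκ hB0 (fun r => -(√r * Real.sin (2 * √r * t)))
      (fun j => ?_) s hs x y
    rw [mul_neg, abs_neg, ← mul_assoc, Real.mul_self_sqrt (hev j).1.le, abs_mul,
      abs_of_pos (hev j).1]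
    exact (mul_le_of_le_one_right (hev j).1.le (Real.abs_sin_le_one _)).trans (hev j).2
  · exact hcos x y

/-! ### Measurability in the disorder -/

lemma effHam_pow_apply (m : ℕ) (x y : Λ) : (effHam lam κ Λ ^ m) x y =
    diagKernel (modes lam κ Λ) (fun i => (effHam_isHermitian lam κ Λ).eigenvalues i ^ m) x y := by
  induction m generalizing x with
  | zero =>
    have h := (modes lam κ Λ).sum_inner_mul_inner (EuclideanSpace.single x (1 : ℝ))
      (EuclideanSpace.single y (1 : ℝ))
    have e : ∀ i, inner ℝ (EuclideanSpace.single x (1 : ℝ)) (modes lam κ Λ i) =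
        modes lam κ Λ i x := fun i => by rw [real_inner_comm, inner_single_right_eq]
    simp only [inner_single_right_eq, e] at h
    simp only [pow_zero, diagKernel, mul_one, h, Matrix.one_apply]
    simp [eq_comm]
  | succ m ih =>
    rw [pow_succ', Matrix.mul_apply]
    simp only [ih, diagKernel, Finset.mul_sum]
    rw [Finset.sum_comm]
    refine Finset.sum_congr rfl fun i _ => ?_
    have h := congrFun ((effHam_isHermitian lam κ Λ).mulVec_eigenvectorBasis i) x
    rw [Matrix.mulVec, dotProduct, Pi.smul_apply, smul_eq_mul] at h
    change ∑ z, effHam lam κ Λ x z * modes lam κ Λ i z = _ * modes lam κ Λ i x at h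
    calc ∑ z, effHam lam κ Λ x z * (modes lam κ Λ i z *
          (effHam_isHermitian lam κ Λ).eigenvalues i ^ m * modes lam κ Λ i y)
        = (∑ z, effHam lam κ Λ x z * modes lam κ Λ i z) *
          ((effHam_isHermitian lam κ Λ).eigenvalues i ^ m * modes lam κ Λ i y) := by
          rw [Finset.sum_mul]
          exact Finset.sum_congr rfl fun z _ => by ring
      _ = _ := by rw [h]; ring

/-- The entries of the function `∑_m a_m r^m` of `h_Λ` are limits of linear combinations of entries
of powers of `h_Λ`. -/
lemma tendsto_sum_effHam_pow (a : ℕ → ℝ) (e : ℕ → ℕ) (φ : ℝ → ℝ)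
    (h : ∀ i, HasSum (fun m => a m * (effHam_isHermitian lam κ Λ).eigenvalues i ^ e m)
      (φ ((effHam_isHermitian lam κ Λ).eigenvalues i))) (x y : Λ) :
    Filter.Tendsto (fun N => ∑ m ∈ Finset.range N, a m * (effHam lam κ Λ ^ e m) x y) Filter.atTop
      (nhds (diagKernel (modes lam κ Λ)
        (fun i => φ ((effHam_isHermitian lam κ Λ).eigenvalues i)) x y)) := by
  have h1 : ∀ i, Filter.Tendsto (fun N => modes lam κ Λ i x * (∑ m ∈ Finset.range N,
      a m * (effHam_isHermitian lam κ Λ).eigenvalues i ^ e m) * modes lam κ Λ i y) Filter.atTop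
      (nhds (modes lam κ Λ i x * φ ((effHam_isHermitian lam κ Λ).eigenvalues i) *
        modes lam κ Λ i y)) := fun i =>
    ((h i).tendsto_sum_nat.const_mul _).mul_const _
  refine (tendsto_finsetSum Finset.univ fun i _ => h1 i).congr fun N => ?_
  simp only [effHam_pow_apply, diagKernel, Finset.mul_sum, Finset.sum_mul]
  rw [Finset.sum_comm]
  exact Finset.sum_congr rfl fun m _ => Finset.sum_congr rfl fun i _ => by ring

lemma hasSum_cos_sqrt {r : ℝ} (hr : 0 < r) (t : ℝ) :
    HasSum (fun m : ℕ => (-1) ^ m * (2 * t) ^ (2 * m) / ((2 * m).factorial : ℝ) * r ^ m)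
      (Real.cos (2 * √r * t)) := by
  convert Real.hasSum_cos (2 * √r * t) using 2 with m
  rw [show 2 * √r * t = 2 * t * √r by ring, mul_pow (2 * t), pow_mul √r, Real.sq_sqrt hr.le]
  ring

lemma hasSum_sin_sqrt_div {r : ℝ} (hr : 0 < r) (t : ℝ) :
    HasSum (fun m : ℕ => (-1) ^ m * (2 * t) ^ (2 * m + 1) / ((2 * m + 1).factorial : ℝ) * r ^ m)
      (Real.sin (2 * √r * t) / √r) := by
  have hs := (Real.sqrt_pos.2 hr).ne'
  refine Eq.subst (motive := fun f => HasSum f _) (funext fun m => ?_)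
    ((Real.hasSum_sin (2 * √r * t)).div_const √r)
  rw [show 2 * √r * t = 2 * t * √r by ring, mul_pow (2 * t), pow_succ √r, pow_mul √r,
    Real.sq_sqrt hr.le]
  field_simp

lemma hasSum_neg_sqrt_mul_sin {r : ℝ} (hr : 0 < r) (t : ℝ) :
    HasSum (fun m : ℕ => -((-1) ^ m * (2 * t) ^ (2 * m + 1) / ((2 * m + 1).factorial : ℝ)) *
      r ^ (m + 1)) (-(√r * Real.sin (2 * √r * t))) := by
  have hs := (Real.sqrt_pos.2 hr).ne'
  have h : -(√r * Real.sin (2 * √r * t)) = -r * (Real.sin (2 * √r * t) / √r) := by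
    field_simp
    rw [Real.sq_sqrt hr.le]
    ring
  rw [h]
  refine Eq.subst (motive := fun f => HasSum f _) (funext fun m => ?_)
    ((hasSum_sin_sqrt_div hr t).mul_left (-r))
  ring

section Random

variable {Ω : Type*} [MeasurableSpace Ω] {P : Measure Ω} {k : (Fin d → ℤ) → Ω → ℝ}

lemma aemeasurable_effHam_pow (hk : ∀ x, AEMeasurable (k x) P) (m : ℕ) (x y : Λ) :
    AEMeasurable (fun ω => (effHam lam (fun z => k z ω) Λ ^ m) x y) P := by
  induction m generalizing x with
  | zero => simp only [pow_zero]; exact aemeasurable_const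
  | succ m ih =>
    simp only [pow_succ', Matrix.mul_apply]
    refine Finset.aemeasurable_fun_sum _ fun z _ => AEMeasurable.mul ?_ (ih z)
    simp only [effHam, Matrix.add_apply, Matrix.diagonal_apply]
    refine aemeasurable_const.add ?_
    split_ifs
    · exact (hk x.1).div_const 2
    · exact aemeasurable_const

/-- Power series of `h_Λ` have measurable entries, whatever eigenvectors are chosen. -/
lemma aemeasurable_diagKernel (hk : ∀ x, AEMeasurable (k x) P) (hlam : 0 < lam)
    (hpos : ∀ᵐ ω ∂P, ∀ x, 0 < k x ω) (a : ℕ → ℝ) (e : ℕ → ℕ) (φ : ℝ → ℝ)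
    (h : ∀ r, 0 < r → HasSum (fun m => a m * r ^ e m) (φ r)) (x y : Λ) :
    AEMeasurable (fun ω => diagKernel (modes lam (fun z => k z ω) Λ)
      (fun i => φ ((effHam_isHermitian lam (fun z => k z ω) Λ).eigenvalues i)) x y) P := by
  refine aemeasurable_of_tendsto_metrizable_ae Filter.atTop
    (f := fun N ω => ∑ m ∈ Finset.range N, a m * (effHam lam (fun z => k z ω) Λ ^ e m) x y)
    (fun N => Finset.aemeasurable_fun_sum _ fun m _ =>
      (aemeasurable_effHam_pow hk (e m) x y).const_mul _) ?_
  filter_upwards [hpos] with ω hω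
  exact tendsto_sum_effHam_pow a e φ
    (fun i => h _ (eigenvalues_effHam_pos hlam (fun x => hω x.1) i)) x y

/-- The eigenvectors of `h_Λ` are chosen arbitrarily, so the propagator is measurable in the
disorder only because it is a limit of polynomials in `h_Λ`. -/
lemma aemeasurable_propagator (hk : ∀ x, AEMeasurable (k x) P) (hlam : 0 < lam)
    (hpos : ∀ᵐ ω ∂P, ∀ x, 0 < k x ω) (t : ℝ) (i j : Λ ⊕ Λ) :
    AEMeasurable (fun ω => propagator (modes lam (fun z => k z ω) Λ)
      (modeParam lam (fun z => k z ω) Λ) t i j) P := by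
  have hcos : ∀ x y : Λ, AEMeasurable (fun ω => diagKernel (modes lam (fun z => k z ω) Λ)
      (fun i => Real.cos (2 * freq (modeParam lam (fun z => k z ω) Λ i) * t)) x y) P :=
    fun x y => by
      simp only [freq_modeParam]
      exact aemeasurable_diagKernel hk hlam hpos _ (fun m => m) (fun r => Real.cos (2 * √r * t))
        (fun r hr => hasSum_cos_sqrt hr t) x y
  rcases i with x | x <;> rcases j with y | y
  · exact hcos x y
  · change AEMeasurable (fun ω => diagKernel _ (fun i => Real.sin (2 * freq (modeParam lam
      (fun z => k z ω) Λ i) * t) / freq (modeParam lam (fun z => k z ω) Λ i)) x y) P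
    simp only [freq_modeParam]
    exact aemeasurable_diagKernel hk hlam hpos _ (fun m => m) (fun r => Real.sin (2 * √r * t) / √r)
      (fun r hr => hasSum_sin_sqrt_div hr t) x y
  · change AEMeasurable (fun ω => diagKernel _ (fun i => -(freq (modeParam lam
      (fun z => k z ω) Λ i) * Real.sin (2 * freq (modeParam lam (fun z => k z ω) Λ i) * t))) x y) P
    simp only [freq_modeParam]
    exact aemeasurable_diagKernel hk hlam hpos _ (fun m => m + 1)
      (fun r => -(√r * Real.sin (2 * √r * t)))
      (fun r hr => hasSum_neg_sqrt_mul_sin hr t) x y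
  · exact hcos x y

end Random

lemma continuous_propagator {V : Type} [Fintype V] (f : OrthonormalBasis V ℝ (EuclideanSpace ℝ V))
    (c : V → ℝ) (i j : V ⊕ V) : Continuous fun t => propagator f c t i j := by
  rcases i with x | x <;> rcases j with y | y
  · change Continuous fun t => ∑ i, f i x * Real.cos (2 * freq (c i) * t) * f i y
    fun_prop
  · change Continuous fun t => ∑ i, f i x * (Real.sin (2 * freq (c i) * t) / freq (c i)) * f i y
    fun_prop
  · change Continuous fun t => ∑ i, f i x * -(freq (c i) * Real.sin (2 * freq (c i) * t)) * f i y
    fun_prop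
  · change Continuous fun t => ∑ i, f i x * Real.cos (2 * freq (c i) * t) * f i y
    fun_prop

/-- The supremum over the real line of a process that is continuous in time is measurable. -/
lemma aemeasurable_iSup_of_continuous {Ω : Type*} [MeasurableSpace Ω] {P : Measure Ω}
    {F : Ω → ℝ → ℝ≥0∞} (hc : ∀ᵐ ω ∂P, Continuous (F ω))
    (hm : ∀ t, AEMeasurable (fun ω => F ω t) P) : AEMeasurable (fun ω => ⨆ t, F ω t) P := by
  have hS : Dense (Set.range ((↑) : ℚ → ℝ)) := Rat.isDenseEmbedding_coe_real.dense
  have : Countable (Set.range ((↑) : ℚ → ℝ)) := (Set.countable_range _).to_subtype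
  refine (AEMeasurable.iSup fun q : Set.range ((↑) : ℚ → ℝ) => hm q).congr ?_
  filter_upwards [hc] with ω hω
  exact hS.ciSup' hω

section Random

variable {Ω : Type*} [MeasurableSpace Ω] {P : Measure Ω} {k : (Fin d → ℤ) → Ω → ℝ}

lemma aemeasurable_iSup_propagator (hk : ∀ x, AEMeasurable (k x) P) (hlam : 0 < lam)
    (hpos : ∀ᵐ ω ∂P, ∀ x, 0 < k x ω) (s : ℝ) (i j : Λ ⊕ Λ) :
    AEMeasurable (fun ω => ⨆ t, ‖propagator (modes lam (fun z => k z ω) Λ)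
      (modeParam lam (fun z => k z ω) Λ) t i j‖ₑ ^ s) P :=
  aemeasurable_iSup_of_continuous
    (Filter.Eventually.of_forall fun _ =>
      ENNReal.continuous_rpow_const.comp (continuous_propagator _ _ i j).enorm)
    fun t => (aemeasurable_propagator hk hlam hpos t i j).enorm.pow_const s

lemma aemeasurable_moment (hk : ∀ x, AEMeasurable (k x) P) (n : Λ → ℕ) (i j : Λ ⊕ Λ) :
    AEMeasurable (fun ω => moment (fun x : Λ => k x.1 ω) n i j) P := by
  have hf : ∀ x : Λ, AEMeasurable (fun ω => freq (k x.1 ω)) P := fun x => by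
    unfold freq
    exact ((hk x.1).div_const 2).sqrt
  rcases i with x | x <;> rcases j with y | y <;> simp only [moment] <;> split_ifs <;>
    first
    | exact aemeasurable_const
    | exact Complex.measurable_ofReal.comp_aemeasurable
        (aemeasurable_const.div ((hf x).const_mul 2))
    | exact Complex.measurable_ofReal.comp_aemeasurable
        (((hf x).mul_const _).div_const 2)

lemma continuous_quenchCorr (hlam : 0 < lam) (hκ : ∀ x : Λ, 0 < κ x.1) (n : Λ → ℕ)
    (i j : Λ ⊕ Λ) : Continuous fun t => quenchCorr lam κ Λ (prodState κ Λ n) t i j := by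
  simp only [quenchCorr_prodState hlam hκ]
  have h := continuous_propagator (modes lam κ Λ) (modeParam lam κ Λ)
  exact continuous_finsetSum _ fun a _ => continuous_finsetSum _ fun b _ =>
    ((Complex.continuous_ofReal.comp (h i a)).mul (Complex.continuous_ofReal.comp (h j b))).mul
      continuous_const

lemma aemeasurable_quenchCorr (hk : ∀ x, AEMeasurable (k x) P) (hlam : 0 < lam)
    (hpos : ∀ᵐ ω ∂P, ∀ x, 0 < k x ω) (n : Λ → ℕ) (t : ℝ) (i j : Λ ⊕ Λ) :
    AEMeasurable (fun ω => quenchCorr lam (fun z => k z ω) Λ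
      (prodState (fun z => k z ω) Λ n) t i j) P := by
  have h := aemeasurable_propagator (Λ := Λ) hk hlam hpos t
  refine (Finset.aemeasurable_fun_sum Finset.univ fun a _ =>
    Finset.aemeasurable_fun_sum Finset.univ fun b _ =>
      ((Complex.measurable_ofReal.comp_aemeasurable (h i a)).mul
        (Complex.measurable_ofReal.comp_aemeasurable (h j b))).mul
        (aemeasurable_moment hk n a b)).congr ?_
  filter_upwards [hpos] with ω hω
  rw [quenchCorr_prodState hlam fun x => hω x.1]
  rfl

end Random

/-- The embedding of complex `2 × 2` matrices, given by their entries, into operators. -/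
def blockCLM : (Fin 2 → Fin 2 → ℂ) →ₗ[ℂ] (EuclideanSpace ℂ (Fin 2) →L[ℂ] EuclideanSpace ℂ (Fin 2)) where
  toFun M := Matrix.toEuclideanCLM (n := Fin 2) (𝕜 := ℂ) (Matrix.of M)
  map_add' M N := by rw [← map_add]; rfl
  map_smul' c M := by rw [RingHom.id_apply, ← map_smul]; rfl

lemma continuous_enorm_toEuclideanCLM : Continuous fun M : Fin 2 → Fin 2 → ℂ =>
    ‖Matrix.toEuclideanCLM (n := Fin 2) (𝕜 := ℂ) (Matrix.of M)‖ₑ :=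
  (LinearMap.continuous_of_finiteDimensional blockCLM).enorm

/-- The operator norm of a matrix is at most the sum of the absolute values of its entries. -/
lemma enorm_toEuclideanCLM_le (M : Matrix (Fin 2) (Fin 2) ℂ) :
    ‖Matrix.toEuclideanCLM (n := Fin 2) (𝕜 := ℂ) M‖ₑ ≤ ∑ i, ∑ j, ‖M i j‖ₑ := by
  have h1 : ∀ i j, ‖Matrix.toEuclideanCLM (n := Fin 2) (𝕜 := ℂ) (Matrix.single i j (M i j))‖ₑ ≤
      ‖M i j‖ₑ := fun i j => by
    rw [← ofReal_norm, ← ofReal_norm]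
    refine ENNReal.ofReal_le_ofReal (ContinuousLinearMap.opNorm_le_bound _ (norm_nonneg _)
      fun v => ?_)
    have h2 : Matrix.toEuclideanCLM (n := Fin 2) (𝕜 := ℂ) (Matrix.single i j (M i j)) v =
        EuclideanSpace.single i (M i j * v j) := by
      ext l
      simp [Matrix.single_mulVec, Function.update_apply]
    rw [h2, PiLp.norm_single, norm_mul]
    exact mul_le_mul_of_nonneg_left (PiLp.norm_apply_le v j) (norm_nonneg _)
  have h3 : ∀ f : Fin 2 → EuclideanSpace ℂ (Fin 2) →L[ℂ] EuclideanSpace ℂ (Fin 2),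
      ‖∑ i, f i‖ₑ ≤ ∑ i, ‖f i‖ₑ := fun f => enorm_sum_le Finset.univ f
  conv_lhs => rw [Matrix.matrix_eq_sum_single M, map_sum]
  simp only [map_sum]
  exact (h3 _).trans (Finset.sum_le_sum fun i _ => (h3 _).trans (Finset.sum_le_sum fun j _ => h1 i j))

lemma aemeasurable_supQuench {Ω : Type*} [MeasurableSpace Ω] {P : Measure Ω}
    {k : (Fin d → ℤ) → Ω → ℝ} (hk : ∀ x, AEMeasurable (k x) P) (hlam : 0 < lam)
    (hpos : ∀ᵐ ω ∂P, ∀ x, 0 < k x ω) (n : Λ → ℕ) (r : ℝ) (x y : Λ) :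
    AEMeasurable (fun ω => supQuench lam (fun z => k z ω) Λ
      (prodState (fun z => k z ω) Λ n) r x y) P := by
  refine aemeasurable_iSup_of_continuous ?_ fun t => ?_
  · filter_upwards [hpos] with ω hω
    have h := continuous_quenchCorr (κ := fun z => k z ω) (Λ := Λ) hlam (fun x => hω x.1) n
    refine ENNReal.continuous_rpow_const.comp (continuous_enorm_toEuclideanCLM.comp
      (f := fun t => block (quenchCorr lam (fun z => k z ω) Λ (prodState (fun z => k z ω) Λ n) t)
        x y) ?_)
    refine continuous_pi fun i => continuous_pi fun j => ?_
    fin_cases i <;> fin_cases j <;> exact h _ _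
  · have h := aemeasurable_quenchCorr (Λ := Λ) hk hlam hpos n t
    refine (continuous_enorm_toEuclideanCLM.measurable.comp_aemeasurable
      (f := fun ω i j => block (quenchCorr lam (fun z => k z ω) Λ
        (prodState (fun z => k z ω) Λ n) t) x y i j) ?_).pow_const r
    refine aemeasurable_pi_lambda _ fun i => aemeasurable_pi_lambda _ fun j => ?_
    fin_cases i <;> fin_cases j <;> exact h _ _

end Model

/-! ### Distribution of a single spring constant -/

section SingleSite

/-- `r ↦ r^{-1/4}` on `(0, 1)`, extended by zero. It carries the singularity, at small spring
constants, of the square root of the position moments. -/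
def cutInvRoot : ℝ → ℝ≥0∞ := (Set.Ioo 0 1).indicator fun r => ENNReal.ofReal (r ^ (-(1 / 4) : ℝ))

lemma measurable_cutInvRoot : Measurable cutInvRoot := by
  refine Measurable.indicator ?_ measurableSet_Ioo
  fun_prop

lemma lintegral_cutInvRoot_lt_top : ∫⁻ r, cutInvRoot r < ∞ := by
  unfold cutInvRoot
  rw [lintegral_indicator measurableSet_Ioo]
  have h : IntegrableOn (fun r : ℝ => r ^ (-(1 / 4) : ℝ)) (Set.Ioo 0 1) :=
    (intervalIntegral.integrableOn_Ioo_rpow_iff zero_lt_one).2 (by norm_num)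
  exact h.lintegral_lt_top

variable {Ω : Type*} [MeasurableSpace Ω] {P : Measure Ω} {ν : ℝ → ℝ≥0∞} {X : Ω → ℝ}

lemma lintegral_cutInvRoot_comp_le (hν : Measurable ν)
    (hX : HasLaw X (volume.withDensity ν) P) :
    ∫⁻ ω, cutInvRoot (X ω) ∂P ≤ essSup ν volume * ∫⁻ r, cutInvRoot r := by
  rw [hX.lintegral_comp measurable_cutInvRoot.aemeasurable,
    lintegral_withDensity_eq_lintegral_mul _ hν measurable_cutInvRoot,
    ← lintegral_const_mul _ measurable_cutInvRoot]
  refine lintegral_mono_ae ?_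
  filter_upwards [ENNReal.ae_le_essSup ν] with r hr
  exact mul_le_mul_left hr _

lemma ae_pos_and_le (hX : HasLaw X (volume.withDensity ν) P) {kmax : ℝ}
    (hν_supp : (volume.withDensity ν).support = Set.Icc 0 kmax) :
    ∀ᵐ ω ∂P, 0 < X ω ∧ X ω ≤ kmax := by
  have h1 : ∀ᵐ r ∂(volume.withDensity ν), r ∈ Set.Icc 0 kmax := by
    rw [← hν_supp]
    exact Measure.support_mem_ae
  have h2 : ∀ᵐ r ∂(volume.withDensity ν), r ≠ 0 :=
    (withDensity_absolutelyContinuous volume ν).ae_le (Measure.ae_ne volume 0)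
  rw [← hX.map_eq] at h1 h2
  filter_upwards [ae_of_ae_map hX.aemeasurable h1, ae_of_ae_map hX.aemeasurable h2] with ω h1 h2
  exact ⟨lt_of_le_of_ne h1.1 (Ne.symm h2), h1.2⟩

end SingleSite

section Moments

variable {V : Type} [Fintype V] [DecidableEq V]

lemma moment_eq_zero (c : V → ℝ) (n : V → ℕ) {k l : V ⊕ V} (h : site k ≠ site l) :
    moment c n k l = 0 := by
  rcases k with x | x <;> rcases l with y | y <;> exact if_neg h

lemma norm_moment_le {c : V → ℝ} (hc : ∀ x, 0 < c x) {kmax : ℝ} (hc' : ∀ x, c x ≤ kmax)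
    (n : V → ℕ) (k l : V ⊕ V) :
    ‖moment c n k l‖ ≤ (1 + 2 * ((Finset.univ.sup n : ℕ) : ℝ)) *
      ((1 + |kmax|) * (1 + 1 / freq (c (site k)))) := by
  have hn : ∀ x, (n x : ℝ) ≤ ((Finset.univ.sup n : ℕ) : ℝ) := fun x => by
    exact_mod_cast Finset.le_sup (f := n) (Finset.mem_univ x)
  generalize ((Finset.univ.sup n : ℕ) : ℝ) = N at hn
  have hw : ∀ x, 0 < freq (c x) := fun x => freq_pos (hc x)
  have hw' : ∀ x, freq (c x) ≤ 1 + |kmax| := fun x => by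
    have h1 := freq_sq (hc x)
    have h2 := (hc' x).trans (le_abs_self _)
    nlinarith [sq_nonneg (freq (c x) - 1), abs_nonneg kmax]
  have hK := abs_nonneg kmax
  have hinv : ∀ x, 0 < 1 / freq (c x) := fun x => one_div_pos.2 (hw x)
  have hN : ∀ x : V, 0 ≤ N := fun x => (Nat.cast_nonneg _).trans (hn x)
  have hbase : ∀ x, 1 ≤ (1 + |kmax|) * (1 + 1 / freq (c x)) := fun x =>
    one_le_mul_of_one_le_of_one_le (by linarith) (by linarith [hinv x])
  have hhalf : ∀ x, (1 / 2 : ℝ) ≤ (1 + 2 * N) * ((1 + |kmax|) * (1 + 1 / freq (c x))) := fun x => by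
    have := one_le_mul_of_one_le_of_one_le (by linarith [hN x] : 1 ≤ 1 + 2 * N) (hbase x)
    linarith
  have hnn : ∀ x, 0 ≤ (1 + 2 * N) * ((1 + |kmax|) * (1 + 1 / freq (c x))) := fun x => by
    linarith [hhalf x]
  rcases k with x | x <;> rcases l with y | y <;> simp only [moment, site, Sum.elim_inl,
    Sum.elim_inr, id] <;> split_ifs
  · rw [Complex.norm_real, Real.norm_eq_abs, abs_of_nonneg
      (div_nonneg (by positivity) (by linarith [hw x]))]
    have h1 : (2 * (n x : ℝ) + 1) / (2 * freq (c x)) = (2 * n x + 1) * (1 / freq (c x) / 2) := by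
      field_simp
    rw [h1]
    refine mul_le_mul (by linarith [hn x]) ?_ (by linarith [hinv x]) (by linarith [hN x])
    nlinarith [hinv x, mul_nonneg hK (hinv x).le]
  · simpa using hnn x
  · simpa using hhalf x
  · simpa using hnn x
  · simpa using hhalf x
  · simpa using hnn x
  · rw [Complex.norm_real, Real.norm_eq_abs, abs_of_nonneg
      (div_nonneg (mul_nonneg (hw x).le (by positivity)) zero_le_two),
      show freq (c x) * (2 * n x + 1) / 2 = (2 * n x + 1) * (freq (c x) / 2) by ring]
    refine mul_le_mul (by linarith [hn x]) ?_ (by linarith [hw x]) (by linarith [hN x])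
    nlinarith [hinv x, hw' x, hw x, mul_nonneg hK (hinv x).le]
  · simpa using hnn x

/-- `(1 / √(r/2))^{1/2}` is a multiple of `r^{-1/4}`. -/
lemma one_div_freq_rpow_le {r : ℝ} (hr : 0 < r) :
    ENNReal.ofReal ((1 / freq r) ^ (1 / 2 : ℝ)) ≤ 2 * (1 + cutInvRoot r) := by
  have h1 : (1 / freq r) ^ (1 / 2 : ℝ) = (2 : ℝ) ^ (1 / 4 : ℝ) * r ^ (-(1 / 4) : ℝ) := by
    rw [freq, Real.sqrt_eq_rpow, one_div, ← Real.rpow_neg (by positivity), ← Real.rpow_mul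
      (by positivity), Real.div_rpow hr.le zero_le_two, div_eq_mul_inv, mul_comm,
      ← Real.rpow_neg zero_le_two]
    norm_num
  have h2 : (2 : ℝ) ^ (1 / 4 : ℝ) ≤ 2 := by
    conv_rhs => rw [← Real.rpow_one 2]
    exact Real.rpow_le_rpow_of_exponent_le one_le_two (by norm_num)
  rw [h1, ENNReal.ofReal_mul (by positivity)]
  refine mul_le_mul' ((ENNReal.ofReal_le_ofReal h2).trans (by simp)) ?_
  by_cases h : r < 1
  · rw [cutInvRoot, Set.indicator_of_mem (show r ∈ Set.Ioo 0 1 from ⟨hr, h⟩)]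
    exact le_add_self
  · refine le_add_right ?_
    rw [← ENNReal.ofReal_one]
    exact ENNReal.ofReal_le_ofReal
      (Real.rpow_le_one_of_one_le_of_nonpos (not_lt.1 h) (by norm_num))

/-- The square root of a second moment is controlled by `1 + N` and by an integrable function of
the spring constant at the site. -/
lemma enorm_moment_rpow_le {c : V → ℝ} (hc : ∀ x, 0 < c x) {kmax : ℝ} (hc' : ∀ x, c x ≤ kmax)
    (n : V → ℕ) (k l : V ⊕ V) :
    ‖moment c n k l‖ₑ ^ (1 / 2 : ℝ) ≤
      ENNReal.ofReal ((1 + 2 * ((Finset.univ.sup n : ℕ) : ℝ)) ^ (1 / 2 : ℝ)) *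
      (ENNReal.ofReal ((1 + |kmax|) ^ (1 / 2 : ℝ)) * (3 + 2 * cutInvRoot (c (site k)))) := by
  have h := ENNReal.ofReal_le_ofReal (norm_moment_le hc hc' n k l)
  have hw := one_div_pos.2 (freq_pos (hc (site k)))
  have hK := abs_nonneg kmax
  rw [ofReal_norm, ENNReal.ofReal_mul (by positivity), ENNReal.ofReal_mul (by positivity),
    ENNReal.ofReal_add zero_le_one hw.le] at h
  refine (ENNReal.rpow_le_rpow h (by norm_num : (0 : ℝ) ≤ 1 / 2)).trans ?_
  rw [ENNReal.mul_rpow_of_nonneg _ _ (by norm_num), ENNReal.mul_rpow_of_nonneg _ _ (by norm_num),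
    ENNReal.ofReal_rpow_of_nonneg (by positivity) (by norm_num),
    ENNReal.ofReal_rpow_of_nonneg (by positivity) (by norm_num)]
  refine mul_le_mul_right (mul_le_mul_right ?_ _) _
  refine (ENNReal.rpow_add_le_add_rpow _ _ (by norm_num) (by norm_num)).trans ?_
  rw [ENNReal.ofReal_one, ENNReal.one_rpow,
    ENNReal.ofReal_rpow_of_nonneg hw.le (by norm_num)]
  calc 1 + ENNReal.ofReal ((1 / freq (c (site k))) ^ (1 / 2 : ℝ))
      ≤ 1 + 2 * (1 + cutInvRoot (c (site k))) := by gcongr; exact one_div_freq_rpow_le (hc _)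
    _ = 3 + 2 * cutInvRoot (c (site k)) := by ring

end Moments

/-! ### Exponential sums over boxes -/

section ExpSum

lemma dist1_nonneg {d : ℕ} (x y : Fin d → ℤ) : 0 ≤ dist1 x y :=
  Finset.sum_nonneg fun _ _ => abs_nonneg _

lemma dist1_triangle {d : ℕ} (x y z : Fin d → ℤ) : dist1 x y ≤ dist1 x z + dist1 y z := by
  simp only [dist1, ← Finset.sum_add_distrib]
  refine Finset.sum_le_sum fun i _ => ?_
  rw [abs_sub_comm (y i)]
  exact abs_sub_le _ _ _

lemma summable_exp_abs {c : ℝ} (hc : 0 < c) : Summable fun m : ℤ => Real.exp (-c * |(m : ℝ)|) := by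
  have h : Summable fun m : ℕ => Real.exp (-c * (m : ℝ)) := by
    simpa only [mul_comm] using Real.summable_exp_nat_mul_of_ge (c := -c) (by linarith)
      (f := fun i => (i : ℝ)) (fun _ => le_rfl)
  refine Summable.of_nat_of_neg ?_ ?_ <;> simpa using h

/-- `∑_{m ∈ ℤ} e^{-c|m|}`. -/
def expSum (c : ℝ) : ℝ := ∑' m : ℤ, Real.exp (-c * |(m : ℝ)|)

lemma sum_exp_dist1_le {d : ℕ} {c : ℝ} (hc : 0 < c) (a b x : Fin d → ℤ) :
    ∑ z ∈ Finset.Icc a b, Real.exp (-c * (dist1 x z : ℝ)) ≤ expSum c ^ d := by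
  have h1 : ∀ z : Fin d → ℤ, Real.exp (-c * (dist1 x z : ℝ)) =
      ∏ i, Real.exp (-c * |((x i - z i : ℤ) : ℝ)|) := fun z => by
    rw [← Real.exp_sum, ← Finset.mul_sum, dist1]
    push_cast
    rfl
  have h2 : ∀ i : Fin d, ∑ m ∈ Finset.Icc (a i) (b i), Real.exp (-c * |((x i - m : ℤ) : ℝ)|) ≤
      expSum c := fun i => by
    have e := (Equiv.subLeft (x i)).tsum_eq fun m : ℤ => Real.exp (-c * |(m : ℝ)|)
    rw [expSum, ← e]
    exact ((Equiv.subLeft (x i)).summable_iff.2 (summable_exp_abs hc)).sum_le_tsum _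
      fun _ _ => (Real.exp_pos _).le
  rw [Pi.Icc_eq]
  simp only [h1]
  rw [← Finset.prod_univ_sum (fun i => Finset.Icc (a i) (b i))
    (fun i m => Real.exp (-c * |((x i - m : ℤ) : ℝ)|))]
  refine (Finset.prod_le_prod (fun i _ => Finset.sum_nonneg fun _ _ => (Real.exp_pos _).le)
    fun i _ => h2 i).trans (le_of_eq ?_)
  simp

/-- Half of the decay is spent on the distance of `x` and `y`, the other half on the convergence of
the sum. -/
lemma sum_exp_two_centers_le {d : ℕ} {c : ℝ} (hc : 0 < c) (a b x y : Fin d → ℤ) :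
    ∑ z ∈ Finset.Icc a b, Real.exp (-(2 * c) * ((dist1 x z : ℝ) + (dist1 y z : ℝ))) ≤
      expSum c ^ d * Real.exp (-c * (dist1 x y : ℝ)) := by
  refine le_trans ?_ (mul_le_mul_of_nonneg_right (sum_exp_dist1_le hc a b x) (Real.exp_pos _).le)
  rw [Finset.sum_mul]
  refine Finset.sum_le_sum fun z _ => ?_
  rw [← Real.exp_add]
  refine Real.exp_le_exp.2 ?_
  have h1 : (dist1 x y : ℝ) ≤ dist1 x z + dist1 y z := by exact_mod_cast dist1_triangle x y z
  have h2 : (0 : ℝ) ≤ dist1 y z := by exact_mod_cast dist1_nonneg y z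
  nlinarith

end ExpSum

/-! ### Fractional moments of the quenched correlations -/

lemma sum_rpow_le_sum_rpow {ι : Type*} (s : Finset ι) {r : ℝ} (hr : 0 < r) (hr1 : r ≤ 1)
    (f : ι → ℝ≥0∞) : (∑ i ∈ s, f i) ^ r ≤ ∑ i ∈ s, f i ^ r := by
  classical
  induction s using Finset.induction_on with
  | empty => simp [hr]
  | insert i s hi ih =>
    rw [Finset.sum_insert hi, Finset.sum_insert hi]
    exact (ENNReal.rpow_add_le_add_rpow _ _ hr.le hr1).trans (add_le_add_right ih _)

/-- Hölder's inequality for three factors. -/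
lemma lintegral_mul_three_le {Ω : Type*} [MeasurableSpace Ω] {P : Measure Ω} {f g h : Ω → ℝ≥0∞}
    (hf : AEMeasurable f P) (hg : AEMeasurable g P) (hh : AEMeasurable h P) :
    ∫⁻ ω, f ω ^ (1 / 3 : ℝ) * g ω ^ (1 / 3 : ℝ) * h ω ^ (1 / 3 : ℝ) ∂P ≤
      (∫⁻ ω, f ω ∂P) ^ (1 / 3 : ℝ) * (∫⁻ ω, g ω ∂P) ^ (1 / 3 : ℝ) *
        (∫⁻ ω, h ω ∂P) ^ (1 / 3 : ℝ) := by
  have := ENNReal.lintegral_prod_norm_pow_le (μ := P) Finset.univ (f := ![f, g, h])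
    (p := fun _ => 1 / 3) (fun i _ => by fin_cases i <;> assumption) (by norm_num)
    (fun _ _ => by norm_num)
  simpa [Fin.prod_univ_three] using this

/-- The index of position (`0`) or momentum (`1`) at the site `x`. -/
def coord {V : Type} (a : Fin 2) (x : V) : V ⊕ V := if a = 0 then .inl x else .inr x

lemma site_coord {V : Type} (a : Fin 2) (x : V) : site (coord a x) = x := by
  fin_cases a <;> rfl

lemma block_apply {V : Type} (M : Matrix (V ⊕ V) (V ⊕ V) ℂ) (x y : V) (a b : Fin 2) :
    block M x y a b = M (coord a x) (coord b y) := by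
  fin_cases a <;> fin_cases b <;> rfl

section Model

variable {d : ℕ} {lam : ℝ} {κ : (Fin d → ℤ) → ℝ} {Λ : Finset (Fin d → ℤ)}

variable (lam κ Λ) in
/-- `sup_t |M_{ik}(t)|^{1/2}` for the propagator `M`. -/
def supPropagator (i k : Λ ⊕ Λ) : ℝ≥0∞ :=
  ⨆ t, ‖propagator (modes lam κ Λ) (modeParam lam κ Λ) t i k‖ₑ ^ (1 / 2 : ℝ)

/-- The `1/6`-th power is subadditive and splits every term into `1/3`-rd powers of the three
quantities whose averages are under control. -/
lemma supQuench_le (hlam : 0 < lam) (hκ : ∀ x : Λ, 0 < κ x.1) (n : Λ → ℕ) (x y : Λ) :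
    supQuench lam κ Λ (prodState κ Λ n) (1 / 6) x y ≤ ∑ a : Fin 2, ∑ b : Fin 2, ∑ k, ∑ l,
      supPropagator lam κ Λ (coord a x) k ^ (1 / 3 : ℝ) *
      supPropagator lam κ Λ (coord b y) l ^ (1 / 3 : ℝ) *
      (‖moment (fun x : Λ => κ x.1) n k l‖ₑ ^ (1 / 2 : ℝ)) ^ (1 / 3 : ℝ) := by
  have hpow : ∀ u : ℝ≥0∞, u ^ (1 / 6 : ℝ) = (u ^ (1 / 2 : ℝ)) ^ (1 / 3 : ℝ) := fun u => by
    rw [← ENNReal.rpow_mul]; norm_num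
  refine iSup_le fun t => ?_
  refine (ENNReal.rpow_le_rpow (enorm_toEuclideanCLM_le _) (by norm_num)).trans ?_
  refine (sum_rpow_le_sum_rpow _ (by norm_num) (by norm_num) _).trans
    (Finset.sum_le_sum fun a _ => ?_)
  refine (sum_rpow_le_sum_rpow _ (by norm_num) (by norm_num) _).trans
    (Finset.sum_le_sum fun b _ => ?_)
  rw [block_apply, quenchCorr_prodState hlam hκ]
  refine (ENNReal.rpow_le_rpow (enorm_sum_le _ _) (by norm_num)).trans ?_
  refine (sum_rpow_le_sum_rpow _ (by norm_num) (by norm_num) _).trans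
    (Finset.sum_le_sum fun k _ => ?_)
  refine (ENNReal.rpow_le_rpow (enorm_sum_le _ _) (by norm_num)).trans ?_
  refine (sum_rpow_le_sum_rpow _ (by norm_num) (by norm_num) _).trans
    (Finset.sum_le_sum fun l _ => ?_)
  have e1 : ∀ a : ℝ, ‖(a : ℂ)‖ₑ = ‖a‖ₑ := fun a => by
    rw [← ofReal_norm, ← ofReal_norm, Complex.norm_real]
  rw [enorm_mul, enorm_mul, e1, e1, ENNReal.mul_rpow_of_nonneg _ _ (by norm_num),
    ENNReal.mul_rpow_of_nonneg _ _ (by norm_num), hpow, hpow, hpow ‖moment _ _ _ _‖ₑ]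
  have h : ∀ i k, (‖propagator (modes lam κ Λ) (modeParam lam κ Λ) t i k‖ₑ ^ (1 / 2 : ℝ)) ^
      (1 / 3 : ℝ) ≤ supPropagator lam κ Λ i k ^ (1 / 3 : ℝ) := fun i k =>
    ENNReal.rpow_le_rpow (le_iSup (fun t => ‖propagator (modes lam κ Λ) (modeParam lam κ Λ) t
      i k‖ₑ ^ (1 / 2 : ℝ)) t) (by norm_num)
  exact mul_le_mul_left (mul_le_mul' (h _ _) (h _ _)) _

end Model

section Average

variable {d : ℕ} {lam : ℝ} {Λ : Finset (Fin d → ℤ)} {Ω : Type*} [MeasurableSpace Ω] {P : Measure Ω}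
  {k : (Fin d → ℤ) → Ω → ℝ}

/-- The decay of the singular eigenfunction correlators passes to the propagator. -/
lemma lintegral_supPropagator_le (hlam : 0 < lam) {kmax : ℝ}
    (hgood : ∀ᵐ ω ∂P, ∀ x, 0 < k x ω ∧ k x ω ≤ kmax) {C₀ E : ℝ} (hE : 0 ≤ E) (i j : Λ ⊕ Λ)
    (hcorr : ∫⁻ ω, singCorr lam (fun z => k z ω) Λ (1 / 2) (site i) (site j) ∂P ≤
      ENNReal.ofReal (C₀ * E)) :
    ∫⁻ ω, supPropagator lam (fun z => k z ω) Λ i j ∂P ≤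
      ENNReal.ofReal (specBound d lam kmax ^ (1 / 2 : ℝ) * |C₀| * E) := by
  have hB : 0 ≤ specBound d lam kmax := zero_le_one.trans (one_le_specBound d hlam kmax)
  calc ∫⁻ ω, supPropagator lam (fun z => k z ω) Λ i j ∂P
      ≤ ∫⁻ ω, ENNReal.ofReal (specBound d lam kmax) ^ (1 / 2 : ℝ) *
          singCorr lam (fun z => k z ω) Λ (1 / 2) (site i) (site j) ∂P := by
        refine lintegral_mono_ae ?_
        filter_upwards [hgood] with ω hω
        exact iSup_le fun t => enorm_propagator_rpow_le hlam (fun x => (hω x.1).1)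
          (fun x => (hω x.1).2) t (by norm_num) i j
    _ = ENNReal.ofReal (specBound d lam kmax) ^ (1 / 2 : ℝ) *
          ∫⁻ ω, singCorr lam (fun z => k z ω) Λ (1 / 2) (site i) (site j) ∂P :=
        lintegral_const_mul' _ _ (ENNReal.rpow_ne_top_of_nonneg (by norm_num) ENNReal.ofReal_ne_top)
    _ ≤ ENNReal.ofReal (specBound d lam kmax) ^ (1 / 2 : ℝ) * ENNReal.ofReal (|C₀| * E) :=
        mul_le_mul_right (hcorr.trans (ENNReal.ofReal_le_ofReal
          (mul_le_mul_of_nonneg_right (le_abs_self _) hE))) _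
    _ = _ := by
        rw [ENNReal.ofReal_rpow_of_nonneg hB (by norm_num),
          ← ENNReal.ofReal_mul (by positivity), mul_assoc]

/-- The factor of the average of the square root of a second moment that does not depend on `n`. -/
def momentBound (ν : ℝ → ℝ≥0∞) (kmax : ℝ) : ℝ≥0∞ :=
  ENNReal.ofReal ((1 + |kmax|) ^ (1 / 2 : ℝ)) *
    (3 + 2 * (essSup ν volume * ∫⁻ r, cutInvRoot r))

lemma momentBound_lt_top {ν : ℝ → ℝ≥0∞} (hν_bdd : essSup ν volume < ∞) (kmax : ℝ) :
    momentBound ν kmax < ∞ :=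
  ENNReal.mul_lt_top ENNReal.ofReal_lt_top (ENNReal.add_lt_top.2 ⟨by simp,
    ENNReal.mul_lt_top (by simp) (ENNReal.mul_lt_top hν_bdd lintegral_cutInvRoot_lt_top)⟩)

/-- The average is finite because `r^{-1/4}` is integrable at zero and the density is bounded. -/
lemma lintegral_moment_le [IsProbabilityMeasure P] {kmax : ℝ} {ν : ℝ → ℝ≥0∞} (hν : Measurable ν)
    (hν_bdd : essSup ν volume < ∞) (hk_law : ∀ x, HasLaw (k x) (volume.withDensity ν) P)
    (hgood : ∀ᵐ ω ∂P, ∀ x, 0 < k x ω ∧ k x ω ≤ kmax) (n : Λ → ℕ) (i j : Λ ⊕ Λ) :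
    ∫⁻ ω, ‖moment (fun x : Λ => k x.1 ω) n i j‖ₑ ^ (1 / 2 : ℝ) ∂P ≤
      ENNReal.ofReal ((1 + 2 * ((Finset.univ.sup n : ℕ) : ℝ)) ^ (1 / 2 : ℝ) *
        (momentBound ν kmax).toReal) := by
  rw [ENNReal.ofReal_mul (by positivity), ENNReal.ofReal_toReal (momentBound_lt_top hν_bdd kmax).ne]
  have hm : AEMeasurable (fun ω => cutInvRoot (k (site i).1 ω)) P :=
    measurable_cutInvRoot.comp_aemeasurable (hk_law _).aemeasurable
  calc ∫⁻ ω, ‖moment (fun x : Λ => k x.1 ω) n i j‖ₑ ^ (1 / 2 : ℝ) ∂P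
      ≤ ∫⁻ ω, ENNReal.ofReal ((1 + 2 * ((Finset.univ.sup n : ℕ) : ℝ)) ^ (1 / 2 : ℝ)) *
          (ENNReal.ofReal ((1 + |kmax|) ^ (1 / 2 : ℝ)) *
            (3 + 2 * cutInvRoot (k (site i).1 ω))) ∂P := by
        refine lintegral_mono_ae ?_
        filter_upwards [hgood] with ω hω
        exact enorm_moment_rpow_le (c := fun x : Λ => k x.1 ω) (fun x => (hω x.1).1)
          (fun x => (hω x.1).2) n i j
    _ = ENNReal.ofReal ((1 + 2 * ((Finset.univ.sup n : ℕ) : ℝ)) ^ (1 / 2 : ℝ)) *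
          (ENNReal.ofReal ((1 + |kmax|) ^ (1 / 2 : ℝ)) *
            (3 + 2 * ∫⁻ ω, cutInvRoot (k (site i).1 ω) ∂P)) := by
        rw [lintegral_const_mul' _ _ ENNReal.ofReal_ne_top,
          lintegral_const_mul' _ _ ENNReal.ofReal_ne_top, lintegral_add_left measurable_const,
          lintegral_const_mul' _ _ (by simp), lintegral_const, measure_univ, mul_one]
    _ ≤ _ := by
        unfold momentBound
        gcongr
        exact lintegral_cutInvRoot_comp_le hν (hk_law _)

lemma sum_sum_site_eq {V : Type} [Fintype V] [DecidableEq V] (F : V → ℝ≥0∞) :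
    ∑ i : V ⊕ V, ∑ j : V ⊕ V, (if site i = site j then F (site i) else 0) = 4 * ∑ z, F z := by
  have e : ∀ z, ∑ y, (if z = y then F z else 0) = F z := fun z => by simp
  have h : ∀ i : V ⊕ V, ∑ j : V ⊕ V, (if site i = site j then F (site i) else 0) =
      2 * F (site i) := fun i => by
    rw [Fintype.sum_sum_type]
    exact (congrArg₂ (· + ·) (e _) (e _)).trans (two_mul _).symm
  simp only [h, Fintype.sum_sum_type]
  change ∑ x, 2 * F x + ∑ x, 2 * F x = _
  rw [← Finset.mul_sum]
  ring

/-- Hölder's inequality with exponents `1/3` splits the average into those of two entries of the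
propagator and of one second moment. -/
lemma lintegral_supQuench_le [IsProbabilityMeasure P] (hlam : 0 < lam) {kmax : ℝ}
    {ν : ℝ → ℝ≥0∞} (hν : Measurable ν) (hν_bdd : essSup ν volume < ∞)
    (hk_law : ∀ x, HasLaw (k x) (volume.withDensity ν) P)
    (hgood : ∀ᵐ ω ∂P, ∀ x, 0 < k x ω ∧ k x ω ≤ kmax) {C₀ η : ℝ} (hη : 0 < η)
    {a b : Fin d → ℤ}
    (hcorr : ∀ x y : Finset.Icc a b,
      ∫⁻ ω, singCorr lam (fun z => k z ω) (Finset.Icc a b) (1 / 2) x y ∂P ≤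
        ENNReal.ofReal (C₀ * Real.exp (-η * (dist1 x.1 y.1 : ℝ))))
    (n : Finset.Icc a b → ℕ) (x y : Finset.Icc a b) :
    ∫⁻ ω, supQuench lam (fun z => k z ω) (Finset.Icc a b)
        (prodState (fun z => k z ω) (Finset.Icc a b) n) (1 / 6) x y ∂P ≤
      ENNReal.ofReal (16 * ((specBound d lam kmax ^ (1 / 2 : ℝ) * |C₀|) ^ (2 / 3 : ℝ) *
          (momentBound ν kmax).toReal ^ (1 / 3 : ℝ) * expSum (η / 6) ^ d) *
        (1 + 2 * ((Finset.univ.sup n : ℕ) : ℝ)) ^ (1 / 6 : ℝ) *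
        Real.exp (-(η / 6) * (dist1 x.1 y.1 : ℝ))) := by
  have hpos : ∀ᵐ ω ∂P, ∀ x, 0 < k x ω := hgood.mono fun ω h x => (h x).1
  have hk : ∀ x, AEMeasurable (k x) P := fun x => (hk_law x).aemeasurable
  have hB : 0 ≤ specBound d lam kmax := zero_le_one.trans (one_le_specBound d hlam kmax)
  have hS : ∀ i j : Finset.Icc a b ⊕ Finset.Icc a b,
      AEMeasurable (fun ω => supPropagator lam (fun z => k z ω) (Finset.Icc a b) i j) P :=
    fun i j => aemeasurable_iSup_propagator hk hlam hpos _ i j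
  have hM : ∀ i j : Finset.Icc a b ⊕ Finset.Icc a b, AEMeasurable
      (fun ω => ‖moment (fun x : Finset.Icc a b => k x.1 ω) n i j‖ₑ ^ (1 / 2 : ℝ)) P :=
    fun i j => (aemeasurable_moment hk n i j).enorm.pow_const _
  have hT : ∀ i j i' j' : Finset.Icc a b ⊕ Finset.Icc a b, AEMeasurable (fun ω =>
      supPropagator lam (fun z => k z ω) (Finset.Icc a b) i i' ^ (1 / 3 : ℝ) *
      supPropagator lam (fun z => k z ω) (Finset.Icc a b) j j' ^ (1 / 3 : ℝ) *
      (‖moment (fun x : Finset.Icc a b => k x.1 ω) n i' j'‖ₑ ^ (1 / 2 : ℝ)) ^ (1 / 3 : ℝ)) P :=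
    fun i j i' j' => (((hS i i').pow_const _).mul ((hS j j').pow_const _)).mul
      ((hM i' j').pow_const _)
  set K : ℝ := specBound d lam kmax ^ (1 / 2 : ℝ) * |C₀| with hKdef
  have hK : 0 ≤ K := by positivity
  set D : ℝ := (momentBound ν kmax).toReal
  have hD : 0 ≤ D := ENNReal.toReal_nonneg
  set N : ℝ := ((Finset.univ.sup n : ℕ) : ℝ)
  have hN : 0 ≤ N := Nat.cast_nonneg _
  have hG : 0 ≤ expSum (η / 6) := tsum_nonneg fun _ => (Real.exp_pos _).le
  set A : ℝ := K ^ (2 / 3 : ℝ) * D ^ (1 / 3 : ℝ) * (1 + 2 * N) ^ (1 / 6 : ℝ) with hA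
  have hA0 : 0 ≤ A := by positivity
  set F : Finset.Icc a b → ℝ := fun z =>
    A * Real.exp (-(2 * (η / 6)) * ((dist1 x.1 z.1 : ℝ) + (dist1 y.1 z.1 : ℝ))) with hF
  have hF0 : ∀ z, 0 ≤ F z := fun z => by positivity
  have hprop : ∀ i j : Finset.Icc a b ⊕ Finset.Icc a b,
      ∫⁻ ω, supPropagator lam (fun z => k z ω) (Finset.Icc a b) i j ∂P ≤
        ENNReal.ofReal (K * Real.exp (-η * (dist1 (site i).1 (site j).1 : ℝ))) := fun i j =>
    lintegral_supPropagator_le hlam hgood (Real.exp_pos _).le i j (hcorr _ _)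
  have hterm : ∀ (α β : Fin 2) (i j : Finset.Icc a b ⊕ Finset.Icc a b), ∫⁻ ω,
      supPropagator lam (fun z => k z ω) (Finset.Icc a b) (coord α x) i ^ (1 / 3 : ℝ) *
      supPropagator lam (fun z => k z ω) (Finset.Icc a b) (coord β y) j ^ (1 / 3 : ℝ) *
      (‖moment (fun x : Finset.Icc a b => k x.1 ω) n i j‖ₑ ^ (1 / 2 : ℝ)) ^ (1 / 3 : ℝ) ∂P ≤
      if site i = site j then ENNReal.ofReal (F (site i)) else 0 := fun α β i j => by
    split_ifs with hij
    · refine (lintegral_mul_three_le (hS _ _) (hS _ _) (hM _ _)).trans ?_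
      refine (mul_le_mul' (mul_le_mul' (ENNReal.rpow_le_rpow (hprop _ _) (by norm_num))
        (ENNReal.rpow_le_rpow (hprop _ _) (by norm_num))) (ENNReal.rpow_le_rpow
        (lintegral_moment_le hν hν_bdd hk_law hgood n i j) (by norm_num))).trans (le_of_eq ?_)
      rw [site_coord, site_coord, ← hij, ENNReal.ofReal_rpow_of_nonneg (by positivity) (by norm_num),
        ENNReal.ofReal_rpow_of_nonneg (by positivity) (by norm_num),
        ENNReal.ofReal_rpow_of_nonneg (by positivity) (by norm_num),
        ← ENNReal.ofReal_mul (by positivity), ← ENNReal.ofReal_mul (by positivity)]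
      congr 1
      rw [Real.mul_rpow hK (Real.exp_pos _).le, Real.mul_rpow hK (Real.exp_pos _).le,
        Real.mul_rpow (by positivity) hD, ← Real.rpow_mul (by positivity), ← Real.exp_mul,
        ← Real.exp_mul, hF, hA]
      have e1 : K ^ (2 / 3 : ℝ) = K ^ (1 / 3 : ℝ) * K ^ (1 / 3 : ℝ) := by
        rw [← Real.rpow_add_of_nonneg hK (by norm_num) (by norm_num)]
        norm_num
      have e2 : Real.exp (-(2 * (η / 6)) * ((dist1 x.1 (site i).1 : ℝ) +
          (dist1 y.1 (site i).1 : ℝ))) = Real.exp (-η * (dist1 x.1 (site i).1 : ℝ) * (1 / 3)) *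
          Real.exp (-η * (dist1 y.1 (site i).1 : ℝ) * (1 / 3)) := by
        rw [← Real.exp_add]
        congr 1
        ring
      simp only [e2]
      rw [e1, show (1 / 2 * (1 / 3) : ℝ) = 1 / 6 by norm_num]
      ring
    · simp [moment_eq_zero _ n hij]
  calc ∫⁻ ω, supQuench lam (fun z => k z ω) (Finset.Icc a b)
        (prodState (fun z => k z ω) (Finset.Icc a b) n) (1 / 6) x y ∂P
      ≤ ∫⁻ ω, ∑ α : Fin 2, ∑ β : Fin 2, ∑ i, ∑ j,
          supPropagator lam (fun z => k z ω) (Finset.Icc a b) (coord α x) i ^ (1 / 3 : ℝ) *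
          supPropagator lam (fun z => k z ω) (Finset.Icc a b) (coord β y) j ^ (1 / 3 : ℝ) *
          (‖moment (fun x : Finset.Icc a b => k x.1 ω) n i j‖ₑ ^ (1 / 2 : ℝ)) ^ (1 / 3 : ℝ) ∂P := by
        refine lintegral_mono_ae ?_
        filter_upwards [hpos] with ω hω
        exact supQuench_le hlam (fun x => hω x.1) n x y
    _ = ∑ α : Fin 2, ∑ β : Fin 2, ∑ i, ∑ j, ∫⁻ ω,
          supPropagator lam (fun z => k z ω) (Finset.Icc a b) (coord α x) i ^ (1 / 3 : ℝ) *
          supPropagator lam (fun z => k z ω) (Finset.Icc a b) (coord β y) j ^ (1 / 3 : ℝ) *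
          (‖moment (fun x : Finset.Icc a b => k x.1 ω) n i j‖ₑ ^ (1 / 2 : ℝ)) ^ (1 / 3 : ℝ) ∂P := by
        rw [lintegral_finsetSum' _ fun α _ => Finset.aemeasurable_fun_sum _ fun β _ =>
          Finset.aemeasurable_fun_sum _ fun i _ => Finset.aemeasurable_fun_sum _ fun j _ =>
            hT _ _ i j]
        refine Finset.sum_congr rfl fun α _ => ?_
        rw [lintegral_finsetSum' _ fun β _ => Finset.aemeasurable_fun_sum _ fun i _ =>
          Finset.aemeasurable_fun_sum _ fun j _ => hT _ _ i j]
        refine Finset.sum_congr rfl fun β _ => ?_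
        rw [lintegral_finsetSum' _ fun i _ => Finset.aemeasurable_fun_sum _ fun j _ => hT _ _ i j]
        exact Finset.sum_congr rfl fun i _ => lintegral_finsetSum' _ fun j _ => hT _ _ i j
    _ ≤ ∑ α : Fin 2, ∑ β : Fin 2, ∑ i : Finset.Icc a b ⊕ Finset.Icc a b,
          ∑ j : Finset.Icc a b ⊕ Finset.Icc a b,
          (if site i = site j then ENNReal.ofReal (F (site i)) else 0) :=
        Finset.sum_le_sum fun α _ => Finset.sum_le_sum fun β _ => Finset.sum_le_sum fun i _ =>
          Finset.sum_le_sum fun j _ => hterm α β i j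
    _ = ENNReal.ofReal (16 * ∑ z, F z) := by
        simp only [sum_sum_site_eq fun z => ENNReal.ofReal (F z), Finset.sum_const,
          Finset.card_univ, Fintype.card_fin]
        rw [← ENNReal.ofReal_sum_of_nonneg fun z _ => hF0 z, ENNReal.ofReal_mul (by norm_num),
          smul_smul, nsmul_eq_mul, ← mul_assoc]
        norm_num
    _ ≤ _ := by
        refine ENNReal.ofReal_le_ofReal ?_
        have h := sum_exp_two_centers_le (c := η / 6) (by positivity) a b x.1 y.1
        rw [← Finset.sum_coe_sort] at h
        rw [← Finset.mul_sum]
        refine (mul_le_mul_of_nonneg_left (mul_le_mul_of_nonneg_left h hA0) (by norm_num)).trans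
          (le_of_eq ?_)
        rw [hA]
        ring

end Average
end Oscillator

end

open Oscillator

theorem corollary6p3 {d : ℕ} (hd : 1 ≤ d) {lam : ℝ} (hlam : 0 < lam)
    {Ω : Type*} [MeasurableSpace Ω] (P : Measure Ω) [IsProbabilityMeasure P]
    (k : (Fin d → ℤ) → Ω → ℝ) (kmax : ℝ) (ν : ℝ → ℝ≥0∞)
    (hν : Measurable ν) (hν_bdd : essSup ν volume < ∞)
    (hν_supp : (volume.withDensity ν).support = Set.Icc 0 kmax)
    (hk_law : ∀ x, HasLaw (k x) (volume.withDensity ν) P)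
    (hk_indep : iIndepFun k P)
    (C₀ η : ℝ) (hη : 0 < η)
    (hcorr : ∀ (a b : Fin d → ℤ) (x y : Finset.Icc a b),
      ∫⁻ ω, singCorr lam (fun z => k z ω) (Finset.Icc a b) (1 / 2) x y ∂P ≤
        ENNReal.ofReal (C₀ * Real.exp (-η * (dist1 x.1 y.1 : ℝ)))) :
    ∃ C : ℝ, ∀ (a b : Fin d → ℤ), a ≤ b → ∀ n : Finset.Icc a b → ℕ,
      (∀ᵐ ω ∂P, QuenchWellDefined lam (fun z => k z ω) (Finset.Icc a b)
        (prodState (fun z => k z ω) (Finset.Icc a b) n)) ∧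
      ∀ x y : Finset.Icc a b,
        AEMeasurable (fun ω => supQuench lam (fun z => k z ω) (Finset.Icc a b)
          (prodState (fun z => k z ω) (Finset.Icc a b) n) (1 / 6) x y) P ∧
        ∫⁻ ω, supQuench lam (fun z => k z ω) (Finset.Icc a b)
          (prodState (fun z => k z ω) (Finset.Icc a b) n) (1 / 6) x y ∂P ≤
          ENNReal.ofReal (C * (1 + 2 * ((Finset.univ.sup n : ℕ) : ℝ)) ^ (1 / 6 : ℝ) *
            Real.exp (-(η / 6) * (dist1 x.1 y.1 : ℝ))) := by
  have hgood : ∀ᵐ ω ∂P, ∀ x, 0 < k x ω ∧ k x ω ≤ kmax :=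
    ae_all_iff.2 fun x => ae_pos_and_le (hk_law x) hν_supp
  have hk : ∀ x, AEMeasurable (k x) P := fun x => (hk_law x).aemeasurable
  refine ⟨16 * ((specBound d lam kmax ^ (1 / 2 : ℝ) * |C₀|) ^ (2 / 3 : ℝ) *
    (momentBound ν kmax).toReal ^ (1 / 3 : ℝ) * expSum (η / 6) ^ d), fun a b _ n => ⟨?_, ?_⟩⟩
  · filter_upwards [hgood] with ω hω
    exact quenchWellDefined_prodState hlam (fun x => (hω x.1).1) n
  · exact fun x y => ⟨aemeasurable_supQuench hk hlam (hgood.mono fun ω h x => (h x).1) n _ x y,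
      lintegral_supQuench_le hlam hν hν_bdd hk_law hgood hη (hcorr a b) n x y⟩
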